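/- Let $m\ge 1$, let $c=(c_1,\dots,c_m)$ be a vector of positive integers with $|c|=c_1+\dots+c_m\ge 2$. A $c$-monomial is a monomial $x^a=x_1^{a_1}\cdots x_m^{a_m}$ with $0\le a_i\le c_i$ for all $i$. A $c$-multicomplex is a nonempty set $M$ of $c$-monomials closed under taking divisors; it is proper if it is not the set of all $c$-monomials. Let $M$ be a proper $c$-multicomplex. Its Murai (generalized Bier) sphere $\mathrm{Bier}_c(M)$ is the simplicial complex on the set $\tilde X=\{x_i^{(j)} : 1\le i\le m,\ 0\le j\le c_i\}$ whose maximal faces are the sets $$\tilde X\setminus\{x_1^{(a_1)},\dots,x_m^{(a_m)},x_i^{(j)}\},\qquad x^a\in M,\ a_i<j\le c_i,\ x^a x_i^{\,j-a_i}\notin M .$$ A simplicial complex is flag if all its minimal non-faces have at most two elements. It is polytopal if it is isomorphic to the boundary complex of a simplicial $d$-polytope $Q$ for some $d$; for $\mathrm{Bier}_c(M)$, we then denote by $P_{M,c}$ the simple $d$-polytope dual to $Q$, which is determined up to combinatorial equivalence (isomorphism of face lattices). Theorem. $\mathrm{Bier}_c(M)$ is flag if and only if it is polytopal and $P_{M,c}$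 is combinatorially equivalent to one of the following polytopes: 1. $I^n$ with $n\ge 1$; 2. $I^n\times P_5$ with $n\ge 0$; 3. $I^n\times P_6$ with $n\ge 0$; 4. $I^n\times Q_2^3$ with $n\ge 0$. Here $I^n$ is the $n$-cube, $P_k$ is the $k$-gon, and $Q_2^3$ is the simple $3$-polytope obtained from the cube $I^3$ by cutting off two adjacent edges by planes in general position. Moreover, in this case $P_{M,c}$ is a flag nestohedron: writing $d=\dim P_{M,c}$, there is a building set $B$ on $[d+1]$ (a family of nonempty subsets of $[d+1]$ that contains all singletons and contains $S\cup T$ whenever $S,T\in B$ and $S\cap T\ne\varnothing$) such that the Minkowski sum $\sum_{S\in B}\mathrm{conv}\{e_i : i\in S\}\subset\mathbb R^{d+1}$ is a $d$-dimensional simple flag polytope (any set of pairwise intersecting facets has a common point) combinatorially equivalent to $P_{M,c}$. -/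

import Mathlib

open scoped Pointwise

noncomputable section

namespace MuraiSphere

/-! ### Simplicial complexes

A simplicial complex on `V` is a `PreAbstractSimplicialComplex V`: a downward closed family of
nonempty finite subsets of `V`. The empty face is left implicit, and elements of `V` that are not
faces (ghost vertices) are allowed. -/

/-- The simplicial complex generated by a family `S` of finite sets. -/
def generatedBy {V : Type*} (S : Set (Finset V)) : PreAbstractSimplicialComplex V where
  faces := {σ | σ.Nonempty ∧ ∃ τ ∈ S, σ ⊆ τ}
  isRelLowerSet_faces := by
    rintro σ ⟨hσ, τ, hτ, hστ⟩
    exact ⟨hσ, fun ρ hρ hne => ⟨hne, τ, hτ, hρ.trans hστ⟩⟩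

/-- A complex is flag if all its minimal non-faces have cardinality at most two. -/
def IsFlag {V : Type*} (K : PreAbstractSimplicialComplex V) : Prop :=
  ∀ σ : Finset V, σ.Nonempty → σ ∉ K.faces →
    (∀ τ : Finset V, τ.Nonempty → τ ⊂ σ → τ ∈ K.faces) → σ.card ≤ 2

/-- Combinatorial equivalence (simplicial isomorphism) of complexes: their face posets are
isomorphic. Ghost vertices play no role. -/
def ComplexIso {V W : Type*} (K : PreAbstractSimplicialComplex V)
    (L : PreAbstractSimplicialComplex W) : Prop :=
  Nonempty (K.faces ≃o L.faces)

/-! ### Multicomplexes and Murai spheres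

A monomial `x^a` in the variables `x_1, …, x_m` is represented by its exponent vector
`a : Fin m → ℕ`; divisibility of monomials is the componentwise order. -/

/-- A `c`-multicomplex: a nonempty set of `c`-monomials closed under taking divisors. -/
structure Multicomplex {m : ℕ} (c : Fin m → ℕ) where
  carrier : Set (Fin m → ℕ)
  nonempty : carrier.Nonempty
  le_of_mem : ∀ a ∈ carrier, a ≤ c
  mem_of_le : ∀ a ∈ carrier, ∀ b, b ≤ a → b ∈ carrier

/-- A `c`-multicomplex is proper if it is not the set of all `c`-monomials. -/
def Multicomplex.IsProper {m : ℕ} {c : Fin m → ℕ} (M : Multicomplex c) : Prop :=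
  M.carrier ≠ {a | a ≤ c}

/-- The set `X̃` of the elements `x_i^{(j)}`, `0 ≤ j ≤ c_i`; `⟨i, j⟩` stands for `x_i^{(j)}`. -/
abbrev Vertex {m : ℕ} (c : Fin m → ℕ) : Type := Σ i : Fin m, Fin (c i + 1)

/-- `F_c(x^a)`, the complement of `{x_1^{(a_1)}, …, x_m^{(a_m)}}` in `X̃`. -/
def facetF {m : ℕ} (c : Fin m → ℕ) (a : Fin m → ℕ) : Finset (Vertex c) :=
  Finset.univ.filter fun v => (v.2 : ℕ) ≠ a v.1

/-- The Murai (generalized Bier) sphere of `M`: it is generated by the sets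
`F_c(x^a) ∖ {x_i^{(j)}}` with `x^a ∈ M`, `a_i < j ≤ c_i` and `x^a x_i^{j - a_i} ∉ M`. -/
def muraiSphere {m : ℕ} {c : Fin m → ℕ} (M : Multicomplex c) :
    PreAbstractSimplicialComplex (Vertex c) :=
  generatedBy {τ | ∃ a ∈ M.carrier, ∃ v : Vertex c, a v.1 < (v.2 : ℕ) ∧
    Function.update a v.1 (v.2 : ℕ) ∉ M.carrier ∧ τ = (facetF c a).erase v}

/-! ### Convex polytopes

The faces of a polytope `P` are its exposed subsets; these include `∅` and `P` itself. -/

section Polytopes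

variable {E F : Type*} [AddCommGroup E] [Module ℝ E] [TopologicalSpace E]
  [AddCommGroup F] [Module ℝ F] [TopologicalSpace F]

/-- A (convex) polytope: the convex hull of a nonempty finite set of points. -/
def IsPolytope (P : Set E) : Prop :=
  ∃ s : Finset E, s.Nonempty ∧ P = convexHull ℝ (s : Set E)

/-- The dimension of a polytope, i.e. the dimension of its affine hull. -/
def polytopeDim (P : Set E) : ℕ := Module.finrank ℝ (vectorSpan ℝ P)

/-- The face lattice of a polytope, ordered by inclusion. -/
abbrev FaceLattice (P : Set E) : Type _ := {A : Set E // IsExposed ℝ P A}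

/-- Combinatorial equivalence of polytopes: their face lattices are isomorphic. -/
def CombEquiv (P : Set E) (Q : Set F) : Prop :=
  Nonempty (FaceLattice P ≃o FaceLattice Q)

/-- Combinatorial duality of polytopes: their face lattices are anti-isomorphic. -/
def CombDual (P : Set E) (Q : Set F) : Prop :=
  Nonempty (FaceLattice P ≃o (FaceLattice Q)ᵒᵈ)

/-- The facets of a polytope: its maximal proper nonempty faces. -/
def IsFacet (P A : Set E) : Prop :=
  A.Nonempty ∧ IsExposed ℝ P A ∧ A ≠ P ∧
    ∀ B : Set E, IsExposed ℝ P B → B ≠ P → A ⊆ B → B = A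

/-- A polytope is simple if each vertex lies in exactly `dim P` facets. -/
def IsSimplePolytope (P : Set E) : Prop :=
  IsPolytope P ∧
    ∀ v ∈ P.extremePoints ℝ, {A : Set E | IsFacet P A ∧ v ∈ A}.ncard = polytopeDim P

/-- A polytope is simplicial if each proper face is a simplex, i.e. has affinely independent
vertices. -/
def IsSimplicialPolytope (Q : Set E) : Prop :=
  IsPolytope Q ∧ ∀ A : Set E, IsExposed ℝ Q A → A ≠ Q →
    AffineIndependent ℝ ((↑) : A.extremePoints ℝ → E)

/-- The boundary of a simplicial polytope `Q` as a simplicial complex: its simplices are the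
nonempty sets of vertices of `Q` that lie in a common proper face. -/
def boundaryComplex (Q : Set E) : PreAbstractSimplicialComplex E :=
  generatedBy {τ | (τ : Set E) ⊆ Q.extremePoints ℝ ∧
    ∃ A : Set E, IsExposed ℝ Q A ∧ A ≠ Q ∧ (τ : Set E) ⊆ A}

/-- A simple polytope is flag if every set of pairwise intersecting facets has a common point. -/
def IsFlagPolytope (P : Set E) : Prop :=
  IsSimplePolytope P ∧ ∀ S : Set (Set E), (∀ A ∈ S, IsFacet P A) →
    (∀ A ∈ S, ∀ B ∈ S, (A ∩ B).Nonempty) → (P ∩ ⋂₀ S).Nonempty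

end Polytopes

/-- `K` is a polytopal sphere: it is isomorphic to the boundary of a simplicial `d`-polytope. -/
def IsPolytopalSphere {V : Type*} (K : PreAbstractSimplicialComplex V) : Prop :=
  ∃ (d : ℕ) (Q : Set (Fin d → ℝ)),
    IsSimplicialPolytope Q ∧ polytopeDim Q = d ∧ ComplexIso K (boundaryComplex Q)

/-- `K = K_P`: the complex `K` is isomorphic to the boundary of a simplicial `d`-polytope `Q`, and
`P` is a simple `d`-polytope dual to `Q`. -/
def IsNerveComplexOf {V : Type*} (K : PreAbstractSimplicialComplex V) {d : ℕ}
    (P : Set (Fin d → ℝ)) : Prop :=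
  IsSimplePolytope P ∧ polytopeDim P = d ∧
    ∃ Q : Set (Fin d → ℝ), IsSimplicialPolytope Q ∧ polytopeDim Q = d ∧
      ComplexIso K (boundaryComplex Q) ∧ CombDual P Q

/-! ### Nestohedra -/

/-- Building sets on `{0, …, N - 1}`. -/
structure IsBuildingSet {N : ℕ} (B : Finset (Finset (Fin N))) : Prop where
  nonempty_of_mem : ∀ S ∈ B, S.Nonempty
  singleton_mem : ∀ i : Fin N, {i} ∈ B
  union_mem : ∀ S ∈ B, ∀ T ∈ B, (S ∩ T).Nonempty → S ∪ T ∈ B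

/-- The Minkowski sum over `S ∈ B` of the simplices `conv {e_i | i ∈ S}`. -/
def nestohedron {N : ℕ} (B : Finset (Finset (Fin N))) : Set (Fin N → ℝ) :=
  ∑ S ∈ B, convexHull ℝ ((fun i : Fin N => (Pi.single i 1 : Fin N → ℝ)) '' (S : Set (Fin N)))

/-- The combinatorial type of `P ⊆ ℝ^d` is that of a flag `d`-dimensional nestohedron, given by a
building set on `d + 1` elements. -/
def IsFlagNestohedron {d : ℕ} (P : Set (Fin d → ℝ)) : Prop :=
  ∃ B : Finset (Finset (Fin (d + 1))), IsBuildingSet B ∧ polytopeDim (nestohedron B) = d ∧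
    IsFlagPolytope (nestohedron B) ∧ CombEquiv P (nestohedron B)

/-! ### The polytopes of the classification -/

/-- The cube `I^n`. -/
def cube (n : ℕ) : Set (Fin n → ℝ) := {x | ∀ i, 0 ≤ x i ∧ x i ≤ 1}

/-- The `k`-gon (for `k ≥ 3`), realized with the vertices `(j, j²)`, `0 ≤ j < k`, on a parabola. -/
def polygon (k : ℕ) : Set (Fin 2 → ℝ) :=
  convexHull ℝ (Set.range fun j : Fin k => ![(j : ℝ), (j : ℝ) ^ 2])

/-- `Q_2^3`: the cube `I^3` with the two adjacent edges `x_0 = x_1 = 0` and `x_0 = x_2 = 0` cut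
off, by two planes that are parallel to the edges and in general position. -/
def cubeTwoEdgeCuts : Set (Fin 3 → ℝ) :=
  {x | x ∈ cube 3 ∧ 1 / 2 ≤ x 0 + x 1 ∧ 1 / 4 ≤ x 0 + x 2}

/-- `P` has the combinatorial type of one of the polytopes `I^n` with `n ≥ 1`, `I^n × P_5`,
`I^n × P_6`, `I^n × Q_2^3` with `n ≥ 0`. -/
def IsListed {d : ℕ} (P : Set (Fin d → ℝ)) : Prop :=
  (∃ n : ℕ, 1 ≤ n ∧ CombEquiv P (cube n)) ∨
  (∃ n : ℕ, CombEquiv P (cube n ×ˢ polygon 5)) ∨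
  (∃ n : ℕ, CombEquiv P (cube n ×ˢ polygon 6)) ∨
  (∃ n : ℕ, CombEquiv P (cube n ×ˢ cubeTwoEdgeCuts))

end MuraiSphere

end

/-!
A flag Murai sphere is recognized from its graph, and simple polytopes are recognized from their
vertex-facet incidences; the theorem is obtained by matching the two.

*Polytopes.* A `FacetSystem s P` presents `P` by inequalities and vertices whose incidences are a
given family `s` of finite sets. Since every edge at a vertex leads to another vertex
(`IsClosedFamily`), linear programming (`FacetSystem.exists_max`) shows that the faces of `P` are
exactly the sets where a subset of some `s k` is tight. Hence `s` determines the face lattice, so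
polytopes with the same incidences are combinatorially equivalent; the polar polytope is simplicial
with boundary complex generated by `s` (`FacetSystem.exists_isNerveComplexOf`). Conversely, a
complex whose dual simple polytope has flag incidences is flag (`isFlag_of_combDual`). Each polytope
of the list, and a nestohedron with the same incidences, is presented in this way (`IsFlagModel`);
products with cubes correspond to joins of incidences, and to adjoining to a building set a new
point and the whole set (`NestedSystem.cone`).

*Murai spheres.* A set of vertices is a face if and only if it is avoided by a member and by a
non-member of `M` (`mem_muraiSphere_iff`). If the sphere is flag, three kinds of minimal non-faces
are therefore small: minimal non-members of `M` have degree at most two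
(`exists_notMem_degree_le`), maximal members have codegree at most two
(`exists_maximal_codegree_le`), and the row of a variable with `c_i ≥ 2` is not a minimal non-face
(`row_condition`). So the complement of `M` is generated by some `x_i`, `x_i²` and `x_i x_j`, and
a maximal member `x^(c - u)` with `u` of degree at most two meets all generators. Going through the
possible `u`, at most four variables occur in the generators, with nineteen possibilities
(`IsFlagGenerators.hasFlagCore`); every other variable has `c_i = 1` and only adds a pair of
opposite vertices. For each possibility, the graph of the sphere is made of the facet adjacencies of a point,
a pentagon, a hexagon or the cube with two cut edges, and of vertices that are matched by the
non-edges; this is a finite verification (`IsFlagCore`). As flag complexes are determined by their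
graphs, the sphere is the join of a cross-polytope and one of the four complexes
(`exists_complexIso_of_core`).
-/

namespace MuraiSphere

/-! ### Simple polytopes from their vertex-facet incidences -/

/-- Combinatorial axioms on a family `s k` of finite sets, thought of as the sets of facets through
the vertices `k` of a simple polytope: each edge at a vertex leads to another vertex, and each facet
has a vertex. -/
structure IsClosedFamily {κ ι : Type*} (s : κ → Finset ι) : Prop where
  nonempty : Nonempty κ
  adj : ∀ k, ∀ i ∈ s k, ∃ k', (∀ j ∈ s k, j ≠ i → j ∈ s k') ∧ i ∉ s k'
  cover : ∀ i, ∃ k, i ∈ s k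

/-- The complex generated by the sets `s k` is flag: a set of pairwise adjacent elements lies in
one of the `s k`. -/
def IsFlagFamily {κ ι : Type*} (s : κ → Finset ι) : Prop :=
  ∀ τ : Finset ι, (∀ i ∈ τ, ∀ j ∈ τ, ∃ k, i ∈ s k ∧ j ∈ s k) → ∃ k, τ ⊆ s k

/-- A presentation of a convex set `P` as a simple polytope: points `v k` of `P`, inequalities
`l i ≤ b i` valid on `P`, such that the inequalities that are tight at `v k` are those in `s k`,
and these separate the points of the affine span of `P`. -/
structure FacetSystem {κ ι E : Type*} [NormedAddCommGroup E] [NormedSpace ℝ E]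
    (s : κ → Finset ι) (P : Set E) where
  /-- the functionals defining the facets -/
  l : ι → E →L[ℝ] ℝ
  /-- the right-hand sides -/
  b : ι → ℝ
  /-- the vertices -/
  v : κ → E
  convex : Convex ℝ P
  mem : ∀ k, v k ∈ P
  le : ∀ x ∈ P, ∀ i, l i x ≤ b i
  eq_iff : ∀ k i, l i (v k) = b i ↔ i ∈ s k
  inj : ∀ k, ∀ y ∈ vectorSpan ℝ P, (∀ i ∈ s k, l i y = 0) → y = 0

namespace FacetSystem

variable {κ ι E : Type*} [NormedAddCommGroup E] [NormedSpace ℝ E] {s : κ → Finset ι} {P : Set E}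

/-- The face on which the inequalities indexed by `τ` are tight. -/
def face (h : FacetSystem s P) (τ : Finset ι) : Set E := {x ∈ P | ∀ i ∈ τ, h.l i x = h.b i}

theorem mem_face_v (h : FacetSystem s P) {k : κ} {τ : Finset ι} :
    h.v k ∈ h.face τ ↔ τ ⊆ s k :=
  ⟨fun hx i hi => (h.eq_iff k i).1 (hx.2 i hi), fun hx => ⟨h.mem k, fun i hi => (h.eq_iff k i).2 (hx hi)⟩⟩

theorem face_empty (h : FacetSystem s P) : h.face ∅ = P := by
  ext x; simp [face]

theorem face_anti (h : FacetSystem s P) {τ τ' : Finset ι} (hτ : τ ⊆ τ') : h.face τ' ⊆ h.face τ :=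
  fun _ hx => ⟨hx.1, fun i hi => hx.2 i (hτ hi)⟩

theorem lt_of_notMem (h : FacetSystem s P) {k : κ} {i : ι} (hi : i ∉ s k) :
    h.l i (h.v k) < h.b i :=
  lt_of_le_of_ne (h.le _ (h.mem k) i) (fun e => hi ((h.eq_iff k i).1 e))

/-- On `P`, a functional is an affine combination of the inequalities tight at a vertex. -/
theorem exists_coeff (h : FacetSystem s P) (k : κ) (f : E →L[ℝ] ℝ) :
    ∃ w : ι → ℝ, ∀ x ∈ P, f x - f (h.v k) = ∑ i ∈ s k, w i * (h.l i x - h.b i) := by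
  classical
  let W := vectorSpan ℝ P
  have key : (f.toLinearMap ∘ₗ W.subtype) ∈ Submodule.span ℝ
      (Set.range fun i : {i // i ∈ s k} => ((h.l i).toLinearMap ∘ₗ W.subtype)) := by
    apply mem_span_of_iInf_ker_le_ker
    intro y hy
    simp only [Submodule.mem_iInf, LinearMap.mem_ker] at hy
    have : (y : E) = 0 := h.inj k y y.2 fun i hi => hy ⟨i, hi⟩
    simp [LinearMap.mem_ker, this]
  obtain ⟨w, hw⟩ := (Submodule.mem_span_range_iff_exists_fun ℝ).1 key
  refine ⟨fun i => if hi : i ∈ s k then w ⟨i, hi⟩ else 0, fun x hx => ?_⟩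
  have hd : x - h.v k ∈ W := vsub_mem_vectorSpan ℝ hx (h.mem k)
  have := LinearMap.congr_fun hw ⟨x - h.v k, hd⟩
  simp only [LinearMap.sum_apply, LinearMap.smul_apply, LinearMap.comp_apply, smul_eq_mul,
    Submodule.subtype_apply, ContinuousLinearMap.coe_coe, map_sub] at this
  rw [← this, ← Finset.sum_attach (s k)]
  refine Finset.sum_congr rfl fun i _ => ?_
  rw [(h.eq_iff k i).2 i.2]
  simp [i.2]

/-- Linear programming on a simple polytope: a functional is maximized at some vertex `v k`, and
there it is a nonnegative combination of the tight inequalities. -/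
theorem exists_max (hs : IsClosedFamily s) [Finite κ] (h : FacetSystem s P) (f : E →L[ℝ] ℝ) :
    ∃ k, ∃ w : ι → ℝ, (∀ i ∈ s k, 0 ≤ w i) ∧
      ∀ x ∈ P, f x - f (h.v k) = ∑ i ∈ s k, w i * (h.l i x - h.b i) := by
  have := hs.nonempty
  obtain ⟨k, hk⟩ := Finite.exists_max fun k => f (h.v k)
  obtain ⟨w, hw⟩ := h.exists_coeff k f
  refine ⟨k, w, fun i hi => ?_, hw⟩
  obtain ⟨k', h1, h2⟩ := hs.adj k i hi
  have e := hw _ (h.mem k')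
  rw [Finset.sum_eq_single_of_mem i hi] at e
  · have h3 := h.lt_of_notMem h2
    have h4 := hk k'
    by_contra hneg
    push Not at hneg
    nlinarith
  · intro j hj hji
    rw [(h.eq_iff k' j).2 (h1 j hj hji)]; simp

theorem sum_nonpos (h : FacetSystem s P) {σ : Finset ι} {w : ι → ℝ} (hw : ∀ i ∈ σ, 0 ≤ w i)
    {x : E} (hx : x ∈ P) : ∑ i ∈ σ, w i * (h.l i x - h.b i) ≤ 0 :=
  Finset.sum_nonpos fun i hi =>
    mul_nonpos_of_nonneg_of_nonpos (hw i hi) (sub_nonpos.2 (h.le x hx i))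

theorem eq_convexHull (hs : IsClosedFamily s) [Finite κ] (h : FacetSystem s P) :
    P = convexHull ℝ (Set.range h.v) := by
  apply Set.Subset.antisymm
  · intro x hx
    by_contra hxn
    have hc : IsClosed (convexHull ℝ (Set.range h.v)) :=
      ((Set.finite_range h.v).isCompact_convexHull ℝ).isClosed
    obtain ⟨f, u, h1, h2⟩ := geometric_hahn_banach_closed_point (convex_convexHull ℝ _) hc hxn
    obtain ⟨k, w, hw, he⟩ := h.exists_max hs f
    have h3 := he x hx
    have h4 := h.sum_nonpos hw hx
    have h5 := h1 _ (subset_convexHull ℝ _ ⟨k, rfl⟩)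
    linarith
  · exact convexHull_min (by rintro _ ⟨k, rfl⟩; exact h.mem k) h.convex

theorem isPolytope (hs : IsClosedFamily s) [Finite κ] (h : FacetSystem s P) : IsPolytope P := by
  classical
  have := hs.nonempty
  refine ⟨(Set.finite_range h.v).toFinset, ?_, ?_⟩
  · simpa using Set.range_nonempty h.v
  · simpa using h.eq_convexHull hs

theorem isExposed_face (h : FacetSystem s P) (τ : Finset ι) : IsExposed ℝ P (h.face τ) := by
  rintro ⟨x0, hx0⟩
  refine ⟨∑ i ∈ τ, h.l i, ?_⟩
  have key : ∀ y ∈ P, ∑ i ∈ τ, h.l i y ≤ ∑ i ∈ τ, h.b i := fun y hy =>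
    Finset.sum_le_sum fun i _ => h.le y hy i
  have e0 : ∑ i ∈ τ, h.l i x0 = ∑ i ∈ τ, h.b i := Finset.sum_congr rfl hx0.2
  ext x
  simp only [_root_.sum_apply, Set.mem_ofPred_eq]
  constructor
  · intro hx
    refine ⟨hx.1, fun y hy => ?_⟩
    rw [Finset.sum_congr rfl hx.2]; exact key y hy
  · rintro ⟨hx, hmax⟩
    refine ⟨hx, fun i hi => ?_⟩
    have := hmax x0 hx0.1
    rw [e0] at this
    exact (Finset.sum_eq_sum_iff_of_le fun i _ => h.le x hx i).1
      (le_antisymm (key x hx) this) i hi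

/-- The inequalities tight at a common point are tight at a common vertex. -/
theorem exists_subset_of_mem_face (hs : IsClosedFamily s) [Finite κ] (h : FacetSystem s P)
    {τ : Finset ι} {x : E} (hx : x ∈ h.face τ) : ∃ k, τ ⊆ s k := by
  obtain ⟨k, w, hw, he⟩ := h.exists_max hs (∑ i ∈ τ, h.l i)
  refine ⟨k, h.mem_face_v.1 ⟨h.mem k, ?_⟩⟩
  have h1 := he x hx.1
  have h2 := h.sum_nonpos hw hx.1
  simp only [_root_.sum_apply] at h1
  rw [Finset.sum_congr rfl hx.2] at h1
  exact (Finset.sum_eq_sum_iff_of_le fun i _ => h.le _ (h.mem k) i).1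
    (le_antisymm (Finset.sum_le_sum fun i _ => h.le _ (h.mem k) i) (by linarith))

theorem face_nonempty_iff (hs : IsClosedFamily s) [Finite κ] (h : FacetSystem s P)
    {τ : Finset ι} : (h.face τ).Nonempty ↔ ∃ k, τ ⊆ s k :=
  ⟨fun ⟨_, hx⟩ => h.exists_subset_of_mem_face hs hx, fun ⟨k, hk⟩ => ⟨h.v k, h.mem_face_v.2 hk⟩⟩

theorem exists_eq_face (hs : IsClosedFamily s) [Finite κ] (h : FacetSystem s P) {A : Set E}
    (hA : IsExposed ℝ P A) (hne : A.Nonempty) : ∃ τ, (∃ k, τ ⊆ s k) ∧ A = h.face τ := by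
  classical
  obtain ⟨f, rfl⟩ := hA hne
  obtain ⟨k, w, hw, he⟩ := h.exists_max hs f
  refine ⟨(s k).filter fun i => 0 < w i, ⟨k, Finset.filter_subset _ _⟩, ?_⟩
  ext x
  constructor
  · rintro ⟨hx, hmax⟩
    refine ⟨hx, fun i hi => ?_⟩
    rw [Finset.mem_filter] at hi
    have h0 : ∑ i ∈ s k, w i * (h.l i x - h.b i) = 0 :=
      le_antisymm (h.sum_nonpos hw hx) (by rw [← he x hx]; linarith [hmax _ (h.mem k)])
    have := (Finset.sum_eq_zero_iff_of_nonpos fun i hi =>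
      mul_nonpos_of_nonneg_of_nonpos (hw i hi) (sub_nonpos.2 (h.le x hx i))).1 h0 i hi.1
    rcases mul_eq_zero.1 this with h1 | h1 <;> linarith
  · rintro ⟨hx, hτ⟩
    refine ⟨hx, fun y hy => ?_⟩
    have h1 : f x - f (h.v k) = 0 := by
      rw [he x hx]
      refine Finset.sum_eq_zero fun i hi => ?_
      by_cases hwi : 0 < w i
      · rw [hτ i (Finset.mem_filter.2 ⟨hi, hwi⟩)]; simp
      · rw [le_antisymm (not_lt.1 hwi) (hw i hi)]; simp
    have h2 := he y hy
    have h3 := h.sum_nonpos hw hy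
    linarith

/-- Each inequality outside `τ ⊆ s k` is strict at some vertex of the face of `τ`. -/
theorem _root_.MuraiSphere.IsClosedFamily.exists_notMem (hs : IsClosedFamily s) {τ : Finset ι}
    {k : κ} (hk : τ ⊆ s k) {i : ι} (hi : i ∉ τ) : ∃ k', τ ⊆ s k' ∧ i ∉ s k' := by
  by_cases hik : i ∈ s k
  · obtain ⟨k', h1, h2⟩ := hs.adj k i hik
    exact ⟨k', fun j hj => h1 j (hk hj) (fun e => hi (e ▸ hj)), h2⟩
  · exact ⟨k, hk, hik⟩

theorem face_subset_iff (hs : IsClosedFamily s) (h : FacetSystem s P) {τ τ' : Finset ι} {k : κ}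
    (hk : τ ⊆ s k) : h.face τ ⊆ h.face τ' ↔ τ' ⊆ τ := by
  refine ⟨fun hsub i hi => ?_, h.face_anti⟩
  by_contra hit
  obtain ⟨k', h1, h2⟩ := hs.exists_notMem hk hit
  exact h2 ((h.mem_face_v.1 (hsub (h.mem_face_v.2 h1))) hi)

theorem face_singleton_ne (hs : IsClosedFamily s) (h : FacetSystem s P) (i : ι) :
    h.face {i} ≠ P := by
  intro e
  obtain ⟨k⟩ := hs.nonempty
  have := (h.face_subset_iff hs (τ' := {i}) (Finset.empty_subset (s k))).1
    (by rw [e, h.face_empty])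
  simp at this

theorem isFacet_iff (hs : IsClosedFamily s) [Finite κ] (h : FacetSystem s P) {A : Set E} :
    IsFacet P A ↔ ∃ i, A = h.face {i} := by
  constructor
  · rintro ⟨hne, hex, hneP, hmax⟩
    obtain ⟨τ, ⟨k, hk⟩, rfl⟩ := h.exists_eq_face hs hex hne
    rcases τ.eq_empty_or_nonempty with rfl | ⟨i, hi⟩
    · exact absurd h.face_empty hneP
    · exact ⟨i, (hmax _ (h.isExposed_face {i}) (h.face_singleton_ne hs i)
        (h.face_anti (Finset.singleton_subset_iff.2 hi))).symm⟩
  · rintro ⟨i, rfl⟩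
    obtain ⟨k, hk⟩ := hs.cover i
    have hk' : {i} ⊆ s k := Finset.singleton_subset_iff.2 hk
    refine ⟨⟨_, h.mem_face_v.2 hk'⟩, h.isExposed_face _, h.face_singleton_ne hs i, ?_⟩
    intro B hB hBP hsub
    obtain ⟨τ, -, rfl⟩ := h.exists_eq_face hs hB ⟨_, hsub (h.mem_face_v.2 hk')⟩
    have := (h.face_subset_iff hs hk').1 hsub
    rcases Finset.subset_singleton_iff.1 this with rfl | rfl
    · exact absurd h.face_empty hBP
    · rfl

theorem face_singleton_injective (hs : IsClosedFamily s) (h : FacetSystem s P) :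
    Function.Injective fun i => h.face {i} := by
  intro i j e
  obtain ⟨k, hk⟩ := hs.cover i
  have := (h.face_subset_iff hs (Finset.singleton_subset_iff.2 hk)).1 (le_of_eq e)
  exact (by simpa using this : j = i).symm

theorem ncard_facets (hs : IsClosedFamily s) [Finite κ] (h : FacetSystem s P) (k : κ) :
    {A : Set E | IsFacet P A ∧ h.v k ∈ A}.ncard = (s k).card := by
  have : {A : Set E | IsFacet P A ∧ h.v k ∈ A} = (fun i => h.face {i}) '' (s k : Set ι) := by
    ext A
    simp only [Set.mem_ofPred_eq, h.isFacet_iff hs, Set.mem_image, Finset.mem_coe]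
    constructor
    · rintro ⟨⟨i, rfl⟩, hA⟩
      exact ⟨i, by simpa using h.mem_face_v.1 hA, rfl⟩
    · rintro ⟨i, hi, rfl⟩
      exact ⟨⟨i, rfl⟩, h.mem_face_v.2 (by simpa using hi)⟩
  rw [this, Set.ncard_image_of_injective _ (h.face_singleton_injective hs), Set.ncard_coe_finset]

theorem polytopeDim_eq (hs : IsClosedFamily s) (h : FacetSystem s P) (k : κ) :
    polytopeDim P = (s k).card := by
  classical
  let W := vectorSpan ℝ P
  let Φ : W →ₗ[ℝ] ({i // i ∈ s k} → ℝ) :=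
    LinearMap.pi fun i => (h.l i).toLinearMap ∘ₗ W.subtype
  have hinj : Function.Injective Φ := by
    rw [← LinearMap.ker_eq_bot, LinearMap.ker_eq_bot']
    intro y hy
    exact Subtype.ext (h.inj k y y.2 fun i hi => congr_fun hy ⟨i, hi⟩)
  have hsurj : Function.Surjective Φ := by
    rw [← LinearMap.range_eq_top, eq_top_iff, ← (Pi.basisFun ℝ _).span_eq, Submodule.span_le]
    rintro _ ⟨i, rfl⟩
    obtain ⟨k', h1, h2⟩ := hs.adj k i i.2
    have hne : h.l i (h.v k') - h.b i ≠ 0 := (sub_neg.2 (h.lt_of_notMem h2)).ne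
    let y : W := ⟨h.v k' - h.v k, vsub_mem_vectorSpan ℝ (h.mem k') (h.mem k)⟩
    refine ⟨(h.l i (h.v k') - h.b i)⁻¹ • y, ?_⟩
    ext j
    have ej : Φ y j = h.l j (h.v k') - h.b j := by
      simp [Φ, y, (h.eq_iff k j).2 j.2]
    rw [map_smul, Pi.smul_apply, ej, Pi.basisFun_apply]
    by_cases hij : j = i
    · subst hij; simp [hne]
    · rw [(h.eq_iff k' j).2 (h1 j j.2 (fun e => hij (Subtype.ext e)))]
      simp [hij]
  rw [polytopeDim, (LinearEquiv.ofBijective Φ ⟨hinj, hsurj⟩).finrank_eq]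
  simp

theorem isSimplePolytope (hs : IsClosedFamily s) [Finite κ] (h : FacetSystem s P) :
    IsSimplePolytope P := by
  refine ⟨h.isPolytope hs, fun x hx => ?_⟩
  rw [h.eq_convexHull hs] at hx
  obtain ⟨k, rfl⟩ := extremePoints_convexHull_subset hx
  rw [h.ncard_facets hs, h.polytopeDim_eq hs k]

theorem isFlagPolytope (hs : IsClosedFamily s) (hf : IsFlagFamily s) [Finite κ] [Finite ι]
    (h : FacetSystem s P) : IsFlagPolytope P := by
  classical
  refine ⟨h.isSimplePolytope hs, fun S hS hpair => ?_⟩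
  let τ : Finset ι := (Set.toFinite {i | h.face {i} ∈ S}).toFinset
  obtain ⟨k, hk⟩ := hf τ (by
    intro i hi j hj
    obtain ⟨x, hxi, hxj⟩ := hpair (h.face {i}) (by simpa [τ] using hi) (h.face {j})
      (by simpa [τ] using hj)
    have hx : x ∈ h.face {i, j} := ⟨hxi.1, by
      intro a ha
      rcases Finset.mem_insert.1 ha with rfl | ha
      · exact hxi.2 _ (by simp)
      · exact hxj.2 _ ha⟩
    obtain ⟨k, hk⟩ := h.exists_subset_of_mem_face hs hx
    exact ⟨k, hk (by simp), hk (by simp)⟩)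
  refine ⟨h.v k, h.mem k, fun A hA => ?_⟩
  obtain ⟨i, rfl⟩ := (h.isFacet_iff hs).1 (hS A hA)
  exact h.mem_face_v.2 (Finset.singleton_subset_iff.2 (hk (by simpa [τ] using hA)))

/-- The face lattice is the face poset of the complex generated by the `s k`, including the empty
face, turned upside down and with a least element (the empty face of `P`) added. -/
theorem nonempty_faceLattice_iso (hs : IsClosedFamily s) [Finite κ] (h : FacetSystem s P) :
    Nonempty ((WithTop {τ : Finset ι // ∃ k, τ ⊆ s k})ᵒᵈ ≃o FaceLattice P) := by
  classical
  let g : (WithTop {τ : Finset ι // ∃ k, τ ⊆ s k})ᵒᵈ → FaceLattice P := fun t =>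
    WithTop.recTopCoe (C := fun _ => FaceLattice P) ⟨∅, isExposed_empty⟩
      (fun τ => ⟨h.face τ.1, h.isExposed_face τ.1⟩) (OrderDual.ofDual t)
  have hle : ∀ t t', g t ≤ g t' ↔ t ≤ t' := by
    intro t t'
    induction t using OrderDual.rec with | _ t
    induction t' using OrderDual.rec with | _ t'
    rw [OrderDual.toDual_le_toDual]
    induction t using WithTop.recTopCoe with
    | top =>
      simp only [le_top, iff_true]
      exact Set.empty_subset (g _ : FaceLattice P).1
    | coe τ =>
      obtain ⟨τ, k, hk⟩ := τ
      induction t' using WithTop.recTopCoe with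
      | top =>
        simp only [top_le_iff, WithTop.coe_ne_top, iff_false]
        intro hsub
        exact (hsub (h.mem_face_v.2 hk) : h.v k ∈ (∅ : Set E))
      | coe τ' =>
        rw [WithTop.coe_le_coe]
        exact h.face_subset_iff hs hk
  have hsurj : Function.Surjective g := by
    rintro ⟨A, hA⟩
    rcases A.eq_empty_or_nonempty with rfl | hne
    · exact ⟨OrderDual.toDual ⊤, rfl⟩
    · obtain ⟨τ, hτ, rfl⟩ := h.exists_eq_face hs hA hne
      exact ⟨OrderDual.toDual ((⟨τ, hτ⟩ : {τ : Finset ι // ∃ k, τ ⊆ s k}) : WithTop _), rfl⟩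
  have hinj : Function.Injective g := fun a b hab =>
    le_antisymm ((hle a b).1 hab.le) ((hle b a).1 hab.ge)
  exact ⟨⟨Equiv.ofBijective g ⟨hinj, hsurj⟩, fun {a b} => hle a b⟩⟩

theorem combEquiv {E' : Type*} [NormedAddCommGroup E'] [NormedSpace ℝ E'] {P' : Set E'}
    (hs : IsClosedFamily s) [Finite κ] (h : FacetSystem s P) (h' : FacetSystem s P') :
    CombEquiv P P' := by
  obtain ⟨e⟩ := h.nonempty_faceLattice_iso hs
  obtain ⟨e'⟩ := h'.nonempty_faceLattice_iso hs
  exact ⟨e.symm.trans e'⟩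

end FacetSystem

/-! ### Properties read off from the face lattice -/

section Lattice

variable {E F : Type*} [NormedAddCommGroup E] [NormedSpace ℝ E]
  [NormedAddCommGroup F] [NormedSpace ℝ F]

theorem IsPolytope.exists_extremePoint {P : Set E} (hP : IsPolytope P) :
    ∃ x, x ∈ P.extremePoints ℝ := by
  obtain ⟨t, ht, rfl⟩ := hP
  exact (t.finite_toSet.isCompact_convexHull ℝ).extremePoints_nonempty
    ((convexHull_nonempty_iff (𝕜 := ℝ)).2 ht)

/-- The extreme points of a polytope are exposed: such a point can be separated from the convex
hull of the other generators. -/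
theorem IsPolytope.isExposed_singleton {P : Set E} (hP : IsPolytope P) {x : E}
    (hx : x ∈ P.extremePoints ℝ) : IsExposed ℝ P {x} := by
  classical
  obtain ⟨t, ht, rfl⟩ := hP
  have hxt : x ∈ t := extremePoints_convexHull_subset hx
  have hcv := ((convex_convexHull ℝ _).mem_extremePoints_iff_convex_sdiff.1 hx).2
  have hsub : convexHull ℝ ((t.erase x : Finset E) : Set E) ⊆ convexHull ℝ (t : Set E) \ {x} := by
    refine convexHull_min (fun y hy => ?_) hcv
    have hy' := Finset.mem_erase.1 hy
    exact ⟨subset_convexHull ℝ _ hy'.2, hy'.1⟩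
  intro _
  rcases (t.erase x).eq_empty_or_nonempty with he | hne
  · have : t = {x} := by
      rw [← Finset.insert_erase hxt, he]; rfl
    subst this
    exact ⟨0, by simp⟩
  have hclosed : IsClosed (convexHull ℝ ((t.erase x : Finset E) : Set E)) :=
    ((t.erase x).finite_toSet.isCompact_convexHull ℝ).isClosed
  obtain ⟨f, u, h1, h2⟩ := geometric_hahn_banach_closed_point (convex_convexHull ℝ _) hclosed
    (fun h => (hsub h).2 rfl)
  have key : ∀ y ∈ convexHull ℝ (t : Set E), f y ≤ f x ∧ (f x ≤ f y → y = x) := by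
    intro y hy
    rw [← Finset.insert_erase hxt, Finset.coe_insert, convexHull_insert hne] at hy
    obtain ⟨a, ha, z, hz, hyz⟩ := mem_convexJoin.1 hy
    rw [Set.mem_singleton_iff] at ha
    subst ha
    obtain ⟨p, q, hp, hq, hpq, rfl⟩ := hyz
    have hz' := h1 z hz
    have hlt : f z < f a := hz'.trans h2
    have ef : f (p • a + q • z) = f a - q * (f a - f z) := by
      simp only [map_add, map_smul, smul_eq_mul]
      have : p = 1 - q := by linarith
      subst this; ring
    rw [ef]
    refine ⟨by nlinarith, fun hle => ?_⟩
    have hq0 : q = 0 := by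
      by_contra hq0
      have : 0 < q := lt_of_le_of_ne hq (Ne.symm hq0)
      nlinarith
    subst hq0
    have : p = 1 := by linarith
    simp [this]
  refine ⟨f, ?_⟩
  ext y
  simp only [Set.mem_singleton_iff, Set.mem_ofPred_eq]
  constructor
  · rintro rfl
    exact ⟨hx.1, fun z hz => (key z hz).1⟩
  · rintro ⟨hy, hmax⟩
    exact (key y hy).2 (hmax x hx.1)

theorem isFacet_iff_covBy {P A : Set E} :
    IsFacet P A ↔ A.Nonempty ∧ ∃ hA : IsExposed ℝ P A,
      (⟨A, hA⟩ : FaceLattice P) ⋖ ⟨P, IsExposed.refl P⟩ := by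
  constructor
  · rintro ⟨hne, hA, hAP, hmax⟩
    refine ⟨hne, hA, lt_of_le_of_ne hA.subset (fun e => hAP (congrArg Subtype.val e)), ?_⟩
    rintro ⟨C, hC⟩ h1 h2
    have : C = A := hmax C hC (fun e => h2.ne (Subtype.ext e)) h1.le
    exact h1.ne (Subtype.ext this.symm)
  · rintro ⟨hne, hA, hcov⟩
    refine ⟨hne, hA, fun e => hcov.1.ne (Subtype.ext e), fun B hB hBP hAB => ?_⟩
    by_contra hBA
    refine hcov.2 (c := ⟨B, hB⟩) (lt_of_le_of_ne hAB fun e => hBA (congrArg Subtype.val e).symm) ?_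
    exact lt_of_le_of_ne hB.subset fun e => hBP (congrArg Subtype.val e)

/-- An isomorphism of face lattices maps nonempty faces to nonempty faces. -/
theorem iso_nonempty {P : Set E} {Q : Set F} (e : FaceLattice P ≃o FaceLattice Q)
    {A : FaceLattice P} (hA : A.1.Nonempty) : (e A).1.Nonempty := by
  by_contra hne
  rw [Set.not_nonempty_iff_eq_empty] at hne
  have : e A ≤ e ⟨∅, isExposed_empty⟩ := by
    have : (e A).1 ⊆ (e ⟨∅, isExposed_empty⟩).1 := by rw [hne]; exact Set.empty_subset _
    exact this
  obtain ⟨x, hx⟩ := hA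
  exact (e.le_iff_le.1 this : A.1 ⊆ ∅) hx

theorem iso_top {P : Set E} {Q : Set F} (e : FaceLattice P ≃o FaceLattice Q) :
    e ⟨P, IsExposed.refl P⟩ = ⟨Q, IsExposed.refl Q⟩ := by
  apply le_antisymm
  · exact (e ⟨P, IsExposed.refl P⟩).2.subset
  · rw [← e.symm_apply_le]
    exact (e.symm _).2.subset

/-- The dimension of a simple polytope is determined by its face lattice: it is the number of
facets through any vertex. -/
theorem FacetSystem.exists_card_eq {κ ι : Type*} [Finite κ] {s : κ → Finset ι} {L : Set F}
    (hs : IsClosedFamily s) (h : FacetSystem s L) {P : Set E} (hP : IsSimplePolytope P)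
    (hPL : CombEquiv P L) : ∃ k, (s k).card = polytopeDim P := by
  obtain ⟨e⟩ := hPL
  obtain ⟨x, hx⟩ := hP.1.exists_extremePoint
  let a : FaceLattice P := ⟨{x}, hP.1.isExposed_singleton hx⟩
  have hane : (e a).1.Nonempty := iso_nonempty e ⟨x, rfl⟩
  obtain ⟨τ, ⟨k, hk⟩, hτ⟩ := h.exists_eq_face hs (e a).2 hane
  let t : FaceLattice L := ⟨h.face (s k), h.isExposed_face _⟩
  have hta : t ≤ e a := by
    have : h.face (s k) ⊆ (e a).1 := by rw [hτ]; exact h.face_anti hk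
    exact this
  have hvk : h.v k ∈ t.1 := h.mem_face_v.2 (Finset.Subset.refl _)
  have hea : e a = t := by
    have h1 : (e.symm t).1 ⊆ {x} := (e.symm_apply_le.2 hta : e.symm t ≤ a)
    have h2 : (e.symm t).1.Nonempty := iso_nonempty e.symm ⟨_, hvk⟩
    have h3 : e.symm t = a := Subtype.ext (h2.subset_singleton_iff.1 h1)
    rw [← h3, e.apply_symm_apply]
  refine ⟨k, ?_⟩
  rw [← hP.2 x hx, ← h.ncard_facets hs k]
  symm
  have hcov : ∀ A : FaceLattice P, A ⋖ ⟨P, IsExposed.refl P⟩ ↔ e A ⋖ ⟨L, IsExposed.refl L⟩ := by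
    intro A
    rw [← iso_top e, apply_covBy_apply_iff]
  have hmem : ∀ A : FaceLattice P, A ⋖ ⟨P, IsExposed.refl P⟩ →
      (x ∈ A.1 ↔ h.v k ∈ (e A).1) := by
    intro A hA
    have h1 : x ∈ A.1 ↔ a ≤ A := Set.singleton_subset_iff.symm
    rw [h1, ← e.le_iff_le, hea]
    constructor
    · intro h2
      exact h2 hvk
    · intro h2
      obtain ⟨i, hi⟩ := (h.isFacet_iff hs).1 (isFacet_iff_covBy.2 ⟨⟨_, h2⟩, (e A).2, (hcov A).1 hA⟩)
      have h3 : h.face (s k) ⊆ (e A).1 := by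
        rw [hi] at h2 ⊢
        exact h.face_anti (h.mem_face_v.1 h2)
      exact h3
  refine Set.ncard_congr (fun A hA => (e ⟨A, hA.1.2.1⟩).1) ?_ ?_ ?_
  · rintro A ⟨hA, hxA⟩
    obtain ⟨hne, hex, hc⟩ := isFacet_iff_covBy.1 hA
    exact ⟨isFacet_iff_covBy.2 ⟨iso_nonempty e hne, (e ⟨A, hex⟩).2, (hcov ⟨A, hex⟩).1 hc⟩,
      (hmem ⟨A, hex⟩ hc).1 hxA⟩
  · intro A B hA hB hAB
    have : e ⟨A, hA.1.2.1⟩ = e ⟨B, hB.1.2.1⟩ := Subtype.ext hAB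
    exact congrArg Subtype.val (e.injective this)
  · rintro B ⟨hB, hvB⟩
    obtain ⟨hne, hex, hc⟩ := isFacet_iff_covBy.1 hB
    have hc' : e.symm ⟨B, hex⟩ ⋖ ⟨P, IsExposed.refl P⟩ := by
      rw [hcov, e.apply_symm_apply]; exact hc
    refine ⟨(e.symm ⟨B, hex⟩).1, ⟨isFacet_iff_covBy.2 ⟨iso_nonempty e.symm hne, _, hc'⟩, ?_⟩, ?_⟩
    · rw [hmem _ hc', e.apply_symm_apply]; exact hvB
    · simp

/-- If the complex `K` is the boundary of a polytope whose dual has the combinatorial type of a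
flag simple polytope, then `K` is flag: flagness is read off from the atoms of the face posets. -/
theorem isFlag_of_combDual {V κ ι G : Type*} [NormedAddCommGroup G] [NormedSpace ℝ G] [Finite κ]
    {s : κ → Finset ι} {L : Set G} (hs : IsClosedFamily s) (hf : IsFlagFamily s)
    (h : FacetSystem s L) {K : PreAbstractSimplicialComplex V} {P : Set E} {Q : Set F}
    (hQ : IsPolytope Q) (hK : ComplexIso K (boundaryComplex Q)) (hPQ : CombDual P Q)
    (hPL : CombEquiv P L) : IsFlag K := by
  classical
  obtain ⟨φ⟩ := hK
  obtain ⟨e1⟩ := hPQ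
  obtain ⟨e2⟩ := hPL
  let e : FaceLattice L ≃o (FaceLattice Q)ᵒᵈ := e2.symm.trans e1
  have hle : ∀ A B : FaceLattice L, A.1 ⊆ B.1 ↔
      (OrderDual.ofDual (e B)).1 ⊆ (OrderDual.ofDual (e A)).1 := fun A B =>
    (e.le_iff_le (x := A) (y := B)).symm
  have hsurj : ∀ B : FaceLattice Q, ∃ A : FaceLattice L, (OrderDual.ofDual (e A)).1 = B.1 :=
    fun B => ⟨e.symm (OrderDual.toDual B), by simp⟩
  have hnonempty : ∀ A : FaceLattice L, (OrderDual.ofDual (e A)).1 ≠ Q ↔ A.1.Nonempty := by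
    intro A
    rw [Set.nonempty_iff_ne_empty, not_iff_not]
    constructor
    · intro hA
      have := (hle A ⟨∅, isExposed_empty⟩).2 (by rw [hA]; exact (OrderDual.ofDual (e _)).2.subset)
      exact Set.subset_empty_iff.1 this
    · intro hA
      obtain ⟨T, hT⟩ := hsurj ⟨Q, IsExposed.refl Q⟩
      have := (hle A T).1 (by rw [hA]; exact Set.empty_subset _)
      rw [hT] at this
      exact (OrderDual.ofDual (e A)).2.subset.antisymm this
  have hempty : ∀ A : FaceLattice L, (OrderDual.ofDual (e A)).1 = ∅ → A.1 = L := by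
    intro A hA
    refine A.2.subset.antisymm ?_
    exact (hle ⟨L, IsExposed.refl L⟩ A).2 (by rw [hA]; exact Set.empty_subset _)
  intro σ hσ hσK hmin
  by_contra hcard
  push Not at hcard
  have hsing : ∀ x ∈ σ, {x} ∈ K.faces := fun x hx =>
    hmin {x} (Finset.singleton_nonempty x) (Finset.ssubset_iff_subset_ne.2
      ⟨Finset.singleton_subset_iff.2 hx, fun e => by rw [← e] at hcard; simp at hcard⟩)
  -- the vertices of `Q` and the facets of `L` corresponding to the elements of `σ`
  have hvert : ∀ x : V, ∀ hx : {x} ∈ K.faces, ∃ u : F, (φ ⟨{x}, hx⟩).1 = {u} := by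
    intro x hx
    have hr := (φ ⟨{x}, hx⟩).2
    obtain ⟨⟨u, hu⟩, hτ⟩ := hr
    have hu' : {u} ∈ (boundaryComplex Q).faces := by
      obtain ⟨τ, h1, h2⟩ := hτ
      exact ⟨Finset.singleton_nonempty u, τ, h1, (Finset.singleton_subset_iff.2 hu).trans h2⟩
    have h1 : φ.symm ⟨{u}, hu'⟩ ≤ ⟨{x}, hx⟩ := by
      rw [φ.symm_apply_le]
      exact Finset.singleton_subset_iff.2 hu
    have h2 : (φ.symm ⟨{u}, hu'⟩).1 = {x} := by
      rcases Finset.subset_singleton_iff.1 h1 with h3 | h3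
      · have := K.isRelLowerSet_faces (φ.symm ⟨{u}, hu'⟩).2
        rw [h3] at this
        simp at this
      · exact h3
    have h3 : φ.symm ⟨{u}, hu'⟩ = ⟨{x}, hx⟩ := Subtype.ext h2
    refine ⟨u, ?_⟩
    rw [← h3, φ.apply_symm_apply]
  choose! u hu using hvert
  have hfacet : ∀ x ∈ σ, ∃ i : ι, (OrderDual.ofDual (e ⟨h.face {i}, h.isExposed_face _⟩)).1
      = {u x} := by
    intro x hx
    have hr := (φ ⟨{x}, hsing x hx⟩).2
    rw [hu x (hsing x hx)] at hr
    obtain ⟨-, τ, ⟨hτe, A, hA, hAQ, hτA⟩, hτ⟩ := hr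
    have hxτ : u x ∈ τ := hτ (Finset.mem_singleton_self _)
    have hxe := hQ.isExposed_singleton (hτe hxτ)
    obtain ⟨G, hG⟩ := hsurj ⟨{u x}, hxe⟩
    have hGne : G.1.Nonempty := by
      rw [← hnonempty, hG]
      intro hQx
      apply hAQ
      refine hA.subset.antisymm ?_
      rw [← hQx]
      exact Set.singleton_subset_iff.2 (hτA hxτ)
    obtain ⟨ρ, -, hρ⟩ := h.exists_eq_face hs G.2 hGne
    rcases ρ.eq_empty_or_nonempty with rfl | ⟨i, hi⟩
    · exfalso
      rw [h.face_empty] at hρ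
      obtain ⟨Z, hZ⟩ := hsurj ⟨∅, isExposed_empty⟩
      have := (hle Z G).1 (by rw [hρ]; exact Z.2.subset)
      rw [hG, hZ] at this
      simp at this
    · refine ⟨i, ?_⟩
      have h1 := (hle G ⟨h.face {i}, h.isExposed_face _⟩).1
        (by rw [hρ]; exact h.face_anti (Finset.singleton_subset_iff.2 hi))
      rw [hG] at h1
      refine (Set.Nonempty.subset_singleton_iff ?_).1 h1
      rw [Set.nonempty_iff_ne_empty]
      intro h2
      exact h.face_singleton_ne hs i (hempty _ h2)
  have : Nonempty ι := by
    obtain ⟨x, hx⟩ := hσ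
    exact ⟨(hfacet x hx).choose⟩
  choose! i hi using hfacet
  obtain ⟨k, hk⟩ := hf (σ.image i) (by
    intro a ha b hb
    obtain ⟨x, hx, rfl⟩ := Finset.mem_image.1 ha
    obtain ⟨y, hy, rfl⟩ := Finset.mem_image.1 hb
    have hxy : {x, y} ∈ K.faces := by
      refine hmin _ ⟨x, by simp⟩ (Finset.ssubset_iff_subset_ne.2 ⟨?_, fun e => ?_⟩)
      · intro z hz
        rcases Finset.mem_insert.1 hz with rfl | hz
        · exact hx
        · rwa [Finset.mem_singleton.1 hz]
      · rw [← e] at hcard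
        exact absurd (Finset.card_le_two (a := x) (b := y)) (not_le.2 hcard)
    obtain ⟨-, τ, ⟨-, A, hA, hAQ, hτA⟩, hτ⟩ := (φ ⟨{x, y}, hxy⟩).2
    have hmemu : ∀ z ∈ σ, {z} ⊆ ({x, y} : Finset V) → u z ∈ A := by
      intro z hz hzxy
      have : φ ⟨{z}, hsing z hz⟩ ≤ φ ⟨{x, y}, hxy⟩ := φ.le_iff_le.2 hzxy
      have h1 : (φ ⟨{z}, hsing z hz⟩).1 ⊆ (φ ⟨{x, y}, hxy⟩).1 := this
      rw [hu z (hsing z hz)] at h1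
      exact hτA (hτ (Finset.singleton_subset_iff.1 h1))
    obtain ⟨G, hG⟩ := hsurj ⟨A, hA⟩
    obtain ⟨p, hp⟩ := (hnonempty G).1 (by rw [hG]; exact hAQ)
    have hGi : ∀ z ∈ σ, {z} ⊆ ({x, y} : Finset V) → p ∈ h.face {i z} := by
      intro z hz hzxy
      refine (hle G ⟨h.face {i z}, h.isExposed_face _⟩).2 ?_ hp
      rw [hG, hi z hz]
      exact Set.singleton_subset_iff.2 (hmemu z hz hzxy)
    have hpx := hGi x hx (by simp)
    have hpy := hGi y hy (by simp)
    have : p ∈ h.face {i x, i y} := ⟨hpx.1, fun a ha => by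
      rcases Finset.mem_insert.1 ha with rfl | ha
      · exact hpx.2 _ (by simp)
      · exact hpy.2 _ ha⟩
    obtain ⟨k, hk⟩ := h.exists_subset_of_mem_face hs this
    exact ⟨k, hk (by simp), hk (by simp)⟩)
  let A : FaceLattice L := ⟨h.face (σ.image i), h.isExposed_face _⟩
  have hAQ := (hnonempty A).2 ((h.face_nonempty_iff hs).2 ⟨k, hk⟩)
  have huA : ∀ x ∈ σ, u x ∈ (OrderDual.ofDual (e A)).1 := by
    intro x hx
    have h1 := (hle A ⟨h.face {i x}, h.isExposed_face _⟩).1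
      (h.face_anti (Finset.singleton_subset_iff.2 (Finset.mem_image_of_mem i hx)))
    rw [hi x hx] at h1
    exact h1 rfl
  have hτ : σ.image u ∈ (boundaryComplex Q).faces := by
    refine ⟨hσ.image u, σ.image u, ⟨?_, _, (OrderDual.ofDual (e A)).2, hAQ, ?_⟩, subset_rfl⟩
    · intro y hy
      obtain ⟨x, hx, rfl⟩ := Finset.mem_image.1 hy
      have hr := (φ ⟨{x}, hsing x hx⟩).2
      rw [hu x (hsing x hx)] at hr
      obtain ⟨-, τ, ⟨hτe, -⟩, hτ⟩ := hr
      exact hτe (hτ (Finset.mem_singleton_self _))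
    · intro y hy
      obtain ⟨x, hx, rfl⟩ := Finset.mem_image.1 hy
      exact huA x hx
  apply hσK
  have hsub : σ ⊆ (φ.symm ⟨_, hτ⟩).1 := by
    intro x hx
    have : (⟨{x}, hsing x hx⟩ : K.faces) ≤ φ.symm ⟨_, hτ⟩ := by
      rw [φ.le_symm_apply]
      have : (φ ⟨{x}, hsing x hx⟩).1 ⊆ σ.image u := by
        rw [hu x (hsing x hx)]
        exact Finset.singleton_subset_iff.2 (Finset.mem_image_of_mem u hx)
      exact this
    exact Finset.singleton_subset_iff.1 this
  exact (K.isRelLowerSet_faces (φ.symm ⟨_, hτ⟩).2).2 hsub hσ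

end Lattice

/-! ### Polarity: the dual simplicial polytope -/

/-- The functional `z ↦ ∑ j, x j * z j` on `ℝ^J`. -/
noncomputable def dotCLM {J : Type*} [Fintype J] (x : J → ℝ) : (J → ℝ) →L[ℝ] ℝ :=
  ∑ j, x j • ContinuousLinearMap.proj j

@[simp] theorem dotCLM_apply {J : Type*} [Fintype J] (x z : J → ℝ) :
    dotCLM x z = ∑ j, x j * z j := by
  simp [dotCLM, _root_.sum_apply]

theorem dotCLM_comm {J : Type*} [Fintype J] (x z : J → ℝ) : dotCLM x z = dotCLM z x := by
  simp [mul_comm]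

theorem eq_dotCLM {J : Type*} [Fintype J] [DecidableEq J] (f : (J → ℝ) →L[ℝ] ℝ) :
    f = dotCLM fun j => f (Pi.single j 1) := by
  ext z
  rw [dotCLM_apply]
  conv_lhs => rw [← Finset.univ_sum_single z, map_sum]
  refine Finset.sum_congr rfl fun j _ => ?_
  have : (Pi.single j (z j) : J → ℝ) = z j • Pi.single j 1 := by
    rw [← Pi.single_smul', smul_eq_mul, mul_one]
  rw [this, map_smul, smul_eq_mul, mul_comm]

/-- A point of the convex hull at which a functional attains its maximum `r` over the generators
lies in the convex hull of the generators where `r` is attained. -/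
theorem mem_convexHull_of_tight {E : Type*} [AddCommGroup E] [Module ℝ E] {S : Set E}
    (f : E →ₗ[ℝ] ℝ) {r : ℝ} (hS : ∀ y ∈ S, f y ≤ r) {z : E} (hz : z ∈ convexHull ℝ S)
    (hfz : f z = r) : z ∈ convexHull ℝ {y ∈ S | f y = r} := by
  let C : Set E := {z | f z ≤ r ∧ (f z = r → z ∈ convexHull ℝ {y ∈ S | f y = r})}
  have hC : Convex ℝ C := by
    rintro x ⟨hx1, hx2⟩ y ⟨hy1, hy2⟩ a b ha hb hab
    have ef : f (a • x + b • y) = a * f x + b * f y := by simp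
    have hb' : b = 1 - a := by linarith
    refine ⟨by rw [ef, hb']; nlinarith, fun he => ?_⟩
    rw [ef] at he
    rcases ha.eq_or_lt with rfl | ha
    · have : b = 1 := by linarith
      subst this
      simpa using hy2 (by simpa using he)
    rcases hb.eq_or_lt with rfl | hb
    · have : a = 1 := by linarith
      subst this
      simpa using hx2 (by simpa using he)
    have h1 : a * (r - f x) + b * (r - f y) = 0 := by rw [hb'] at he ⊢; linarith
    have h2 : 0 ≤ a * (r - f x) := mul_nonneg ha.le (by linarith)
    have h3 : 0 ≤ b * (r - f y) := mul_nonneg hb.le (by linarith)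
    have h4 : a * (r - f x) = 0 := by linarith
    have h5 : b * (r - f y) = 0 := by linarith
    refine convex_convexHull ℝ _ (hx2 ?_) (hy2 ?_) ha.le hb.le hab
    · rcases mul_eq_zero.1 h4 with h | h <;> linarith
    · rcases mul_eq_zero.1 h5 with h | h <;> linarith
  have hSC : S ⊆ C := fun y hy => ⟨hS y hy, fun h => subset_convexHull ℝ _ ⟨hy, h⟩⟩
  exact (convexHull_min hSC hC hz).2 hfz

namespace FacetSystem

section Points

variable {κ ι E : Type*} [NormedAddCommGroup E] [NormedSpace ℝ E] {s : κ → Finset ι} {P : Set E}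

/-- Each face has a point in its relative interior: the centroid of its vertices. -/
theorem exists_point (hs : IsClosedFamily s) [Finite κ] (h : FacetSystem s P) {τ : Finset ι} {k : κ}
    (hk : τ ⊆ s k) : ∃ x ∈ P, ∀ i, h.l i x = h.b i ↔ i ∈ τ := by
  classical
  have := Fintype.ofFinite κ
  let T : Finset κ := Finset.univ.filter fun k => τ ⊆ s k
  have hkT : k ∈ T := by simp [T, hk]
  have hT : (0 : ℝ) < T.card := by exact_mod_cast Finset.card_pos.2 ⟨k, hkT⟩
  refine ⟨∑ k ∈ T, (T.card : ℝ)⁻¹ • h.v k, ?_, fun i => ?_⟩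
  · refine h.convex.sum_mem (fun _ _ => by positivity) ?_ fun k _ => h.mem k
    rw [Finset.sum_const, nsmul_eq_mul, mul_inv_cancel₀ hT.ne']
  · have e1 : h.l i (∑ k ∈ T, (T.card : ℝ)⁻¹ • h.v k) =
        (T.card : ℝ)⁻¹ * ∑ k ∈ T, h.l i (h.v k) := by
      rw [map_sum, Finset.mul_sum]; simp
    have e2 : h.b i = (T.card : ℝ)⁻¹ * ∑ k ∈ T, h.b i := by
      rw [Finset.sum_const, nsmul_eq_mul, ← mul_assoc, inv_mul_cancel₀ hT.ne', one_mul]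
    rw [e1]
    nth_rw 1 [e2]
    rw [mul_right_inj' (inv_ne_zero hT.ne'),
      Finset.sum_eq_sum_iff_of_le fun k _ => h.le _ (h.mem k) i]
    constructor
    · intro hall
      by_contra hi
      obtain ⟨k', h1, h2⟩ := hs.exists_notMem hk hi
      exact h2 ((h.eq_iff k' i).1 (hall k' (by simp [T, h1])))
    · intro hi k' hk'
      exact (h.eq_iff k' i).2 ((Finset.mem_filter.1 hk').2 hi)

/-- A full-dimensional simple polytope can be moved to `ℝ^d` so that its inequalities take the form
`l i ≤ 1`. -/
theorem exists_centered (hs : IsClosedFamily s) [Finite κ] [FiniteDimensional ℝ E]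
    (h : FacetSystem s P) {d : ℕ} (hd : Module.finrank ℝ E = d)
    (hcard : ∃ k, (s k).card = d) :
    ∃ (P' : Set (Fin d → ℝ)) (h' : FacetSystem s P'), (∀ i, h'.b i = 1) ∧
      P' = {x | ∀ i, h'.l i x ≤ 1} := by
  obtain ⟨k0, hk0⟩ := hcard
  obtain ⟨p, hpP, hp⟩ := h.exists_point hs (Finset.empty_subset (s k0))
  have htop : vectorSpan ℝ P = ⊤ := by
    apply Submodule.eq_top_of_finrank_eq
    rw [hd, ← hk0]
    exact h.polytopeDim_eq hs k0
  let e : E ≃L[ℝ] (Fin d → ℝ) := ContinuousLinearEquiv.ofFinrankEq (by simp [hd])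
  have hlt : ∀ i, 0 < h.b i - h.l i p := fun i => by
    refine sub_pos.2 (lt_of_le_of_ne ?_ fun e => by simpa using (hp i).1 e)
    exact h.le p hpP i
  let l' : ι → (Fin d → ℝ) →L[ℝ] ℝ := fun i => (h.b i - h.l i p)⁻¹ • (h.l i ∘L (e.symm : _ →L[ℝ] E))
  have hl' : ∀ i x, l' i x = (h.b i - h.l i p)⁻¹ * h.l i (e.symm x) := fun i x => rfl
  have hv : ∀ i k, l' i (e (h.v k - p)) = (h.l i (h.v k) - h.l i p) / (h.b i - h.l i p) := by
    intro i k
    rw [hl', e.symm_apply_apply, map_sub, div_eq_inv_mul]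
  refine ⟨{x | ∀ i, l' i x ≤ 1}, ⟨l', fun _ => 1, fun k => e (h.v k - p), ?_, ?_, ?_, ?_, ?_⟩,
    fun _ => rfl, rfl⟩
  · intro x hx y hy a b ha hb hab i
    simp only [map_add, map_smul, smul_eq_mul]
    have h1 := hx i
    have h2 := hy i
    nlinarith
  · intro k i
    rw [hv, div_le_one (hlt i)]
    linarith [h.le _ (h.mem k) i]
  · intro x hx i
    exact hx i
  · intro k i
    rw [hv, div_eq_one_iff_eq (hlt i).ne', sub_left_inj, h.eq_iff]
  · intro k y _ hy
    have h1 := h.inj k (e.symm y) (by rw [htop]; trivial) fun i hi => by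
      have := hy i hi
      rw [hl'] at this
      exact (mul_eq_zero.1 this).resolve_left (inv_ne_zero (hlt i).ne')
    simpa using h1

end Points

section Polar

variable {κ ι : Type*} {d : ℕ} {s : κ → Finset ι} {P : Set (Fin d → ℝ)}

/-- The vertices of the polar polytope: the normal vectors of the facets. -/
noncomputable def normal (h : FacetSystem s P) (i : ι) : Fin d → ℝ := fun j => h.l i (Pi.single j 1)

theorem dot_normal (h : FacetSystem s P) (i : ι) (x : Fin d → ℝ) :
    dotCLM x (h.normal i) = h.l i x := by
  conv_rhs => rw [eq_dotCLM (h.l i)]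
  rw [dotCLM_comm]; rfl

/-- The polar polytope. -/
noncomputable def polar (h : FacetSystem s P) : Set (Fin d → ℝ) :=
  convexHull ℝ (Set.range h.normal)

/-- The face of the polar polytope spanned by the vertices in `τ`. -/
noncomputable def polarFace (h : FacetSystem s P) (τ : Finset ι) : Set (Fin d → ℝ) :=
  convexHull ℝ (h.normal '' τ)

theorem normal_mem_polar (h : FacetSystem s P) (i : ι) : h.normal i ∈ h.polar :=
  subset_convexHull ℝ _ ⟨i, rfl⟩

/-- The normal vectors positively span the space, as `P` is bounded. -/
theorem exists_pos (hs : IsClosedFamily s) [Finite κ] (h : FacetSystem s P)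
    (hP : P = {x | ∀ i, h.l i x ≤ 1}) {y : Fin d → ℝ} (hy : y ≠ 0) : ∃ i, 0 < h.l i y := by
  by_contra! hneg
  obtain ⟨k, w, hw, he⟩ := h.exists_max hs (dotCLM y)
  have hyy : 0 < dotCLM y y := by
    rw [dotCLM_apply]
    obtain ⟨j, hj⟩ := Function.ne_iff.1 hy
    exact Finset.sum_pos' (fun i _ => mul_self_nonneg _)
      ⟨j, Finset.mem_univ _, mul_self_pos.2 hj⟩
  have hray : ∀ t : ℝ, 0 ≤ t → t * dotCLM y y ≤ dotCLM y (h.v k) := by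
    intro t ht
    have hmem : t • y ∈ P := by
      rw [hP]
      intro i
      rw [map_smul, smul_eq_mul]
      have := mul_nonpos_of_nonneg_of_nonpos ht (hneg i)
      linarith
    have h1 := he _ hmem
    have h2 := h.sum_nonpos hw hmem
    rw [map_smul, smul_eq_mul] at h1
    linarith
  have h0 := hray 0 le_rfl
  have h1 := hray ((dotCLM y (h.v k) + 1) / dotCLM y y) (div_nonneg (by linarith) hyy.le)
  rw [div_mul_cancel₀ _ hyy.ne'] at h1
  linarith

theorem dot_le_one (h : FacetSystem s P) (hb : ∀ i, h.b i = 1) {x z : Fin d → ℝ} (hx : x ∈ P)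
    (hz : z ∈ h.polar) : dotCLM x z ≤ 1 := by
  have hc : Convex ℝ {z | dotCLM x z ≤ 1} := convex_halfSpace_le (dotCLM x).isLinear 1
  refine convexHull_min ?_ hc hz
  rintro _ ⟨i, rfl⟩
  have := h.le x hx i
  rw [hb] at this
  rwa [Set.mem_ofPred_eq, dot_normal]

theorem polarFace_eq (h : FacetSystem s P) (hb : ∀ i, h.b i = 1) {x : Fin d → ℝ} (hx : x ∈ P)
    {τ : Finset ι} (hτ : ∀ i, h.l i x = 1 ↔ i ∈ τ) :
    h.polarFace τ = {z ∈ h.polar | dotCLM x z = 1} := by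
  apply Set.Subset.antisymm
  · intro z hz
    refine ⟨convexHull_mono (Set.image_subset_range _ _) hz, ?_⟩
    have hc : Convex ℝ {z | dotCLM x z = 1} := convex_hyperplane (dotCLM x).isLinear 1
    refine convexHull_min ?_ hc hz
    rintro _ ⟨i, hi, rfl⟩
    rw [Set.mem_ofPred_eq, dot_normal]
    exact (hτ i).2 hi
  · rintro z ⟨hz, hxz⟩
    refine convexHull_mono ?_ (mem_convexHull_of_tight (dotCLM x).toLinearMap (r := 1) ?_ hz hxz)
    · rintro _ ⟨⟨i, rfl⟩, hi⟩
      refine ⟨i, (hτ i).1 ?_, rfl⟩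
      rw [← dot_normal]; exact hi
    · rintro _ ⟨i, rfl⟩
      exact h.dot_le_one hb hx (h.normal_mem_polar i)

theorem isExposed_polarFace_aux (h : FacetSystem s P) (hb : ∀ i, h.b i = 1) {x : Fin d → ℝ}
    (hx : x ∈ P) {τ : Finset ι} (hτ : ∀ i, h.l i x = 1 ↔ i ∈ τ) :
    IsExposed ℝ h.polar (h.polarFace τ) := by
  rw [h.polarFace_eq hb hx hτ]
  rintro ⟨z0, hz0, h0⟩
  refine ⟨dotCLM x, ?_⟩
  ext z
  constructor
  · rintro ⟨hz, h1⟩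
    exact ⟨hz, fun y hy => by rw [h1]; exact h.dot_le_one hb hx hy⟩
  · rintro ⟨hz, h1⟩
    exact ⟨hz, le_antisymm (h.dot_le_one hb hx hz) (by rw [← h0]; exact h1 z0 hz0)⟩

theorem affineIndependent_normal (hs : IsClosedFamily s) (h : FacetSystem s P) (k : κ) :
    AffineIndependent ℝ fun i : {i // i ∈ s k} => h.normal i := by
  rw [affineIndependent_iff]
  intro t w _ hsum i hi
  obtain ⟨k', h1, h2⟩ := hs.adj k i i.2
  have e := congrArg (dotCLM (h.v k' - h.v k)) hsum
  simp only [map_sum, map_smul, dot_normal, smul_eq_mul, map_zero, map_sub] at e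
  rw [Finset.sum_eq_single_of_mem i hi] at e
  · rw [(h.eq_iff k i).2 i.2] at e
    exact (mul_eq_zero.1 e).resolve_right (sub_neg.2 (h.lt_of_notMem h2)).ne
  · intro j _ hji
    rw [(h.eq_iff k j).2 j.2, (h.eq_iff k' j).2 (h1 j j.2 fun e => hji (Subtype.ext e))]
    simp

variable [Finite κ]

theorem isExposed_polarFace (hs : IsClosedFamily s) (h : FacetSystem s P) (hb : ∀ i, h.b i = 1)
    {τ : Finset ι} {k : κ} (hk : τ ⊆ s k) : IsExposed ℝ h.polar (h.polarFace τ) := by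
  obtain ⟨x, hx, hτ⟩ := h.exists_point hs hk
  simp only [hb] at hτ
  exact h.isExposed_polarFace_aux hb hx hτ

theorem normal_mem_polarFace_iff (hs : IsClosedFamily s) (h : FacetSystem s P)
    (hb : ∀ i, h.b i = 1) {τ : Finset ι} {k : κ} (hk : τ ⊆ s k) {i : ι} :
    h.normal i ∈ h.polarFace τ ↔ i ∈ τ := by
  refine ⟨fun hi => ?_, fun hi => subset_convexHull ℝ _ ⟨i, hi, rfl⟩⟩
  obtain ⟨x, hx, hτ⟩ := h.exists_point hs hk
  simp only [hb] at hτ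
  rw [h.polarFace_eq hb hx hτ] at hi
  rw [← hτ, ← dot_normal]
  exact hi.2

theorem polarFace_subset_iff (hs : IsClosedFamily s) (h : FacetSystem s P) (hb : ∀ i, h.b i = 1)
    {τ τ' : Finset ι} {k : κ} (hk : τ' ⊆ s k) :
    h.polarFace τ ⊆ h.polarFace τ' ↔ τ ⊆ τ' := by
  constructor
  · intro hsub i hi
    exact (h.normal_mem_polarFace_iff hs hb hk).1 (hsub (subset_convexHull ℝ _ ⟨i, hi, rfl⟩))
  · intro hsub
    exact convexHull_mono (Set.image_mono (by simpa using hsub))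

theorem normal_injective (hs : IsClosedFamily s) (h : FacetSystem s P) (hb : ∀ i, h.b i = 1) :
    Function.Injective h.normal := by
  intro i j hij
  obtain ⟨k, hk⟩ := hs.cover j
  have := (h.normal_mem_polarFace_iff hs hb (τ := {j}) (i := i)
    (Finset.singleton_subset_iff.2 hk)).1 (by rw [hij]; exact subset_convexHull ℝ _ ⟨j, by simp, rfl⟩)
  simpa using this

theorem not_polar_subset_polarFace (hs : IsClosedFamily s) (h : FacetSystem s P)
    (hb : ∀ i, h.b i = 1) (hP : P = {x | ∀ i, h.l i x ≤ 1}) [Nonempty ι]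
    {τ : Finset ι} {k : κ} (hk : τ ⊆ s k) : ¬ h.polar ⊆ h.polarFace τ := by
  intro hsub
  obtain ⟨x, hx, hτ⟩ := h.exists_point hs hk
  simp only [hb] at hτ
  have hall : ∀ i, h.l i x = 1 := fun i =>
    (hτ i).2 ((h.normal_mem_polarFace_iff hs hb hk).1 (hsub (h.normal_mem_polar i)))
  have hx0 : x ≠ 0 := by
    rintro rfl
    obtain ⟨i⟩ := ‹Nonempty ι›
    simpa using hall i
  obtain ⟨i, hi⟩ := h.exists_pos hs hP (neg_ne_zero.2 hx0)
  rw [map_neg, hall] at hi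
  linarith

theorem exists_eq_polarFace (hs : IsClosedFamily s) [Finite ι] (h : FacetSystem s P)
    (hb : ∀ i, h.b i = 1) (hP : P = {x | ∀ i, h.l i x ≤ 1}) {A : Set (Fin d → ℝ)}
    (hA : IsExposed ℝ h.polar A) (hne : A.Nonempty) (hAQ : A ≠ h.polar) :
    ∃ τ, (∃ k, τ ⊆ s k) ∧ A = h.polarFace τ := by
  classical
  obtain ⟨f, hf⟩ := hA hne
  rw [eq_dotCLM f] at hf
  set y : Fin d → ℝ := fun j => f (Pi.single j 1)
  have hy : y ≠ 0 := by
    intro hy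
    apply hAQ
    rw [hf, hy]
    ext z
    simp
  obtain ⟨i1, hi1⟩ := h.exists_pos hs hP hy
  have : Nonempty ι := ⟨i1⟩
  obtain ⟨i0, hi0⟩ := Finite.exists_max fun i => h.l i y
  set M := h.l i0 y with hM
  have hMpos : 0 < M := hi1.trans_le (hi0 i1)
  let x := M⁻¹ • y
  have hlx : ∀ i, h.l i x = M⁻¹ * h.l i y := fun i => by simp [x]
  have hx : x ∈ P := by
    rw [hP]
    intro i
    rw [hlx, inv_mul_le_one₀ hMpos]
    exact hi0 i
  let τ : Finset ι := (Set.toFinite {i | h.l i x = 1}).toFinset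
  have hτ : ∀ i, h.l i x = 1 ↔ i ∈ τ := fun i => by simp [τ]
  have hxτ : x ∈ h.face τ := ⟨hx, fun i hi => by rw [hb]; exact (hτ i).2 hi⟩
  refine ⟨τ, h.exists_subset_of_mem_face hs hxτ, ?_⟩
  rw [h.polarFace_eq hb hx hτ, hf]
  have hxy : ∀ z, dotCLM x z = M⁻¹ * dotCLM y z := fun z => by
    rw [dotCLM_comm, map_smul, smul_eq_mul, dotCLM_comm]
  have hi0x : dotCLM x (h.normal i0) = 1 := by
    rw [dot_normal, hlx, ← hM, inv_mul_cancel₀ hMpos.ne']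
  ext z
  constructor
  · rintro ⟨hz, hmax⟩
    refine ⟨hz, le_antisymm (h.dot_le_one hb hx hz) ?_⟩
    rw [← hi0x, hxy, hxy]
    exact mul_le_mul_of_nonneg_left (hmax _ (h.normal_mem_polar i0)) (inv_nonneg.2 hMpos.le)
  · rintro ⟨hz, hz1⟩
    refine ⟨hz, fun w hw => ?_⟩
    have h1 := h.dot_le_one hb hx hw
    rw [← hz1, hxy, hxy] at h1
    exact le_of_mul_le_mul_left h1 (inv_pos.2 hMpos)

theorem extremePoints_polar (hs : IsClosedFamily s) (h : FacetSystem s P) (hb : ∀ i, h.b i = 1) :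
    h.polar.extremePoints ℝ = Set.range h.normal := by
  refine Set.Subset.antisymm extremePoints_convexHull_subset ?_
  rintro _ ⟨i, rfl⟩
  obtain ⟨k, hk⟩ := hs.cover i
  apply exposedPoints_subset_extremePoints
  rw [mem_exposedPoints_iff_exposed_singleton]
  have := h.isExposed_polarFace hs hb (Finset.singleton_subset_iff.2 hk)
  simpa [polarFace] using this

theorem isSimplicialPolytope_polar (hs : IsClosedFamily s) [Finite ι] [Nonempty ι]
    (h : FacetSystem s P) (hb : ∀ i, h.b i = 1) (hP : P = {x | ∀ i, h.l i x ≤ 1}) :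
    IsSimplicialPolytope h.polar := by
  classical
  refine ⟨⟨(Set.finite_range h.normal).toFinset, ?_, ?_⟩, fun A hA hAQ => ?_⟩
  · simpa using Set.range_nonempty h.normal
  · simp [polar]
  · rcases A.eq_empty_or_nonempty with rfl | hne
    · rw [extremePoints_empty]
      exact affineIndependent_of_subsingleton ℝ _
    · obtain ⟨τ, ⟨k, hk⟩, rfl⟩ := h.exists_eq_polarFace hs hb hP hA hne hAQ
      refine ((h.affineIndependent_normal hs k).range).mono ?_
      refine extremePoints_convexHull_subset.trans ?_
      rintro _ ⟨i, hi, rfl⟩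
      exact ⟨⟨i, hk hi⟩, rfl⟩

theorem polytopeDim_polar (hs : IsClosedFamily s) [Nonempty ι]
    (h : FacetSystem s P) (hP : P = {x | ∀ i, h.l i x ≤ 1}) :
    polytopeDim h.polar = d := by
  have htop : vectorSpan ℝ h.polar = ⊤ := by
    by_contra hne
    obtain ⟨f, hf0, hf⟩ := Submodule.exists_le_ker_of_lt_top _ (lt_top_iff_ne_top.2 hne)
    have hf' := eq_dotCLM f.toContinuousLinearMap
    set y : Fin d → ℝ := fun j => f.toContinuousLinearMap (Pi.single j 1)
    have hfy : ∀ z, f z = dotCLM y z := fun z => DFunLike.congr_fun hf' z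
    have hy : y ≠ 0 := by
      intro hy
      apply hf0
      ext z
      simp [hfy, hy]
    obtain ⟨i, hi⟩ := h.exists_pos hs hP hy
    obtain ⟨j, hj⟩ := h.exists_pos hs hP (neg_ne_zero.2 hy)
    have h1 := hf (vsub_mem_vectorSpan ℝ (h.normal_mem_polar i) (h.normal_mem_polar j))
    rw [LinearMap.mem_ker, vsub_eq_sub, map_sub, hfy, hfy, dot_normal, dot_normal] at h1
    rw [map_neg] at hj
    linarith
  rw [polytopeDim, htop, finrank_top]
  simp

theorem combDual_polar (hs : IsClosedFamily s) [Finite ι] [Nonempty ι]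
    (h : FacetSystem s P) (hb : ∀ i, h.b i = 1) (hP : P = {x | ∀ i, h.l i x ≤ 1}) :
    CombDual P h.polar := by
  obtain ⟨e1⟩ := h.nonempty_faceLattice_iso hs
  let g : WithTop {τ : Finset ι // ∃ k, τ ⊆ s k} → FaceLattice h.polar := fun t =>
    WithTop.recTopCoe (C := fun _ => FaceLattice h.polar) ⟨h.polar, IsExposed.refl _⟩
      (fun τ => ⟨h.polarFace τ.1, h.isExposed_polarFace hs hb τ.2.choose_spec⟩) t
  have hle : ∀ t t', g t ≤ g t' ↔ t ≤ t' := by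
    intro t t'
    induction t' using WithTop.recTopCoe with
    | top =>
      simp only [le_top, iff_true]
      exact (g t).2.subset
    | coe τ' =>
      obtain ⟨τ', k, hk⟩ := τ'
      induction t using WithTop.recTopCoe with
      | top =>
        simp only [top_le_iff, WithTop.coe_ne_top, iff_false]
        exact h.not_polar_subset_polarFace hs hb hP hk
      | coe τ =>
        rw [WithTop.coe_le_coe]
        exact h.polarFace_subset_iff hs hb hk
  have hsurj : Function.Surjective g := by
    rintro ⟨A, hA⟩
    by_cases hAQ : A = h.polar
    · subst hAQ
      exact ⟨⊤, rfl⟩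
    rcases A.eq_empty_or_nonempty with rfl | hne
    · obtain ⟨k⟩ := hs.nonempty
      refine ⟨((⟨∅, k, Finset.empty_subset _⟩ : {τ : Finset ι // ∃ k, τ ⊆ s k}) : WithTop _), ?_⟩
      apply Subtype.ext
      change convexHull ℝ (h.normal '' ((∅ : Finset ι) : Set ι)) = ∅
      simp
    · obtain ⟨τ, hτ, rfl⟩ := h.exists_eq_polarFace hs hb hP hA hne hAQ
      exact ⟨((⟨τ, hτ⟩ : {τ : Finset ι // ∃ k, τ ⊆ s k}) : WithTop _), rfl⟩
  have hinj : Function.Injective g := fun a b hab =>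
    le_antisymm ((hle a b).1 hab.le) ((hle b a).1 hab.ge)
  let e2 : WithTop {τ : Finset ι // ∃ k, τ ⊆ s k} ≃o FaceLattice h.polar :=
    ⟨Equiv.ofBijective g ⟨hinj, hsurj⟩, fun {a b} => hle a b⟩
  exact ⟨e1.symm.trans e2.dual⟩

theorem complexIso_polar (hs : IsClosedFamily s) [Finite ι] [Nonempty ι]
    (h : FacetSystem s P) (hb : ∀ i, h.b i = 1) (hP : P = {x | ∀ i, h.l i x ≤ 1}) :
    ComplexIso (generatedBy (Set.range s)) (boundaryComplex h.polar) := by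
  classical
  have hinj := h.normal_injective hs hb
  let g : (generatedBy (Set.range s)).faces → (boundaryComplex h.polar).faces := fun τ =>
    ⟨τ.1.image h.normal, by
      obtain ⟨τ, hτ, -, ⟨k, rfl⟩, hk⟩ := τ
      refine ⟨hτ.image _, τ.image h.normal, ⟨?_, h.polarFace τ, h.isExposed_polarFace hs hb hk,
        ?_, ?_⟩, subset_rfl⟩
      · rw [h.extremePoints_polar hs hb]
        simp
      · intro e
        exact h.not_polar_subset_polarFace hs hb hP hk e.ge
      · rw [Finset.coe_image]
        exact subset_convexHull ℝ _⟩
  have hle : ∀ t t', g t ≤ g t' ↔ t ≤ t' := fun t t' => Finset.image_subset_image_iff hinj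
  have hsurj : Function.Surjective g := by
    rintro ⟨τ, hτ, ρ, ⟨hρe, A, hA, hAQ, hρA⟩, hτρ⟩
    rw [h.extremePoints_polar hs hb] at hρe
    have hne : A.Nonempty := by
      obtain ⟨x, hx⟩ := hτ
      exact ⟨x, hρA (hτρ hx)⟩
    obtain ⟨α, ⟨k, hk⟩, rfl⟩ := h.exists_eq_polarFace hs hb hP hA hne hAQ
    have hsub : ∀ x ∈ τ, ∃ i ∈ α, h.normal i = x := by
      intro x hx
      obtain ⟨i, rfl⟩ := hρe (hτρ hx)
      exact ⟨i, (h.normal_mem_polarFace_iff hs hb hk).1 (hρA (hτρ hx)), rfl⟩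
    have himg : (α.filter fun i => h.normal i ∈ τ).image h.normal = τ := by
      ext x
      simp only [Finset.mem_image, Finset.mem_filter]
      constructor
      · rintro ⟨i, ⟨-, hi⟩, rfl⟩
        exact hi
      · intro hx
        obtain ⟨i, hi, rfl⟩ := hsub x hx
        exact ⟨i, ⟨hi, hx⟩, rfl⟩
    refine ⟨⟨α.filter fun i => h.normal i ∈ τ, ?_, s k, ⟨k, rfl⟩,
      (Finset.filter_subset _ _).trans hk⟩, Subtype.ext himg⟩
    rw [← himg] at hτ
    exact Finset.image_nonempty.1 hτ
  have hinj' : Function.Injective g := fun a b hab =>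
    le_antisymm ((hle a b).1 hab.le) ((hle b a).1 hab.ge)
  exact ⟨⟨Equiv.ofBijective g ⟨hinj', hsurj⟩, fun {a b} => hle a b⟩⟩

end Polar

/-- A complex isomorphic to the one generated by the vertices of a full-dimensional simple polytope
`L` is polytopal, with `L` as its dual simple polytope up to combinatorial equivalence. -/
theorem exists_isNerveComplexOf {V κ ι E : Type*} [NormedAddCommGroup E] [NormedSpace ℝ E]
    [FiniteDimensional ℝ E] [Finite κ] [Finite ι] [Nonempty ι] {s : κ → Finset ι} {L : Set E}
    (hs : IsClosedFamily s) (h : FacetSystem s L) {d : ℕ} (hd : Module.finrank ℝ E = d)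
    (hcard : ∃ k, (s k).card = d) {K : PreAbstractSimplicialComplex V}
    (hK : ComplexIso K (generatedBy (Set.range s))) :
    IsPolytopalSphere K ∧ ∃ P : Set (Fin d → ℝ), IsNerveComplexOf K P ∧ CombEquiv P L := by
  obtain ⟨P, h', hb, hP⟩ := h.exists_centered hs hd hcard
  obtain ⟨k, hk⟩ := hcard
  have hKQ : ComplexIso K (boundaryComplex h'.polar) := by
    obtain ⟨e1⟩ := hK
    obtain ⟨e2⟩ := h'.complexIso_polar hs hb hP
    exact ⟨e1.trans e2⟩
  have h1 := h'.isSimplicialPolytope_polar hs hb hP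
  have h2 := h'.polytopeDim_polar hs hP
  exact ⟨⟨d, h'.polar, h1, h2, hKQ⟩, P, ⟨h'.isSimplePolytope hs, by rw [h'.polytopeDim_eq hs k, hk],
    h'.polar, h1, h2, hKQ, h'.combDual_polar hs hb hP⟩, h'.combEquiv hs h⟩

end FacetSystem

/-! ### Cubes, products, polygons and the cube with two cut edges -/

/-- The vertices of the cube `I^A` are the maps `ε : A → Bool`; the facet `(a, b)` passes through
those with `ε a = b`. -/
def cubeFamily (A : Type*) [Fintype A] [DecidableEq A] (ε : A → Bool) : Finset (A × Bool) :=
  Finset.univ.image fun a => (a, ε a)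

/-- The incidences of a product of simple polytopes; the generated complex is a join. -/
def joinFamily {κ₁ κ₂ ι₁ ι₂ : Type*} (s₁ : κ₁ → Finset ι₁) (s₂ : κ₂ → Finset ι₂)
    (k : κ₁ × κ₂) : Finset (ι₁ ⊕ ι₂) :=
  (s₁ k.1).disjSum (s₂ k.2)

theorem map_mem_vectorSpan {E F : Type*} [AddCommGroup E] [Module ℝ E] [AddCommGroup F]
    [Module ℝ F] (f : E →ₗ[ℝ] F) {S : Set E} {T : Set F} (hf : ∀ x ∈ S, f x ∈ T) {y : E}
    (hy : y ∈ vectorSpan ℝ S) : f y ∈ vectorSpan ℝ T := by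
  have : vectorSpan ℝ S ≤ (vectorSpan ℝ T).comap f := by
    rw [vectorSpan_def, Submodule.span_le]
    rintro _ ⟨a, ha, b, hb, rfl⟩
    simpa using vsub_mem_vectorSpan ℝ (hf a ha) (hf b hb)
  exact this hy

section Families

variable {A : Type*} [Fintype A] [DecidableEq A]

@[simp] theorem mem_cubeFamily {ε : A → Bool} {x : A × Bool} :
    x ∈ cubeFamily A ε ↔ ε x.1 = x.2 := by
  obtain ⟨a, b⟩ := x
  simp [cubeFamily]

theorem card_cubeFamily (ε : A → Bool) : (cubeFamily A ε).card = Fintype.card A := by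
  rw [cubeFamily, Finset.card_image_of_injective _ fun a b h => (Prod.ext_iff.1 h).1,
    Finset.card_univ]

theorem isClosedFamily_cube : IsClosedFamily (cubeFamily A) where
  nonempty := ⟨fun _ => true⟩
  adj := by
    rintro ε ⟨a, b⟩ h
    rw [mem_cubeFamily] at h
    refine ⟨Function.update ε a (!b), ?_, by simp⟩
    rintro ⟨a', b'⟩ h1 h2
    rw [mem_cubeFamily] at h1 ⊢
    have : a' ≠ a := by
      rintro rfl
      exact h2 (Prod.ext rfl (h1.symm.trans h))
    simpa [this] using h1
  cover := by
    rintro ⟨a, b⟩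
    exact ⟨fun _ => b, by simp⟩

theorem isFlagFamily_cube : IsFlagFamily (cubeFamily A) := by
  intro τ hτ
  refine ⟨fun a => decide ((a, true) ∈ τ), ?_⟩
  rintro ⟨a, b⟩ hab
  rw [mem_cubeFamily]
  cases b with
  | true => simpa using hab
  | false =>
    simp only [decide_eq_false_iff_not]
    intro h
    obtain ⟨k, h1, h2⟩ := hτ _ hab _ h
    rw [mem_cubeFamily] at h1 h2
    simp [h1] at h2

variable {κ₁ κ₂ ι₁ ι₂ : Type*} {s₁ : κ₁ → Finset ι₁} {s₂ : κ₂ → Finset ι₂}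

@[simp] theorem inl_mem_joinFamily {k : κ₁ × κ₂} {i : ι₁} :
    Sum.inl i ∈ joinFamily s₁ s₂ k ↔ i ∈ s₁ k.1 := Finset.inl_mem_disjSum

@[simp] theorem inr_mem_joinFamily {k : κ₁ × κ₂} {i : ι₂} :
    Sum.inr i ∈ joinFamily s₁ s₂ k ↔ i ∈ s₂ k.2 := Finset.inr_mem_disjSum

theorem card_joinFamily (k : κ₁ × κ₂) :
    (joinFamily s₁ s₂ k).card = (s₁ k.1).card + (s₂ k.2).card := Finset.card_disjSum _ _

theorem IsClosedFamily.join (h₁ : IsClosedFamily s₁) (h₂ : IsClosedFamily s₂) :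
    IsClosedFamily (joinFamily s₁ s₂) where
  nonempty := by
    have := h₁.nonempty
    have := h₂.nonempty
    infer_instance
  adj := by
    rintro ⟨k₁, k₂⟩ (i | i) hi
    · obtain ⟨k', h3, h4⟩ := h₁.adj k₁ i (by simpa using hi)
      refine ⟨⟨k', k₂⟩, ?_, by simpa using h4⟩
      rintro (j | j) hj hne
      · simpa using h3 j (by simpa using hj) (fun e => hne (e ▸ rfl))
      · simpa using hj
    · obtain ⟨k', h3, h4⟩ := h₂.adj k₂ i (by simpa using hi)
      refine ⟨⟨k₁, k'⟩, ?_, by simpa using h4⟩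
      rintro (j | j) hj hne
      · simpa using hj
      · simpa using h3 j (by simpa using hj) (fun e => hne (e ▸ rfl))
  cover := by
    obtain ⟨k₁⟩ := h₁.nonempty
    obtain ⟨k₂⟩ := h₂.nonempty
    rintro (i | i)
    · obtain ⟨k, hk⟩ := h₁.cover i
      exact ⟨⟨k, k₂⟩, by simpa using hk⟩
    · obtain ⟨k, hk⟩ := h₂.cover i
      exact ⟨⟨k₁, k⟩, by simpa using hk⟩

theorem IsFlagFamily.join (h₁ : IsFlagFamily s₁) (h₂ : IsFlagFamily s₂) :
    IsFlagFamily (joinFamily s₁ s₂) := by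
  intro τ hτ
  obtain ⟨k₁, hk₁⟩ := h₁ τ.toLeft (by
    intro i hi j hj
    obtain ⟨k, h3, h4⟩ := hτ _ (Finset.mem_toLeft.1 hi) _ (Finset.mem_toLeft.1 hj)
    exact ⟨k.1, by simpa using h3, by simpa using h4⟩)
  obtain ⟨k₂, hk₂⟩ := h₂ τ.toRight (by
    intro i hi j hj
    obtain ⟨k, h3, h4⟩ := hτ _ (Finset.mem_toRight.1 hi) _ (Finset.mem_toRight.1 hj)
    exact ⟨k.2, by simpa using h3, by simpa using h4⟩)
  refine ⟨⟨k₁, k₂⟩, ?_⟩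
  rintro (i | i) hi
  · simpa using hk₁ (Finset.mem_toLeft.2 hi)
  · simpa using hk₂ (Finset.mem_toRight.2 hi)

/-- The facet presentation of a product. -/
noncomputable def FacetSystem.prod {E₁ E₂ : Type*} [NormedAddCommGroup E₁] [NormedSpace ℝ E₁]
    [NormedAddCommGroup E₂] [NormedSpace ℝ E₂] {P₁ : Set E₁} {P₂ : Set E₂}
    (h₁ : FacetSystem s₁ P₁) (h₂ : FacetSystem s₂ P₂) :
    FacetSystem (joinFamily s₁ s₂) (P₁ ×ˢ P₂) where
  l := Sum.elim (fun i => h₁.l i ∘L ContinuousLinearMap.fst ℝ E₁ E₂)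
    (fun i => h₂.l i ∘L ContinuousLinearMap.snd ℝ E₁ E₂)
  b := Sum.elim h₁.b h₂.b
  v k := (h₁.v k.1, h₂.v k.2)
  convex := h₁.convex.prod h₂.convex
  mem k := ⟨h₁.mem k.1, h₂.mem k.2⟩
  le := by
    rintro ⟨x, y⟩ ⟨hx, hy⟩ (i | i)
    · exact h₁.le x hx i
    · exact h₂.le y hy i
  eq_iff := by
    rintro k (i | i)
    · simpa using h₁.eq_iff k.1 i
    · simpa using h₂.eq_iff k.2 i
  inj := by
    rintro k y hy h
    have h3 : y.1 ∈ vectorSpan ℝ P₁ :=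
      map_mem_vectorSpan (LinearMap.fst ℝ E₁ E₂) (fun x hx => hx.1) hy
    have h4 : y.2 ∈ vectorSpan ℝ P₂ :=
      map_mem_vectorSpan (LinearMap.snd ℝ E₁ E₂) (fun x hx => hx.2) hy
    refine Prod.ext (h₁.inj k.1 _ h3 fun i hi => ?_) (h₂.inj k.2 _ h4 fun i hi => ?_)
    · exact h (Sum.inl i) (by simpa using hi)
    · exact h (Sum.inr i) (by simpa using hi)

end Families

/-- The facet presentation of the cube. -/
noncomputable def cubeSystem (n : ℕ) : FacetSystem (cubeFamily (Fin n)) (cube n) where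
  l x := if x.2 then ContinuousLinearMap.proj x.1 else -ContinuousLinearMap.proj x.1
  b x := if x.2 then 1 else 0
  v ε i := if ε i then 1 else 0
  convex := by
    intro x hx y hy a b ha hb hab i
    have h1 := hx i
    have h2 := hy i
    simp only [Pi.add_apply, Pi.smul_apply, smul_eq_mul]
    constructor <;> nlinarith
  mem ε i := by dsimp only; split <;> norm_num
  le := by
    rintro x hx ⟨i, b⟩
    have := hx i
    cases b <;> simp <;> linarith
  eq_iff := by
    rintro ε ⟨i, b⟩
    cases b <;> simp
  inj := by
    rintro ε y - h
    ext i
    have := h (i, ε i) (by simp)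
    dsimp only at this
    split at this <;> simpa using this

/-- The vertex `j` of the `k`-gon lies on the edges `j` and `j + 1`. -/
def polygonFamily (k : ℕ) [NeZero k] (j : Fin k) : Finset (Fin k) := {j, j + 1}

/-- The incidences of the cube with two adjacent edges cut off. The facets `0`, `1`, `3`, `7`, `4`,
`5` are those on which `x 0`, `x 1`, `x 2` are `0` or `1`, and `6`, `2` are the two cuts. -/
def cutCubeFamily : Fin 12 → Finset (Fin 8) :=
  ![{0, 2, 6}, {0, 2, 7}, {0, 5, 6}, {0, 5, 7}, {1, 3, 4}, {1, 3, 5}, {1, 4, 7}, {1, 5, 7},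
    {2, 4, 6}, {2, 4, 7}, {3, 4, 6}, {3, 5, 6}]

theorem isClosedFamily_five : IsClosedFamily (polygonFamily 5) :=
  ⟨⟨0⟩, by decide, by decide⟩

theorem isClosedFamily_six : IsClosedFamily (polygonFamily 6) :=
  ⟨⟨0⟩, by decide, by decide⟩

theorem isClosedFamily_cutCube : IsClosedFamily cutCubeFamily :=
  ⟨⟨0⟩, by decide, by decide⟩

theorem isFlagFamily_five : IsFlagFamily (polygonFamily 5) := by
  unfold IsFlagFamily; decide +kernel

theorem isFlagFamily_six : IsFlagFamily (polygonFamily 6) := by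
  unfold IsFlagFamily; decide +kernel

theorem isFlagFamily_cutCube : IsFlagFamily cutCubeFamily := by
  unfold IsFlagFamily; decide +kernel

/-- A facet presentation from rational data. -/
noncomputable def FacetSystem.ofRat {κ ι : Type*} {d : ℕ} {s : κ → Finset ι} {P : Set (Fin d → ℝ)}
    (q : ι → Fin d → ℚ) (b : ι → ℚ) (v : κ → Fin d → ℚ)
    (hP : Convex ℝ P) (hv : ∀ k, (fun j => (v k j : ℝ)) ∈ P)
    (hle : ∀ x ∈ P, ∀ i, ∑ j, (q i j : ℝ) * x j ≤ b i)
    (heq : ∀ k i, ∑ j, q i j * v k j = b i ↔ i ∈ s k)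
    (hinj : ∀ k (y : Fin d → ℝ), (∀ i ∈ s k, ∑ j, (q i j : ℝ) * y j = 0) → y = 0) :
    FacetSystem s P where
  l i := dotCLM fun j => (q i j : ℝ)
  b i := b i
  v k j := v k j
  convex := hP
  mem := hv
  le x hx i := by simpa using hle x hx i
  eq_iff k i := by
    rw [← heq k i, dotCLM_apply]
    norm_cast
  inj k y _ h := hinj k y fun i hi => by simpa using h i hi

theorem sum_le_of_mem_convexHull {κ : Type*} {d : ℕ} {q : Fin d → ℚ} {b : ℚ} {v : κ → Fin d → ℚ}
    (h : ∀ k, ∑ j, q j * v k j ≤ b) {x : Fin d → ℝ}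
    (hx : x ∈ convexHull ℝ (Set.range fun k j => (v k j : ℝ))) :
    ∑ j, (q j : ℝ) * x j ≤ b := by
  have hc : Convex ℝ {z | dotCLM (fun j => (q j : ℝ)) z ≤ b} :=
    convex_halfSpace_le (dotCLM _).isLinear _
  have := convexHull_min (t := {z | dotCLM (fun j => (q j : ℝ)) z ≤ b}) ?_ hc hx
  · simpa using this
  · rintro _ ⟨k, rfl⟩
    rw [Set.mem_ofPred_eq, dotCLM_apply]
    dsimp only
    exact_mod_cast h k

/-- The facet presentation of the pentagon. -/
noncomputable def pentagonSystem : FacetSystem (polygonFamily 5) (polygon 5) :=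
  have hr : polygon 5 = convexHull ℝ (Set.range fun (k : Fin 5) (j : Fin 2) =>
      (((![![0, 0], ![1, 1], ![2, 4], ![3, 9], ![4, 16]] : Fin 5 → Fin 2 → ℚ) k j : ℚ) : ℝ)) := by
    rw [polygon]
    congr 2
    ext k j
    fin_cases k <;> fin_cases j <;> norm_num
  .ofRat ![![-4, 1], ![1, -1], ![3, -1], ![5, -1], ![7, -1]] ![0, 0, 2, 6, 12]
    ![![0, 0], ![1, 1], ![2, 4], ![3, 9], ![4, 16]]
    (by rw [hr]; exact convex_convexHull ℝ _)
    (by rw [hr]; exact fun k => subset_convexHull ℝ _ ⟨k, rfl⟩)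
    (by
      rw [hr]
      intro x hx i
      refine sum_le_of_mem_convexHull ?_ hx
      revert i
      decide +kernel)
    (by decide +kernel)
    (by
      intro k y h
      ext j
      fin_cases k <;> simp [polygonFamily, Fin.sum_univ_two] at h <;> fin_cases j <;> simp <;>
        linarith)

/-- The facet presentation of the hexagon. -/
noncomputable def hexagonSystem : FacetSystem (polygonFamily 6) (polygon 6) :=
  have hr : polygon 6 = convexHull ℝ (Set.range fun (k : Fin 6) (j : Fin 2) =>
      (((![![0, 0], ![1, 1], ![2, 4], ![3, 9], ![4, 16], ![5, 25]] : Fin 6 → Fin 2 → ℚ) k j : ℚ)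
        : ℝ)) := by
    rw [polygon]
    congr 2
    ext k j
    fin_cases k <;> fin_cases j <;> norm_num
  .ofRat ![![-5, 1], ![1, -1], ![3, -1], ![5, -1], ![7, -1], ![9, -1]] ![0, 0, 2, 6, 12, 20]
    ![![0, 0], ![1, 1], ![2, 4], ![3, 9], ![4, 16], ![5, 25]]
    (by rw [hr]; exact convex_convexHull ℝ _)
    (by rw [hr]; exact fun k => subset_convexHull ℝ _ ⟨k, rfl⟩)
    (by
      rw [hr]
      intro x hx i
      refine sum_le_of_mem_convexHull ?_ hx
      revert i
      decide +kernel)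
    (by decide +kernel)
    (by
      intro k y h
      ext j
      fin_cases k <;> simp [polygonFamily, Fin.sum_univ_two] at h <;> fin_cases j <;> simp <;>
        linarith)

/-- The vertices of the cube with two adjacent edges cut off. -/
def cutCubeVertex : Fin 12 → Fin 3 → ℚ :=
  ![![0, 1/2, 1/4], ![0, 1, 1/4], ![0, 1/2, 1], ![0, 1, 1], ![1, 0, 0], ![1, 0, 1], ![1, 1, 0],
    ![1, 1, 1], ![1/4, 1/4, 0], ![1/4, 1, 0], ![1/2, 0, 0], ![1/2, 0, 1]]

/-- The facet presentation of the cube with two adjacent edges cut off. -/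
noncomputable def cutCubeSystem : FacetSystem cutCubeFamily cubeTwoEdgeCuts :=
  .ofRat ![![-1, 0, 0], ![1, 0, 0], ![-1, 0, -1], ![0, -1, 0], ![0, 0, -1], ![0, 0, 1],
      ![-1, -1, 0], ![0, 1, 0]]
    ![0, 1, -1/4, 0, 0, 1, -1/2, 1]
    cutCubeVertex
    (by
      rintro x ⟨hx, hx1, hx2⟩ y ⟨hy, hy1, hy2⟩ a b ha hb hab
      refine ⟨(cubeSystem 3).convex hx hy ha hb hab, ?_, ?_⟩ <;>
        simp only [Pi.add_apply, Pi.smul_apply, smul_eq_mul] <;> nlinarith)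
    (by
      intro k
      have hk : (∀ i, 0 ≤ cutCubeVertex k i ∧ cutCubeVertex k i ≤ 1) ∧
          1 / 2 ≤ cutCubeVertex k 0 + cutCubeVertex k 1 ∧
          1 / 4 ≤ cutCubeVertex k 0 + cutCubeVertex k 2 := by
        revert k; decide +kernel
      refine ⟨fun i => ?_, ?_, ?_⟩
      · have := hk.1 i
        rify at this
        exact this
      · have := hk.2.1
        rify at this
        exact this
      · have := hk.2.2
        rify at this
        exact this)
    (by
      rintro x ⟨hx, hx1, hx2⟩ i
      have h0 := hx 0
      have h1 := hx 1
      have h2 := hx 2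
      fin_cases i <;> simp [Fin.sum_univ_three] <;> linarith)
    (by decide +kernel)
    (by
      intro k y h
      ext j
      fin_cases k <;> simp [cutCubeFamily, Fin.sum_univ_three] at h <;> fin_cases j <;> simp <;>
        linarith)

/-! ### Nestohedra -/

theorem simplex_bounds {N : ℕ} {T : Finset (Fin N)} {y : Fin N → ℝ}
    (hy : y ∈ convexHull ℝ ((fun i : Fin N => (Pi.single i 1 : Fin N → ℝ)) '' (T : Set (Fin N)))) :
    (∀ j, 0 ≤ y j) ∧ (∀ j ∉ T, y j = 0) ∧ ∑ j, y j = 1 := by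
  let C : Set (Fin N → ℝ) := {y | (∀ j, 0 ≤ y j) ∧ (∀ j ∉ T, y j = 0) ∧ ∑ j, y j = 1}
  have hC : Convex ℝ C := by
    rintro x ⟨hx1, hx2, hx3⟩ y ⟨hy1, hy2, hy3⟩ a b ha hb hab
    refine ⟨fun j => ?_, fun j hj => ?_, ?_⟩
    · have := hx1 j
      have := hy1 j
      simp only [Pi.add_apply, Pi.smul_apply, smul_eq_mul]
      positivity
    · simp [hx2 j hj, hy2 j hj]
    · simp only [Pi.add_apply, Pi.smul_apply, smul_eq_mul, Finset.sum_add_distrib,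
        ← Finset.mul_sum, hx3, hy3]
      linarith
  refine (convexHull_min ?_ hC hy : y ∈ C)
  rintro _ ⟨i, hi, rfl⟩
  refine ⟨fun j => ?_, fun j hj => ?_, by simp⟩
  · by_cases h : j = i
    · subst h; simp
    · simp [h]
  · have : j ≠ i := by rintro rfl; exact hj hi
    simp [this]

theorem single_mem_simplex {N : ℕ} {T : Finset (Fin N)} {i : Fin N} (hi : i ∈ T) :
    (Pi.single i 1 : Fin N → ℝ) ∈
      convexHull ℝ ((fun i : Fin N => (Pi.single i 1 : Fin N → ℝ)) '' (T : Set (Fin N))) :=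
  subset_convexHull ℝ _ ⟨i, hi, rfl⟩

theorem sum_eq_of_mem_nestohedron {N : ℕ} {B : Finset (Finset (Fin N))} {x : Fin N → ℝ}
    (hx : x ∈ nestohedron B) : ∑ j, x j = B.card := by
  obtain ⟨g, hg, rfl⟩ := (Set.mem_finsetSum _ _ _).1 hx
  simp only [Finset.sum_apply]
  rw [Finset.sum_comm, Finset.sum_congr rfl fun T hT => (simplex_bounds (hg hT)).2.2]
  simp

/-- Each simplex of a subset of `S` contributes `1` to the coordinate sum over `S`. -/
theorem card_le_of_mem_nestohedron {N : ℕ} {B : Finset (Finset (Fin N))} {x : Fin N → ℝ}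
    (hx : x ∈ nestohedron B) (S : Finset (Fin N)) :
    ((B.filter (· ⊆ S)).card : ℝ) ≤ ∑ j ∈ S, x j := by
  obtain ⟨g, hg, rfl⟩ := (Set.mem_finsetSum _ _ _).1 hx
  simp only [Finset.sum_apply]
  rw [Finset.sum_comm, Finset.card_filter]
  push_cast
  refine Finset.sum_le_sum fun T hT => ?_
  obtain ⟨h1, h2, h3⟩ := simplex_bounds (hg hT)
  split
  · rename_i hTS
    rw [← h3]
    refine (Finset.sum_subset (Finset.subset_univ S) fun j _ hj => h2 j fun h => hj (hTS h)).ge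
  · exact Finset.sum_nonneg fun j _ => h1 j

/-- A presentation of the nestohedron of `B`: facets given by the subsets `S i`, on which the
coordinate sum takes its least value, and vertices `v k`. The field `root` says that the sets
through a vertex do not cover. -/
structure NestedSystem {κ ι : Type*} {N : ℕ} (s : κ → Finset ι)
    (B : Finset (Finset (Fin N))) where
  /-- the subsets defining the facets -/
  S : ι → Finset (Fin N)
  /-- the vertices -/
  v : κ → Fin N → ℝ
  building : IsBuildingSet B
  univ_mem : Finset.univ ∈ B
  mem : ∀ k, v k ∈ nestohedron B
  eq_iff : ∀ k i, ∑ j ∈ S i, v k j = (B.filter (· ⊆ S i)).card ↔ i ∈ s k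
  inj : ∀ k (y : Fin N → ℝ), ∑ j, y j = 0 → (∀ i ∈ s k, ∑ j ∈ S i, y j = 0) → y = 0
  root : ∀ k, ∃ r, ∀ i ∈ s k, r ∉ S i

namespace NestedSystem

variable {κ ι : Type*} {N : ℕ} {s : κ → Finset ι} {B : Finset (Finset (Fin N))}

/-- The facet presentation of a nestohedron. -/
noncomputable def facetSystem (h : NestedSystem s B) : FacetSystem s (nestohedron B) where
  l i := -∑ j ∈ h.S i, ContinuousLinearMap.proj j
  b i := -((B.filter (· ⊆ h.S i)).card : ℝ)
  v := h.v
  convex := by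
    unfold nestohedron
    exact convex_sum _ fun _ _ => convex_convexHull ℝ _
  mem := h.mem
  le x hx i := by
    have := card_le_of_mem_nestohedron hx (h.S i)
    simpa [_root_.sum_apply] using this
  eq_iff k i := by
    rw [← h.eq_iff k i]
    simp [_root_.sum_apply]
  inj k y hy hi := by
    refine h.inj k y ?_ fun i his => by simpa [_root_.sum_apply] using hi i his
    have := map_mem_vectorSpan (T := {(B.card : ℝ)}) (∑ j, LinearMap.proj j : (Fin N → ℝ) →ₗ[ℝ] ℝ)
      (fun x hx => by simpa using sum_eq_of_mem_nestohedron hx) hy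
    simpa using this

/-- Relabelling facets and vertices. -/
def comap {κ' ι' : Type*} {s' : κ' → Finset ι'} (h : NestedSystem s B) (f : ι' → ι) (g : κ' → κ)
    (hf : Function.Surjective f) (hfg : ∀ k i, i ∈ s' k ↔ f i ∈ s (g k)) : NestedSystem s' B where
  S i := h.S (f i)
  v k := h.v (g k)
  building := h.building
  univ_mem := h.univ_mem
  mem k := h.mem (g k)
  eq_iff k i := by rw [h.eq_iff, hfg]
  inj k y hy hi := h.inj (g k) y hy fun i his => by
    obtain ⟨i, rfl⟩ := hf i
    exact hi i ((hfg k i).2 his)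
  root k := by
    obtain ⟨r, hr⟩ := h.root (g k)
    exact ⟨r, fun i hi => hr (f i) ((hfg k i).1 hi)⟩

end NestedSystem

section Cone

variable {N : ℕ}

/-- The building set obtained by adjoining a new point, with no new connected sets besides the
point and the whole set. Its nestohedron is combinatorially the product of the old one and a
segment. -/
def coneBuildingSet (B : Finset (Finset (Fin N))) : Finset (Finset (Fin (N + 1))) :=
  insert Finset.univ (insert {Fin.last N} (B.image fun T => T.map Fin.castSuccEmb))

theorem last_notMem_map (T : Finset (Fin N)) : Fin.last N ∉ T.map Fin.castSuccEmb := by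
  simp only [Finset.mem_map, Fin.coe_castSuccEmb, not_exists, not_and]
  exact fun x _ => (Fin.castSucc_lt_last x).ne

theorem map_castSucc_injective :
    Function.Injective fun T : Finset (Fin N) => T.map Fin.castSuccEmb :=
  Finset.map_injective _

theorem univ_ne_map (T : Finset (Fin N)) : Finset.univ ≠ T.map Fin.castSuccEmb := fun e =>
  last_notMem_map T (e ▸ Finset.mem_univ _)

theorem singleton_last_ne_map (T : Finset (Fin N)) : {Fin.last N} ≠ T.map Fin.castSuccEmb :=
  fun e => last_notMem_map T (e ▸ Finset.mem_singleton_self _)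

theorem mem_coneBuildingSet {B : Finset (Finset (Fin N))} {T : Finset (Fin (N + 1))} :
    T ∈ coneBuildingSet B ↔
      T = Finset.univ ∨ T = {Fin.last N} ∨ ∃ U ∈ B, U.map Fin.castSuccEmb = T := by
  simp [coneBuildingSet]

theorem IsBuildingSet.cone {B : Finset (Finset (Fin N))} (hB : IsBuildingSet B) :
    IsBuildingSet (coneBuildingSet B) where
  nonempty_of_mem T hT := by
    rcases mem_coneBuildingSet.1 hT with rfl | rfl | ⟨U, hU, rfl⟩
    · exact ⟨Fin.last N, Finset.mem_univ _⟩
    · simp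
    · simpa using hB.nonempty_of_mem U hU
  singleton_mem i := by
    rw [mem_coneBuildingSet]
    induction i using Fin.lastCases with
    | last => simp
    | cast i => exact Or.inr (Or.inr ⟨{i}, hB.singleton_mem i, by simp⟩)
  union_mem S hS T hT hST := by
    rw [mem_coneBuildingSet] at *
    rcases hS with rfl | rfl | ⟨U, hU, rfl⟩
    · simp
    · rcases hT with rfl | rfl | ⟨V, hV, rfl⟩
      · simp
      · simp
      · obtain ⟨x, hx⟩ := hST
        rw [Finset.mem_inter, Finset.mem_singleton] at hx
        exact absurd (hx.1 ▸ hx.2) (last_notMem_map V)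
    · rcases hT with rfl | rfl | ⟨V, hV, rfl⟩
      · simp
      · obtain ⟨x, hx⟩ := hST
        rw [Finset.mem_inter, Finset.mem_singleton] at hx
        exact absurd (hx.2 ▸ hx.1) (last_notMem_map U)
      · refine Or.inr (Or.inr ⟨U ∪ V, hB.union_mem U hU V hV ?_, Finset.map_union _ _ ⟩)
        rw [← Finset.map_inter] at hST
        simpa using hST

theorem card_filter_cone_map (B : Finset (Finset (Fin N))) (S : Finset (Fin N)) :
    ((coneBuildingSet B).filter (· ⊆ S.map Fin.castSuccEmb)).card = (B.filter (· ⊆ S)).card := by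
  rw [← Finset.card_image_of_injective (B.filter (· ⊆ S)) map_castSucc_injective]
  congr 1
  ext T
  simp only [Finset.mem_filter, mem_coneBuildingSet, Finset.mem_image]
  constructor
  · rintro ⟨rfl | rfl | ⟨U, hU, rfl⟩, hT⟩
    · exact absurd (hT (Finset.mem_univ _)) (last_notMem_map S)
    · exact absurd (hT (Finset.mem_singleton_self _)) (last_notMem_map S)
    · exact ⟨U, ⟨hU, Finset.map_subset_map.1 hT⟩, rfl⟩
  · rintro ⟨U, ⟨hU, hUS⟩, rfl⟩
    exact ⟨Or.inr (Or.inr ⟨U, hU, rfl⟩), Finset.map_subset_map.2 hUS⟩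

theorem card_filter_cone_last {B : Finset (Finset (Fin N))} (hB : IsBuildingSet B) (hN : 0 < N) :
    ((coneBuildingSet B).filter (· ⊆ {Fin.last N})).card = 1 := by
  rw [Finset.card_eq_one]
  refine ⟨{Fin.last N}, ?_⟩
  ext T
  simp only [Finset.mem_filter, mem_coneBuildingSet, Finset.mem_singleton]
  constructor
  · rintro ⟨rfl | rfl | ⟨U, hU, rfl⟩, hT⟩
    · have : Fin.castSucc ⟨0, hN⟩ = Fin.last N :=
        Finset.mem_singleton.1 (hT (Finset.mem_univ _))
      exact absurd this (Fin.castSucc_lt_last _).ne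
    · rfl
    · obtain ⟨x, hx⟩ := hB.nonempty_of_mem U hU
      have := Finset.mem_singleton.1 (hT (Finset.mem_map_of_mem _ hx))
      exact absurd this (Fin.castSucc_lt_last x).ne
  · rintro rfl
    simp

/-- Extension of a vector by a zero coordinate. -/
def extendZero (N : ℕ) : (Fin N → ℝ) →ₗ[ℝ] (Fin (N + 1) → ℝ) where
  toFun x := Fin.snoc (α := fun _ => ℝ) x 0
  map_add' x y := by
    ext i
    induction i using Fin.lastCases <;> simp
  map_smul' a x := by
    ext i
    induction i using Fin.lastCases <;> simp

@[simp] theorem extendZero_castSucc (x : Fin N → ℝ) (j : Fin N) :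
    extendZero N x j.castSucc = x j := by simp [extendZero]

@[simp] theorem extendZero_last (x : Fin N → ℝ) : extendZero N x (Fin.last N) = 0 := by
  simp [extendZero]

theorem extendZero_single (j : Fin N) :
    extendZero N (Pi.single j 1) = Pi.single j.castSucc 1 := by
  ext i
  induction i using Fin.lastCases with
  | last => simp [(Fin.castSucc_lt_last j).ne']
  | cast i => simp [Pi.single_apply]

theorem mem_nestohedron_cone {B : Finset (Finset (Fin N))} (hN : 0 < N) {x : Fin N → ℝ}
    (hx : x ∈ nestohedron B) (j : Fin (N + 1)) :
    Pi.single j 1 + (Pi.single (Fin.last N) 1 + extendZero N x) ∈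
      nestohedron (coneBuildingSet B) := by
  have h1 : (Finset.univ : Finset (Fin (N + 1))) ∉
      insert {Fin.last N} (B.image fun T => T.map Fin.castSuccEmb) := by
    simp only [Finset.mem_insert, Finset.mem_image, not_or, not_exists, not_and]
    refine ⟨fun e => ?_, fun T _ => (univ_ne_map T).symm⟩
    have : Fin.castSucc ⟨0, hN⟩ = Fin.last N :=
      Finset.mem_singleton.1 (e ▸ Finset.mem_univ _)
    exact absurd this (Fin.castSucc_lt_last _).ne
  have h2 : ({Fin.last N} : Finset (Fin (N + 1))) ∉ B.image fun T => T.map Fin.castSuccEmb := by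
    simp only [Finset.mem_image, not_exists, not_and]
    exact fun T _ => (singleton_last_ne_map T).symm
  rw [nestohedron, coneBuildingSet, Finset.sum_insert h1, Finset.sum_insert h2,
    Finset.sum_image fun _ _ _ _ h => map_castSucc_injective h]
  refine Set.add_mem_add (single_mem_simplex (Finset.mem_univ j))
    (Set.add_mem_add (single_mem_simplex (Finset.mem_singleton_self _)) ?_)
  obtain ⟨g, hg, rfl⟩ := (Set.mem_finsetSum _ _ _).1 hx
  rw [map_sum]
  refine Set.finsetSum_mem_finsetSum _ _ _ fun T hT => ?_
  have := Set.mem_image_of_mem (extendZero N) (hg hT)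
  rw [LinearMap.image_convexHull] at this
  refine convexHull_mono ?_ this
  rintro _ ⟨_, ⟨i, hi, rfl⟩, rfl⟩
  refine ⟨i.castSucc, ?_, (extendZero_single i).symm⟩
  simpa using hi

variable {κ ι : Type*} {s : κ → Finset ι} {B : Finset (Finset (Fin N))}

/-- The vertices of the nestohedron of the cone: the new simplex contributes either the new unit
vector or the one of a root of the old vertex. -/
noncomputable def NestedSystem.cone (h : NestedSystem s B) (hN : 0 < N) :
    NestedSystem (joinFamily s fun b : Bool => {b}) (coneBuildingSet B) where
  S := Sum.elim (fun i => (h.S i).map Fin.castSuccEmb)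
    (fun b => if b then Finset.univ.map Fin.castSuccEmb else {Fin.last N})
  v k := Pi.single (if k.2 then Fin.last N else ((h.root k.1).choose).castSucc) 1 +
    (Pi.single (Fin.last N) 1 + extendZero N (h.v k.1))
  building := h.building.cone
  univ_mem := mem_coneBuildingSet.2 (Or.inl rfl)
  mem k := mem_nestohedron_cone hN (h.mem k.1) _
  eq_iff := by
    rintro ⟨k, b⟩ (i | b')
    · have h1 := card_le_of_mem_nestohedron (h.mem k) (h.S i)
      have h2 := h.eq_iff k i
      have h3 := (h.root k).choose_spec i
      change ∑ j ∈ (h.S i).map Fin.castSuccEmb, _ = (((coneBuildingSet B).filter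
        (· ⊆ (h.S i).map Fin.castSuccEmb)).card : ℝ) ↔ _
      simp only [inl_mem_joinFamily, card_filter_cone_map, Finset.sum_map,
        Fin.coe_castSuccEmb, Pi.add_apply, extendZero_castSucc, Finset.sum_add_distrib]
      set r := (h.root k).choose
      have e1 : ∑ j ∈ h.S i, (Pi.single (Fin.last N) 1 : Fin (N + 1) → ℝ) j.castSucc = 0 :=
        Finset.sum_eq_zero fun j _ => by simp [(Fin.castSucc_lt_last j).ne]
      rw [e1]
      cases b with
      | true => simpa [e1] using h2
      | false =>
        have e2 : ∑ j ∈ h.S i, (Pi.single r.castSucc 1 : Fin (N + 1) → ℝ) j.castSucc =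
            if r ∈ h.S i then 1 else 0 := by
          simp [Pi.single_apply]
        simp only [Bool.false_eq_true, if_false, e2]
        by_cases hi : i ∈ s k
        · simp [h3 hi, hi, h2.2 hi]
        · have h4 : ((B.filter (· ⊆ h.S i)).card : ℝ) < ∑ j ∈ h.S i, h.v k j :=
            lt_of_le_of_ne h1 fun e => hi (h2.1 e.symm)
          simp only [hi, iff_false]
          split <;> intro e <;> linarith
    · have hsum := sum_eq_of_mem_nestohedron (h.mem k)
      have e0 : (B.filter (· ⊆ (Finset.univ : Finset (Fin N)))).card = B.card := by simp
      cases b' with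
      | true =>
        simp only [Sum.elim_inr, if_true, inr_mem_joinFamily, card_filter_cone_map, e0,
          Finset.sum_map, Fin.coe_castSuccEmb, Pi.add_apply, extendZero_castSucc,
          Finset.sum_add_distrib, hsum, Finset.mem_singleton]
        have e1 : ∑ j : Fin N, (Pi.single (Fin.last N) 1 : Fin (N + 1) → ℝ) j.castSucc = 0 :=
          Finset.sum_eq_zero fun j _ => by simp [(Fin.castSucc_lt_last j).ne]
        cases b with
        | true => simp
        | false => simp [Pi.single_apply]
      | false =>
        simp only [Sum.elim_inr, Bool.false_eq_true, if_false, inr_mem_joinFamily,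
          card_filter_cone_last h.building hN, Finset.sum_singleton, Pi.add_apply, extendZero_last,
          Finset.mem_singleton]
        cases b with
        | true => norm_num
        | false => simp [(Fin.castSucc_lt_last _).ne']
  inj := by
    rintro ⟨k, b⟩ y hy hi
    rw [Fin.sum_univ_castSucc] at hy
    have hlast : y (Fin.last N) = 0 := by
      have := hi (Sum.inr b) (by simp)
      cases b with
      | true =>
        simp at this
        linarith
      | false => simpa using this
    have h0 := h.inj k (fun j => y j.castSucc) (by rw [hlast] at hy; simpa using hy) fun i his => by
      have := hi (Sum.inl i) (by simpa using his)
      simpa using this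
    ext j
    induction j using Fin.lastCases with
    | last => exact hlast
    | cast j => exact congr_fun h0 j
  root := by
    rintro ⟨k, b⟩
    cases b with
    | true =>
      refine ⟨Fin.last N, ?_⟩
      rintro (i | b') hi
      · exact last_notMem_map _
      · obtain rfl : b' = true := by simpa using hi
        exact last_notMem_map _
    | false =>
      refine ⟨(h.root k).choose.castSucc, ?_⟩
      rintro (i | b') hi
      · have := (h.root k).choose_spec i (by simpa using hi)
        simpa using this
      · obtain rfl : b' = false := by simpa using hi
        simp

/-- Products with cubes are nestohedra along with the other factor. -/
theorem NestedSystem.exists_cube_join (h : NestedSystem s B) (hN : 0 < N) (n : ℕ) :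
    ∃ B' : Finset (Finset (Fin (N + n))),
      Nonempty (NestedSystem (joinFamily (cubeFamily (Fin n)) s) B') := by
  induction n with
  | zero =>
    refine ⟨B, ⟨h.comap (Sum.elim (fun x => x.1.elim0) id) Prod.snd (fun i => ⟨Sum.inr i, rfl⟩) ?_⟩⟩
    rintro k (i | i)
    · exact i.1.elim0
    · simp
  | succ n ih =>
    obtain ⟨B', ⟨h'⟩⟩ := ih
    refine ⟨coneBuildingSet B', ⟨(h'.cone (by omega)).comap
      (Sum.elim (fun x => Fin.cases (Sum.inr x.2) (fun a => Sum.inl (Sum.inl (a, x.2))) x.1)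
        fun i => Sum.inl (Sum.inr i)) (fun k => ((Fin.tail k.1, k.2), k.1 0)) ?_ ?_⟩⟩
    · rintro ((⟨a, b⟩ | i) | b)
      · exact ⟨Sum.inl (a.succ, b), by simp⟩
      · exact ⟨Sum.inr i, rfl⟩
      · exact ⟨Sum.inl (0, b), rfl⟩
    · rintro ⟨ε, k⟩ (⟨a, b⟩ | i)
      · induction a using Fin.cases with
        | zero => simp [eq_comm]
        | succ a => simp [Fin.tail]
      · simp

end Cone

/-- The vertex of a nestohedron obtained by taking from each simplex the unit vector of the first
of its elements in the order `o k`. -/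
noncomputable def NestedSystem.ofOrders {κ ι : Type*} {N : ℕ} [NeZero N] {s : κ → Finset ι}
    {B : Finset (Finset (Fin N))} (S : ι → Finset (Fin N)) (o : κ → List (Fin N))
    (hB : (∀ T ∈ B, T.Nonempty) ∧ (∀ i : Fin N, {i} ∈ B) ∧
      ∀ S ∈ B, ∀ T ∈ B, (S ∩ T).Nonempty → S ∪ T ∈ B)
    (huniv : Finset.univ ∈ B)
    (ho : ∀ k, ∀ T ∈ B, ((o k).find? (· ∈ T)).getD 0 ∈ T)
    (heq : ∀ k i, (B.filter fun T => ((o k).find? (· ∈ T)).getD 0 ∈ S i).card =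
      (B.filter (· ⊆ S i)).card ↔ i ∈ s k)
    (hinj : ∀ k (y : Fin N → ℝ), ∑ j, y j = 0 → (∀ i ∈ s k, ∑ j ∈ S i, y j = 0) → y = 0)
    (hroot : ∀ k, ∃ r, ∀ i ∈ s k, r ∉ S i) : NestedSystem s B where
  S := S
  v k := ∑ T ∈ B, Pi.single (((o k).find? (· ∈ T)).getD 0) 1
  building := ⟨hB.1, hB.2.1, hB.2.2⟩
  univ_mem := huniv
  mem k := Set.finsetSum_mem_finsetSum _ _ _ fun T hT => single_mem_simplex (ho k T hT)
  eq_iff k i := by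
    rw [← heq k i]
    have : ∑ j ∈ S i, (∑ T ∈ B, Pi.single (((o k).find? (· ∈ T)).getD 0) 1 : Fin N → ℝ) j =
        ((B.filter fun T => ((o k).find? (· ∈ T)).getD 0 ∈ S i).card : ℝ) := by
      simp only [Finset.sum_apply]
      rw [Finset.sum_comm, Finset.card_filter]
      push_cast
      refine Finset.sum_congr rfl fun T _ => ?_
      simp [Pi.single_apply]
    rw [this]
    norm_cast
  inj := hinj
  root := hroot

/-- The incidences of a single point. -/
def pointFamily (_ : Unit) : Finset Empty := ∅

theorem isClosedFamily_point : IsClosedFamily pointFamily :=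
  ⟨⟨()⟩, fun _ i => i.elim, fun i => i.elim⟩

theorem isFlagFamily_point : IsFlagFamily pointFamily := fun _ _ => ⟨(), fun i => i.elim⟩

/-- A point as a nestohedron. -/
noncomputable def pointNested : NestedSystem pointFamily ({{0}} : Finset (Finset (Fin 1))) :=
  .ofOrders (fun i => i.elim) (fun _ => []) (by decide) (by decide) (by decide)
    (fun _ i => i.elim)
    (fun _ y hy _ => by
      ext j
      rw [Fin.sum_univ_one] at hy
      rw [Subsingleton.elim j 0]
      exact hy)
    fun _ => ⟨0, fun i => i.elim⟩

/-- The pentagon as the two-dimensional associahedron. -/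
noncomputable def pentagonNested : NestedSystem (polygonFamily 5)
    ({{0}, {1}, {2}, {0, 1}, {1, 2}, {0, 1, 2}} : Finset (Finset (Fin 3))) :=
  .ofOrders ![{0}, {0, 1}, {1}, {1, 2}, {2}]
    ![[2, 1, 0], [2, 0, 1], [0, 2, 1], [0, 1, 2], [1, 0, 2]]
    (by decide) (by decide) (by decide +kernel) (by decide +kernel)
    (by
      intro k y h0 h
      ext j
      rw [Fin.sum_univ_three] at h0
      fin_cases k <;> simp [polygonFamily] at h <;> fin_cases j <;> simp <;> linarith)
    (by decide +kernel)

/-- The hexagon as the two-dimensional permutohedron. -/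
noncomputable def hexagonNested : NestedSystem (polygonFamily 6)
    ({{0}, {1}, {2}, {0, 1}, {1, 2}, {0, 2}, {0, 1, 2}} : Finset (Finset (Fin 3))) :=
  .ofOrders ![{0}, {0, 1}, {1}, {1, 2}, {2}, {0, 2}]
    ![[2, 1, 0], [2, 0, 1], [0, 2, 1], [0, 1, 2], [1, 0, 2], [1, 2, 0]]
    (by decide) (by decide) (by decide +kernel) (by decide +kernel)
    (by
      intro k y h0 h
      ext j
      rw [Fin.sum_univ_three] at h0
      fin_cases k <;> simp [polygonFamily] at h <;> fin_cases j <;> simp <;> linarith)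
    (by decide +kernel)

/-- The cube with two adjacent edges cut off as a nestohedron: the sets `{0}`, `{1}`, `{2}`, `{3}`,
`{0, 1}`, `{0, 1, 2}` give the facets of a cube, and the sets `{0, 1, 3}` and `{0, 3}` cut off
its edges in the facet of `{3}` that are given by `{0, 1}` and `{0}`. -/
noncomputable def cutCubeNested : NestedSystem cutCubeFamily
    ({{0}, {1}, {2}, {3}, {0, 1}, {0, 3}, {0, 1, 2}, {0, 1, 3}, {0, 1, 2, 3}} :
      Finset (Finset (Fin 4))) :=
  .ofOrders ![{3}, {0, 1}, {0, 3}, {0, 1, 2}, {0}, {1}, {2}, {0, 1, 3}]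
    ![[1, 0, 2, 3], [2, 1, 0, 3], [0, 1, 2, 3], [2, 0, 1, 3], [3, 2, 1, 0], [3, 2, 0, 1],
      [2, 3, 1, 0], [2, 3, 0, 1], [1, 3, 2, 0], [2, 1, 3, 0], [3, 1, 0, 2], [3, 0, 1, 2]]
    (by decide +kernel) (by decide) (by decide +kernel) (by decide +kernel)
    (by
      intro k y h0 h
      ext j
      rw [Fin.sum_univ_four] at h0
      fin_cases k <;> simp [cutCubeFamily] at h <;> fin_cases j <;> simp <;> linarith)
    (by decide +kernel)

/-! ### The flag polytopes of the classification -/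

/-- `L` is a `d`-dimensional flag simple polytope with incidences `s`, and there is a building set
on `d + 1` elements whose nestohedron has the same incidences. -/
structure IsFlagModel {κ ι E : Type*} [NormedAddCommGroup E] [NormedSpace ℝ E]
    (s : κ → Finset ι) (L : Set E) (d : ℕ) : Prop where
  closed : IsClosedFamily s
  flag : IsFlagFamily s
  card : ∀ k, (s k).card = d
  finrank : Module.finrank ℝ E = d
  system : Nonempty (FacetSystem s L)
  nested : ∃ N, N = d + 1 ∧ ∃ B : Finset (Finset (Fin N)), Nonempty (NestedSystem s B)

namespace IsFlagModel

variable {κ ι E : Type*} [NormedAddCommGroup E] [NormedSpace ℝ E] [Finite κ]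
  {s : κ → Finset ι} {L : Set E} {d : ℕ}

theorem exists_isNerveComplexOf [FiniteDimensional ℝ E] [Finite ι] (h : IsFlagModel s L d)
    (hd : 1 ≤ d) {V : Type*} {K : PreAbstractSimplicialComplex V}
    (hK : ComplexIso K (generatedBy (Set.range s))) :
    IsPolytopalSphere K ∧ ∃ (d : ℕ) (P : Set (Fin d → ℝ)), IsNerveComplexOf K P ∧ CombEquiv P L := by
  obtain ⟨k⟩ := h.closed.nonempty
  obtain ⟨F⟩ := h.system
  have hk := h.card k
  obtain ⟨i, -⟩ : (s k).Nonempty := Finset.card_pos.1 (by omega)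
  have : Nonempty ι := ⟨i⟩
  obtain ⟨h1, P, h2⟩ := F.exists_isNerveComplexOf h.closed h.finrank ⟨k, hk⟩ hK
  exact ⟨h1, d, P, h2⟩

theorem isFlag (h : IsFlagModel s L d) {V : Type*} {K : PreAbstractSimplicialComplex V} {d' : ℕ}
    {P : Set (Fin d' → ℝ)} (hP : IsNerveComplexOf K P) (hPL : CombEquiv P L) : IsFlag K := by
  obtain ⟨F⟩ := h.system
  obtain ⟨-, -, Q, hQ, -, hKQ, hPQ⟩ := hP
  exact isFlag_of_combDual h.closed h.flag F hQ.1 hKQ hPQ hPL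

theorem isFlagNestohedron [Finite ι] (h : IsFlagModel s L d) {V : Type*}
    {K : PreAbstractSimplicialComplex V} {d' : ℕ} {P : Set (Fin d' → ℝ)}
    (hP : IsNerveComplexOf K P) (hPL : CombEquiv P L) : IsFlagNestohedron P := by
  obtain ⟨F⟩ := h.system
  obtain ⟨N, rfl, B, ⟨G⟩⟩ := h.nested
  obtain ⟨k, hk⟩ := F.exists_card_eq h.closed hP.1 hPL
  obtain rfl : d = d' := by rw [← h.card k, hk, hP.2.1]
  refine ⟨B, G.building, ?_, G.facetSystem.isFlagPolytope h.closed h.flag, ?_⟩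
  · rw [G.facetSystem.polytopeDim_eq h.closed k, h.card]
  · obtain ⟨e1⟩ := hPL
    obtain ⟨e2⟩ := F.combEquiv h.closed G.facetSystem
    exact ⟨e1.trans e2⟩

theorem cube_prod {κ₀ ι₀ E₀ : Type*} [NormedAddCommGroup E₀] [NormedSpace ℝ E₀]
    [FiniteDimensional ℝ E₀] {s₀ : κ₀ → Finset ι₀} {L₀ : Set E₀} {d₀ : ℕ}
    (h : IsFlagModel s₀ L₀ d₀) (n : ℕ) :
    IsFlagModel (joinFamily (cubeFamily (Fin n)) s₀) (cube n ×ˢ L₀) (n + d₀) where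
  closed := isClosedFamily_cube.join h.closed
  flag := isFlagFamily_cube.join h.flag
  card k := by rw [card_joinFamily, card_cubeFamily, h.card, Fintype.card_fin]
  finrank := by rw [Module.finrank_prod, h.finrank, Module.finrank_fin_fun]
  system := by
    obtain ⟨F⟩ := h.system
    exact ⟨(cubeSystem n).prod F⟩
  nested := by
    obtain ⟨N, rfl, B, ⟨G⟩⟩ := h.nested
    exact ⟨_, by omega, G.exists_cube_join (by omega) n⟩

theorem cube (n : ℕ) :
    IsFlagModel (joinFamily (cubeFamily (Fin n)) pointFamily) (cube n) n where
  closed := isClosedFamily_cube.join isClosedFamily_point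
  flag := isFlagFamily_cube.join isFlagFamily_point
  card k := by
    rw [card_joinFamily, card_cubeFamily, Fintype.card_fin]
    simp [pointFamily]
  finrank := Module.finrank_fin_fun ℝ
  system := ⟨{
    l := Sum.elim (cubeSystem n).l Empty.elim
    b := Sum.elim (cubeSystem n).b Empty.elim
    v := fun k => (cubeSystem n).v k.1
    convex := (cubeSystem n).convex
    mem := fun k => (cubeSystem n).mem k.1
    le := by
      rintro x hx (i | i)
      · exact (cubeSystem n).le x hx i
      · exact i.elim
    eq_iff := by
      rintro k (i | i)
      · rw [inl_mem_joinFamily]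
        exact (cubeSystem n).eq_iff k.1 i
      · exact i.elim
    inj := fun k y hy h => (cubeSystem n).inj k.1 y hy fun i hi =>
      h (Sum.inl i) (inl_mem_joinFamily.2 hi) }⟩
  nested := ⟨_, by omega, pointNested.exists_cube_join Nat.one_pos n⟩

theorem pentagon : IsFlagModel (polygonFamily 5) (polygon 5) 2 where
  closed := isClosedFamily_five
  flag := isFlagFamily_five
  card := by decide
  finrank := Module.finrank_fin_fun ℝ
  system := ⟨pentagonSystem⟩
  nested := ⟨3, rfl, _, ⟨pentagonNested⟩⟩

theorem hexagon : IsFlagModel (polygonFamily 6) (polygon 6) 2 where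
  closed := isClosedFamily_six
  flag := isFlagFamily_six
  card := by decide
  finrank := Module.finrank_fin_fun ℝ
  system := ⟨hexagonSystem⟩
  nested := ⟨3, rfl, _, ⟨hexagonNested⟩⟩

theorem cutCube : IsFlagModel cutCubeFamily cubeTwoEdgeCuts 3 where
  closed := isClosedFamily_cutCube
  flag := isFlagFamily_cutCube
  card := by decide
  finrank := Module.finrank_fin_fun ℝ
  system := ⟨cutCubeSystem⟩
  nested := ⟨4, rfl, _, ⟨cutCubeNested⟩⟩

end IsFlagModel

/-! ### Flag complexes and perfect matchings of non-edges -/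

section FlagComplex

variable {V : Type*} {K : PreAbstractSimplicialComplex V}

theorem mem_faces_of_subset {σ τ : Finset V} (hσ : σ ∈ K.faces) (hτ : τ.Nonempty) (h : τ ⊆ σ) :
    τ ∈ K.faces := (K.isRelLowerSet_faces hσ).2 h hτ

variable [DecidableEq V]

/-- In a flag complex, sets of pairwise adjacent vertices are faces. -/
theorem IsFlag.mem_faces (hK : IsFlag K) {σ : Finset V} (hσ : σ.Nonempty)
    (h : ∀ u ∈ σ, ∀ w ∈ σ, {u, w} ∈ K.faces) : σ ∈ K.faces := by
  induction hn : σ.card using Nat.strong_induction_on generalizing σ with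
  | _ n ih =>
    subst hn
    by_contra hσK
    have hcard := hK σ hσ hσK fun τ hτ hτσ =>
      ih _ (Finset.card_lt_card hτσ) hτ
        (fun u hu w hw => h u (hτσ.subset hu) w (hτσ.subset hw)) rfl
    obtain ⟨u, hu⟩ := hσ
    apply hσK
    rcases (σ.erase u).eq_empty_or_nonempty with he | ⟨w, hw⟩
    · have : σ = {u} := by rw [← Finset.insert_erase hu, he]; rfl
      rw [this]
      simpa using h u hu u hu
    · have hw' := Finset.mem_erase.1 hw
      have : {u, w} = σ := by
        refine Finset.eq_of_subset_of_card_le ?_ (hcard.trans_eq (Finset.card_pair hw'.1.symm).symm)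
        intro x hx
        rcases Finset.mem_insert.1 hx with rfl | hx
        · exact hu
        · rw [Finset.mem_singleton.1 hx]; exact hw'.2
      rw [← this]
      exact h u hu w hw'.2

/-- A flag complex is determined by its graph. -/
theorem complexIso_of_isFlag {κ ι : Type*} {s : κ → Finset ι} (hs : IsFlagFamily s)
    (hK : IsFlag K) (ψ : ι → V) (hψ : Function.Injective ψ)
    (hsurj : ∀ v, {v} ∈ K.faces → v ∈ Set.range ψ)
    (hadj : ∀ i j, {ψ i, ψ j} ∈ K.faces ↔ ∃ k, i ∈ s k ∧ j ∈ s k) :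
    ComplexIso K (generatedBy (Set.range s)) := by
  classical
  let g : (generatedBy (Set.range s)).faces → K.faces := fun τ => ⟨τ.1.image ψ, by
    obtain ⟨τ, hτ, -, ⟨k, rfl⟩, hk⟩ := τ
    refine hK.mem_faces (hτ.image ψ) fun u hu w hw => ?_
    obtain ⟨i, hi, rfl⟩ := Finset.mem_image.1 hu
    obtain ⟨j, hj, rfl⟩ := Finset.mem_image.1 hw
    exact (hadj i j).2 ⟨k, hk hi, hk hj⟩⟩
  have hle : ∀ t t', g t ≤ g t' ↔ t ≤ t' := fun t t' => Finset.image_subset_image_iff hψ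
  have hgs : Function.Surjective g := by
    rintro ⟨σ, hσ⟩
    have hne := (K.isRelLowerSet_faces hσ).1
    have h1 : ∀ v ∈ σ, v ∈ Set.range ψ := fun v hv =>
      hsurj v (mem_faces_of_subset hσ (by simp) (by simpa using hv))
    let τ := σ.preimage ψ hψ.injOn
    have hτ : τ.image ψ = σ := by
      rw [Finset.image_preimage, Finset.filter_true_of_mem h1]
    obtain ⟨k, hk⟩ := hs τ fun i hi j hj => by
      rw [Finset.mem_preimage] at hi hj
      refine (hadj i j).1 (mem_faces_of_subset hσ (by simp) ?_)
      intro x hx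
      rcases Finset.mem_insert.1 hx with rfl | hx
      · exact hi
      · rw [Finset.mem_singleton.1 hx]; exact hj
    refine ⟨⟨τ, ?_, s k, ⟨k, rfl⟩, hk⟩, Subtype.ext hτ⟩
    rw [← hτ] at hne
    exact Finset.image_nonempty.1 hne
  have hinj : Function.Injective g := fun a b hab =>
    le_antisymm ((hle a b).1 hab.le) ((hle b a).1 hab.ge)
  let e : (generatedBy (Set.range s)).faces ≃o K.faces :=
    ⟨Equiv.ofBijective g ⟨hinj, hgs⟩, fun {a b} => hle a b⟩
  exact ⟨e.symm⟩

/-- A fixed-point free involution of a finite type has the form `(a, b) ↦ (a, !b)`. -/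
theorem exists_equiv_of_involutive {U : Type*} [Finite U] {g : U → U}
    (hg : Function.Involutive g) (hfix : ∀ u, g u ≠ u) :
    ∃ (n : ℕ) (e : Fin n × Bool ≃ U), ∀ a b, g (e (a, b)) = e (a, !b) := by
  classical
  obtain ⟨N, ⟨ν⟩⟩ := Finite.exists_equiv_fin U
  obtain ⟨n, ⟨α⟩⟩ := Finite.exists_equiv_fin {u // ν u < ν (g u)}
  let f : Fin n × Bool → U := fun x => if x.2 then (α.symm x.1).1 else g (α.symm x.1).1
  have hinj : Function.Injective f := by
    rintro ⟨a, b⟩ ⟨a', b'⟩ h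
    have h1 := (α.symm a).2
    have h2 := (α.symm a').2
    cases b <;> cases b' <;> simp only [f, Bool.false_eq_true, if_false, if_true] at h
    · rw [α.symm.injective (Subtype.ext (hg.injective h))]
    · rw [← h, hg] at h2
      exact absurd h1 h2.asymm
    · rw [h, hg] at h1
      exact absurd h1 h2.asymm
    · rw [α.symm.injective (Subtype.ext h)]
  have hsurj : Function.Surjective f := by
    intro u
    rcases lt_or_gt_of_ne (fun e => hfix u (ν.injective e).symm : ν u ≠ ν (g u)) with h | h
    · exact ⟨(α ⟨u, h⟩, true), by simp [f]⟩
    · exact ⟨(α ⟨g u, by rwa [hg]⟩, false), by simp [f, hg u]⟩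
  refine ⟨n, Equiv.ofBijective f ⟨hinj, hsurj⟩, fun a b => ?_⟩
  change g (f (a, b)) = f (a, !b)
  cases b
  · simp [f, hg _]
  · simp [f]

/-- A flag complex is the join of a flag complex with a cross-polytope as soon as the remaining
vertices are matched by the non-edges. -/
theorem exists_complexIso_join [Finite V] {κ₀ ι₀ : Type*} {s₀ : κ₀ → Finset ι₀}
    (hc : IsClosedFamily s₀) (hs : IsFlagFamily s₀) (hK : IsFlag K) (φ : ι₀ → V)
    (hφ : Function.Injective φ)
    (hadj : ∀ p q, {φ p, φ q} ∈ K.faces ↔ ∃ k, p ∈ s₀ k ∧ q ∈ s₀ k)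
    (hout : ∀ u, {u} ∈ K.faces → u ∉ Set.range φ → (∀ p, {φ p, u} ∈ K.faces) ∧
      ∃ w, {w} ∈ K.faces ∧ w ≠ u ∧ ∀ w', {w'} ∈ K.faces → ({u, w'} ∉ K.faces ↔ w' = w)) :
    ∃ n, ComplexIso K (generatedBy (Set.range (joinFamily (cubeFamily (Fin n)) s₀))) := by
  let U := {u // {u} ∈ K.faces ∧ u ∉ Set.range φ}
  have hex : ∀ u : U, ∃ w : U, w ≠ u ∧
      ∀ w', {w'} ∈ K.faces → ({u.1, w'} ∉ K.faces ↔ w' = w.1) := by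
    rintro ⟨u, hu1, hu2⟩
    obtain ⟨h1, w, hw, hne, hw'⟩ := hout u hu1 hu2
    refine ⟨⟨w, hw, ?_⟩, fun e => hne (congrArg Subtype.val e), hw'⟩
    rintro ⟨p, rfl⟩
    refine (hw' _ hw).2 rfl ?_
    rw [Finset.pair_comm]
    exact h1 p
  choose g hg1 hg2 using hex
  have hinv : Function.Involutive g := by
    intro u
    have h1 : {u.1, (g u).1} ∉ K.faces := (hg2 u _ (g u).2.1).2 rfl
    rw [Finset.pair_comm] at h1
    exact (Subtype.ext ((hg2 (g u) u.1 u.2.1).1 h1)).symm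
  obtain ⟨n, e, he⟩ := exists_equiv_of_involutive hinv hg1
  refine ⟨n, complexIso_of_isFlag (isFlagFamily_cube.join hs) hK
    (Sum.elim (fun x => (e x).1) φ) ?_ ?_ ?_⟩
  · rintro (x | p) (y | q) h
    · rw [e.injective (Subtype.ext h)]
    · exact absurd ⟨q, h.symm⟩ (e x).2.2
    · exact absurd ⟨p, h⟩ (e y).2.2
    · rw [hφ h]
  · intro v hv
    by_cases hvφ : v ∈ Set.range φ
    · obtain ⟨p, rfl⟩ := hvφ
      exact ⟨Sum.inr p, rfl⟩
    · exact ⟨Sum.inl (e.symm ⟨v, hv, hvφ⟩), by simp⟩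
  · obtain ⟨k₀⟩ := hc.nonempty
    have hcross : ∀ (x : Fin n × Bool) (p : ι₀), ∃ k, Sum.inl x ∈
        joinFamily (cubeFamily (Fin n)) s₀ k ∧ Sum.inr p ∈ joinFamily (cubeFamily (Fin n)) s₀ k := by
      intro x p
      obtain ⟨k, hk⟩ := hc.cover p
      exact ⟨(fun _ => x.2, k), by simp, by simpa using hk⟩
    rintro (⟨a, b⟩ | p) (⟨a', b'⟩ | q)
    · have h1 : {(e (a, b)).1, (e (a', b')).1} ∉ K.faces ↔ a' = a ∧ b' = !b := by
        rw [hg2 (e (a, b)) _ (e (a', b')).2.1, he, ← Subtype.ext_iff, e.apply_eq_iff_eq,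
          Prod.mk.injEq]
      rw [← not_iff_not, Sum.elim_inl, Sum.elim_inl, h1]
      constructor
      · rintro ⟨rfl, rfl⟩ ⟨k, h2, h3⟩
        simp only [inl_mem_joinFamily, mem_cubeFamily] at h2 h3
        simp [h2] at h3
      · intro h2
        by_contra h3
        apply h2
        refine ⟨(fun i => if i = a then b else b', k₀), by simp, ?_⟩
        simp only [inl_mem_joinFamily, mem_cubeFamily]
        split
        · rename_i h4
          by_contra h5
          exact h3 ⟨h4, by cases b <;> cases b' <;> simp_all⟩
        · rfl
    · refine iff_of_true ?_ (hcross _ _)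
      rw [Sum.elim_inl, Sum.elim_inr, Finset.pair_comm]
      exact (hout _ (e (a, b)).2.1 (e (a, b)).2.2).1 q
    · refine iff_of_true ((hout _ (e (a', b')).2.1 (e (a', b')).2.2).1 p) ?_
      obtain ⟨k, h1, h2⟩ := hcross (a', b') p
      exact ⟨k, h2, h1⟩
    · rw [Sum.elim_inr, Sum.elim_inr, hadj]
      constructor
      · rintro ⟨k, h1, h2⟩
        exact ⟨(fun _ => true, k), by simpa using h1, by simpa using h2⟩
      · rintro ⟨k, h1, h2⟩
        exact ⟨k.2, by simpa using h1, by simpa using h2⟩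

end FlagComplex

/-! ### Faces of Murai spheres -/

section Faces

variable {m : ℕ} {c : Fin m → ℕ} {M : Multicomplex c}

/-- A set of vertices is a face if and only if some member and some non-member of the multicomplex
avoid it. -/
theorem mem_muraiSphere_iff {σ : Finset (Vertex c)} :
    σ ∈ (muraiSphere M).faces ↔ σ.Nonempty ∧
      (∃ a ∈ M.carrier, ∀ v ∈ σ, (v.2 : ℕ) ≠ a v.1) ∧
      ∃ b, b ≤ c ∧ b ∉ M.carrier ∧ ∀ v ∈ σ, (v.2 : ℕ) ≠ b v.1 := by
  classical
  constructor
  · rintro ⟨hσ, _, ⟨a, ha, v, hv, hb, rfl⟩, hsub⟩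
    have h1 : ∀ w ∈ σ, w ≠ v ∧ (w.2 : ℕ) ≠ a w.1 := fun w hw => by
      simpa [facetF] using hsub hw
    refine ⟨hσ, ⟨a, ha, fun w hw => (h1 w hw).2⟩, Function.update a v.1 v.2, ?_, hb, ?_⟩
    · intro i
      by_cases hi : i = v.1
      · subst hi
        simpa using Nat.lt_succ_iff.1 v.2.2
      · simpa [hi] using M.le_of_mem a ha i
    · rintro ⟨i, j⟩ hw
      obtain ⟨i', j'⟩ := v
      by_cases hi : i = i'
      · subst hi
        simp only [Function.update_self]
        intro hj
        exact (h1 _ hw).1 (by rw [Fin.ext hj])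
      · simpa [hi] using (h1 _ hw).2
  · rintro ⟨hσ, ⟨a, ha, haσ⟩, b, hbc, hb, hbσ⟩
    -- walk from the meet of `a` and `b` to their join, changing one coordinate at a time
    let mix : Finset (Fin m) → Fin m → ℕ := fun S i => if i ∈ S then a i ⊔ b i else a i ⊓ b i
    have hmix : ∀ S i, mix S i = a i ∨ mix S i = b i := by
      intro S i
      simp only [mix]
      split
      · exact max_choice _ _
      · exact min_choice _ _
    have h0 : mix ∅ ∈ M.carrier := M.mem_of_le a ha _ fun i => by simp [mix]
    have h1 : mix Finset.univ ∉ M.carrier := fun h =>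
      hb (M.mem_of_le _ h b fun i => by simp [mix])
    obtain ⟨S, hS, hmax⟩ := (Set.toFinite {S | mix S ∈ M.carrier}).exists_maximal ⟨∅, h0⟩
    obtain ⟨i, hi⟩ : ∃ i, i ∉ S := by
      by_contra! hall
      exact h1 (by rwa [← Finset.eq_univ_iff_forall.2 hall])
    have hins : mix (insert i S) ∉ M.carrier := fun h =>
      hi (hmax h (Finset.subset_insert i S) (Finset.mem_insert_self i S))
    have hupd : mix (insert i S) = Function.update (mix S) i (a i ⊔ b i) := by
      ext j
      by_cases hj : j = i
      · subst hj
        simp [mix]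
      · simp [mix, hj]
    have hle : a i ⊔ b i ≤ c i := max_le (M.le_of_mem a ha i) (hbc i)
    have hav : ∀ x : Fin m → ℕ, (∀ i, x i = a i ∨ x i = b i) → ∀ v ∈ σ, (v.2 : ℕ) ≠ x v.1 := by
      intro x hx v hv
      rcases hx v.1 with h | h <;> rw [h]
      · exact haσ v hv
      · exact hbσ v hv
    refine ⟨hσ, _, ⟨mix S, hS, ⟨i, ⟨a i ⊔ b i, by omega⟩⟩, ?_, by rwa [hupd] at hins, rfl⟩, ?_⟩
    · simp only
      have : mix S i = a i ⊓ b i := by simp [mix, hi]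
      rw [this]
      refine lt_of_le_of_ne (inf_le_sup) fun e => hins ?_
      rw [hupd, ← e, ← this, Function.update_eq_self]
      exact hS
    · intro v hv
      rw [Finset.mem_erase]
      refine ⟨?_, by simpa [facetF] using hav _ (hmix S) v hv⟩
      rintro rfl
      have := hav _ (hmix (insert i S)) _ hv
      simp [mix] at this

theorem pair_mem_muraiSphere_iff {u w : Vertex c} :
    {u, w} ∈ (muraiSphere M).faces ↔
      (∃ a ∈ M.carrier, (u.2 : ℕ) ≠ a u.1 ∧ (w.2 : ℕ) ≠ a w.1) ∧
      ∃ b, b ≤ c ∧ b ∉ M.carrier ∧ (u.2 : ℕ) ≠ b u.1 ∧ (w.2 : ℕ) ≠ b w.1 := by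
  rw [mem_muraiSphere_iff]
  simp

theorem Multicomplex.zero_mem (M : Multicomplex c) : (0 : Fin m → ℕ) ∈ M.carrier := by
  obtain ⟨a, ha⟩ := M.nonempty
  exact M.mem_of_le a ha 0 fun i => Nat.zero_le _

theorem Multicomplex.IsProper.notMem (hM : M.IsProper) : c ∉ M.carrier := fun h =>
  hM (Set.Subset.antisymm (fun a ha => M.le_of_mem a ha) fun a ha => M.mem_of_le c h a ha)

theorem card_filter_lt {b : Fin m → ℕ} (hb : b ≤ c) :
    (Finset.univ.filter fun v : Vertex c => (v.2 : ℕ) < b v.1).card = ∑ i, b i := by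
  have : (Finset.univ.filter fun v : Vertex c => (v.2 : ℕ) < b v.1) =
      Finset.univ.sigma fun i => Finset.univ.filter fun j : Fin (c i + 1) => (j : ℕ) < b i := by
    ext ⟨i, j⟩
    simp
  rw [this, Finset.card_sigma]
  refine Finset.sum_congr rfl fun i _ => ?_
  have : b i ≤ c i := hb i
  rw [Fin.card_filter_val_lt]
  omega

theorem card_filter_gt {a : Fin m → ℕ} (ha : a ≤ c) :
    (Finset.univ.filter fun v : Vertex c => a v.1 < (v.2 : ℕ)).card = ∑ i, (c i - a i) := by
  have : (Finset.univ.filter fun v : Vertex c => a v.1 < (v.2 : ℕ)) =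
      Finset.univ.sigma fun i => Finset.univ.filter fun j : Fin (c i + 1) => a i < (j : ℕ) := by
    ext ⟨i, j⟩
    simp
  rw [this, Finset.card_sigma]
  refine Finset.sum_congr rfl fun i _ => ?_
  have : a i ≤ c i := ha i
  have h1 := Finset.card_filter_add_card_filter_not (s := (Finset.univ : Finset (Fin (c i + 1))))
    (fun j => (j : ℕ) < a i + 1)
  have h2 : (Finset.univ.filter fun j : Fin (c i + 1) => ¬ (j : ℕ) < a i + 1) =
      Finset.univ.filter fun j : Fin (c i + 1) => a i < (j : ℕ) := by
    exact Finset.filter_congr fun j _ => by omega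
  rw [h2, Fin.card_filter_val_lt, Finset.card_univ, Fintype.card_fin] at h1
  omega

/-- The elements `x_i^{(j)}` with `j < b_i` form a minimal non-face if `b` is a minimal non-member,
so in a flag Murai sphere the minimal non-members have degree at most two. -/
theorem exists_notMem_degree_le (hK : IsFlag (muraiSphere M)) {b : Fin m → ℕ} (hbc : b ≤ c)
    (hb : b ∉ M.carrier) : ∃ b' ≤ b, b' ∉ M.carrier ∧ ∑ i, b' i ≤ 2 := by
  obtain ⟨b', hle, hb', hmin⟩ := exists_minimal_le_of_wellFoundedLT (fun b => b ∉ M.carrier) b hb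
  refine ⟨b', hle, hb', ?_⟩
  have hb'c := hle.trans hbc
  rw [← card_filter_lt hb'c]
  refine hK _ ?_ ?_ ?_
  · rw [← Finset.card_pos, card_filter_lt hb'c]
    refine Nat.pos_of_ne_zero fun h0 => hb' ?_
    have : b' = 0 := funext fun i => by simpa using Finset.sum_eq_zero_iff.1 h0 i
    rw [this]
    exact M.zero_mem
  · rw [mem_muraiSphere_iff]
    rintro ⟨-, ⟨a, ha, hav⟩, -⟩
    refine hb' (M.mem_of_le a ha b' fun i => ?_)
    by_contra hlt
    have hac : a i ≤ c i := M.le_of_mem a ha i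
    exact hav ⟨i, ⟨a i, by omega⟩⟩ (by simpa using hlt) rfl
  · intro τ hτ hτσ
    rw [mem_muraiSphere_iff]
    obtain ⟨⟨i, j⟩, hv, hvτ⟩ := Finset.exists_of_ssubset hτσ
    have hj : (j : ℕ) < b' i := by simpa using hv
    refine ⟨hτ, ⟨Function.update b' i j, ?_, ?_⟩, b', hb'c, hb', ?_⟩
    · by_contra hn
      have := hmin hn (update_le_self_iff.2 hj.le) i
      simp at this
      omega
    · rintro ⟨i', j'⟩ hw
      have hw' : (j' : ℕ) < b' i' := by simpa using hτσ.subset hw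
      by_cases hi : i' = i
      · subst hi
        simp only [Function.update_self]
        intro e
        exact hvτ (by rwa [← Fin.ext e])
      · simpa [hi] using hw'.ne
    · rintro ⟨i', j'⟩ hw
      have hw' : (j' : ℕ) < b' i' := by simpa using hτσ.subset hw
      exact hw'.ne

/-- The elements `x_i^{(j)}` with `j > a_i` form a minimal non-face if `a` is a maximal member, so
in a flag Murai sphere the maximal members have codegree at most two. -/
theorem exists_maximal_codegree_le (hK : IsFlag (muraiSphere M)) (hM : M.IsProper)
    {a : Fin m → ℕ} (ha : a ∈ M.carrier) :
    ∃ a', a ≤ a' ∧ Maximal (· ∈ M.carrier) a' ∧ ∑ i, (c i - a' i) ≤ 2 := by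
  have hfin : M.carrier.Finite := (Set.finite_Iic c).subset fun a ha => M.le_of_mem a ha
  obtain ⟨a', hle, ha', hmax⟩ := hfin.exists_le_maximal ha
  refine ⟨a', hle, ⟨ha', hmax⟩, ?_⟩
  have ha'c := M.le_of_mem a' ha'
  rw [← card_filter_gt ha'c]
  refine hK _ ?_ ?_ ?_
  · rw [← Finset.card_pos, card_filter_gt ha'c]
    refine Nat.pos_of_ne_zero fun h0 => hM.notMem ?_
    have : a' = c := funext fun i => by
      have h1 := Finset.sum_eq_zero_iff.1 h0 i (Finset.mem_univ i)
      have h2 : a' i ≤ c i := ha'c i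
      omega
    exact this ▸ ha'
  · rw [mem_muraiSphere_iff]
    rintro ⟨-, -, b, hbc, hb, hbv⟩
    refine hb (M.mem_of_le a' ha' b fun i => ?_)
    by_contra hlt
    have hbi : b i ≤ c i := hbc i
    exact hbv ⟨i, ⟨b i, by omega⟩⟩ (by simpa using hlt) rfl
  · intro τ hτ hτσ
    rw [mem_muraiSphere_iff]
    obtain ⟨⟨i, j⟩, hv, hvτ⟩ := Finset.exists_of_ssubset hτσ
    have hj : a' i < (j : ℕ) := by simpa using hv
    refine ⟨hτ, ⟨a', ha', ?_⟩, Function.update a' i j, ?_, ?_, ?_⟩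
    · rintro ⟨i', j'⟩ hw
      have hw' : a' i' < (j' : ℕ) := by simpa using hτσ.subset hw
      exact hw'.ne'
    · exact update_le_iff.2 ⟨Nat.lt_succ_iff.1 j.2, fun i' _ => ha'c i'⟩
    · intro hn
      have := hmax hn (le_update_self_iff.2 hj.le) i
      simp at this
      omega
    · rintro ⟨i', j'⟩ hw
      have hw' : a' i' < (j' : ℕ) := by simpa using hτσ.subset hw
      by_cases hi : i' = i
      · subst hi
        simp only [Function.update_self]
        intro e
        exact hvτ (by rwa [← Fin.ext e])
      · simpa [hi] using hw'.ne'

/-- The whole row of a variable `x_i` with `c_i ≥ 2` must not be a minimal non-face. -/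
theorem row_condition (hK : IsFlag (muraiSphere M)) {i : Fin m} (hi : 2 ≤ c i) :
    Function.update (0 : Fin m → ℕ) i (c i) ∉ M.carrier ∨ Function.update c i 0 ∈ M.carrier := by
  by_contra! hcon
  obtain ⟨h1, h2⟩ := hcon
  have hcard : (Finset.univ.filter fun v : Vertex c => v.1 = i).card = c i + 1 := by
    have : (Finset.univ.filter fun v : Vertex c => v.1 = i) =
        (Finset.univ : Finset (Fin (c i + 1))).map ⟨fun j => (⟨i, j⟩ : Vertex c),
          fun j j' h => by simpa using h⟩ := by
      ext ⟨i', j⟩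
      simp only [Finset.mem_filter, Finset.mem_univ, true_and, Finset.mem_map]
      constructor
      · rintro rfl
        exact ⟨j, rfl⟩
      · rintro ⟨j, h⟩
        exact (Sigma.mk.inj h).1.symm
    rw [this, Finset.card_map, Finset.card_univ, Fintype.card_fin]
  have := hK (Finset.univ.filter fun v : Vertex c => v.1 = i) ?_ ?_ ?_
  · omega
  · rw [← Finset.card_pos]; omega
  · rw [mem_muraiSphere_iff]
    rintro ⟨-, ⟨a, ha, hav⟩, -⟩
    have : a i ≤ c i := M.le_of_mem a ha i
    exact hav ⟨i, ⟨a i, by omega⟩⟩ (by simp) rfl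
  · intro τ hτ hτσ
    rw [mem_muraiSphere_iff]
    obtain ⟨⟨i', j⟩, hv, hvτ⟩ := Finset.exists_of_ssubset hτσ
    obtain rfl : i' = i := by simpa using hv
    have hj := Nat.lt_succ_iff.1 j.2
    have hne : ∀ x : Fin m → ℕ, x i' = j → ∀ v ∈ τ, (v.2 : ℕ) ≠ x v.1 := by
      rintro x hx ⟨k, l⟩ hw
      obtain rfl : k = i' := by simpa using hτσ.subset hw
      intro e
      rw [hx] at e
      exact hvτ (by rwa [← Fin.ext e])
    refine ⟨hτ, ⟨Function.update (0 : Fin m → ℕ) i' j, ?_, hne _ (by simp)⟩, Function.update c i' j, ?_, ?_,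
      hne _ (by simp)⟩
    · exact M.mem_of_le _ h1 _ (update_le_update_iff.2 ⟨hj, fun _ _ => le_rfl⟩)
    · exact update_le_self_iff.2 hj
    · exact fun h => h2 (M.mem_of_le _ h _
        (update_le_update_iff.2 ⟨Nat.zero_le _, fun _ _ => le_rfl⟩))

end Faces

/-! ### Reduction to finitely many variables -/

section Core

variable {r : ℕ}

/-- Adjacency of `u` and `w` in the Murai sphere of the set of `c₀`-monomials satisfying `m₀`. -/
abbrev CoreAdj (c₀ : Fin r → ℕ) (m₀ : (Fin r → ℕ) → Prop) (u w : Vertex c₀) : Prop :=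
  (∃ a : ∀ i, Fin (c₀ i + 1), a u.1 ≠ u.2 ∧ a w.1 ≠ w.2 ∧ m₀ fun i => a i) ∧
    ∃ b : ∀ i, Fin (c₀ i + 1), b u.1 ≠ u.2 ∧ b w.1 ≠ w.2 ∧ ¬ m₀ fun i => b i

/-- A finite certificate: `φ` embeds the complex of `s₀` in the Murai sphere of `(c₀, m₀)`, and the
other vertices of the sphere are matched by the non-edges. -/
abbrev CoreCert (c₀ : Fin r → ℕ) (m₀ : (Fin r → ℕ) → Prop) {κ₀ ι₀ : Type} (s₀ : κ₀ → Finset ι₀)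
    (φ : ι₀ → Vertex c₀) : Prop :=
  (∀ p q, φ p = φ q → p = q) ∧ (∀ p q, CoreAdj c₀ m₀ (φ p) (φ q) ↔ ∃ k, p ∈ s₀ k ∧ q ∈ s₀ k) ∧
    ∀ u, CoreAdj c₀ m₀ u u → (∀ p, φ p ≠ u) → (∀ p, CoreAdj c₀ m₀ (φ p) u) ∧
      ∃ w, CoreAdj c₀ m₀ w w ∧ w ≠ u ∧
        ∀ w', CoreAdj c₀ m₀ w' w' → (¬ CoreAdj c₀ m₀ u w' ↔ w' = w)

variable {m : ℕ} {c : Fin m → ℕ} {M : Multicomplex c}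

/-- If membership in a multicomplex depends only on the variables in the range of `ρ`, and the
other variables have `c_i = 1`, then a certificate for the former describes a flag Murai sphere
up to joins with pairs of points. -/
theorem exists_complexIso_of_core (hK : IsFlag (muraiSphere M)) (hM : M.IsProper)
    {c₀ : Fin r → ℕ} {m₀ : (Fin r → ℕ) → Prop} {κ₀ ι₀ : Type} {s₀ : κ₀ → Finset ι₀}
    {φ : ι₀ → Vertex c₀} (hs₀ : IsClosedFamily s₀) (hf₀ : IsFlagFamily s₀)
    (hcert : CoreCert c₀ m₀ s₀ φ) (ρ : Fin r → Fin m) (hρ : Function.Injective ρ)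
    (hc₀ : ∀ i, c (ρ i) = c₀ i) (hfree : ∀ i, (∀ j, ρ j ≠ i) → c i = 1)
    (hmem : ∀ a, a ≤ c → (a ∈ M.carrier ↔ m₀ fun i => a (ρ i))) :
    ∃ n, ComplexIso (muraiSphere M)
      (generatedBy (Set.range (joinFamily (cubeFamily (Fin n)) s₀))) := by
  classical
  obtain ⟨hφ, hadj, hout⟩ := hcert
  let ψ : Vertex c₀ → Vertex c := fun u => ⟨ρ u.1, ⟨u.2, by rw [hc₀]; exact u.2.2⟩⟩
  have hψ2 : ∀ u, ((ψ u).2 : ℕ) = u.2 := fun _ => rfl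
  have hψ : Function.Injective ψ := by
    rintro ⟨i, j⟩ ⟨i', j'⟩ h
    have h1 : ρ i = ρ i' := congrArg Sigma.fst h
    obtain rfl := hρ h1
    have h2 : (j : ℕ) = j' := by
      rw [← hψ2 ⟨i, j⟩, h]
    rw [Fin.ext h2]
  -- restriction to the core and extension from the core
  have hres : ∀ a : Fin m → ℕ, a ≤ c → ∃ a₀ : ∀ i, Fin (c₀ i + 1), ∀ i, (a₀ i : ℕ) = a (ρ i) :=
    fun a ha => ⟨fun i => ⟨a (ρ i), by
      have : a (ρ i) ≤ c (ρ i) := ha (ρ i)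
      rw [hc₀] at this
      omega⟩, fun _ => rfl⟩
  have hext : ∀ (a₀ : ∀ i, Fin (c₀ i + 1)) (f : Fin m → ℕ), f ≤ c → ∃ a, a ≤ c ∧
      (∀ i, a (ρ i) = a₀ i) ∧ ∀ i, (∀ j, ρ j ≠ i) → a i = f i := by
    intro a₀ f hf
    refine ⟨Function.extend ρ (fun i => (a₀ i : ℕ)) f, fun i => ?_, fun i => hρ.extend_apply _ _ i,
      fun i hi => Function.extend_apply' _ _ _ fun ⟨j, hj⟩ => hi j hj⟩
    by_cases hi : ∃ j, ρ j = i
    · obtain ⟨j, rfl⟩ := hi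
      rw [hρ.extend_apply, hc₀]
      exact Nat.lt_succ_iff.1 (a₀ j).2
    · rw [Function.extend_apply' _ _ _ hi]
      exact hf i
  have hmem' : ∀ (a : Fin m → ℕ) (a₀ : ∀ i, Fin (c₀ i + 1)), a ≤ c → (∀ i, a (ρ i) = a₀ i) →
      (a ∈ M.carrier ↔ m₀ fun i => a₀ i) := by
    intro a a₀ ha h
    rw [hmem a ha]
    simp only [h]
  have hcore : ∀ u w, {ψ u, ψ w} ∈ (muraiSphere M).faces ↔ CoreAdj c₀ m₀ u w := by
    intro u w
    rw [pair_mem_muraiSphere_iff]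
    have hne : ∀ (a : Fin m → ℕ) (a₀ : ∀ i, Fin (c₀ i + 1)), (∀ i, a (ρ i) = a₀ i) → ∀ u,
        ((ψ u).2 : ℕ) ≠ a (ψ u).1 ↔ a₀ u.1 ≠ u.2 := by
      intro a a₀ h u
      change (u.2 : ℕ) ≠ a (ρ u.1) ↔ _
      rw [h, not_iff_not, eq_comm, Fin.ext_iff]
    constructor
    · rintro ⟨⟨a, ha, h1, h2⟩, b, hb, hbM, h3, h4⟩
      obtain ⟨a₀, ha₀⟩ := hres a (M.le_of_mem a ha)
      obtain ⟨b₀, hb₀⟩ := hres b hb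
      have e1 := fun u => hne a a₀ (fun i => (ha₀ i).symm) u
      have e2 := fun u => hne b b₀ (fun i => (hb₀ i).symm) u
      exact ⟨⟨a₀, (e1 u).1 h1, (e1 w).1 h2,
          (hmem' a a₀ (M.le_of_mem a ha) fun i => (ha₀ i).symm).1 ha⟩,
        b₀, (e2 u).1 h3, (e2 w).1 h4, fun h => hbM ((hmem' b b₀ hb fun i => (hb₀ i).symm).2 h)⟩
    · rintro ⟨⟨a₀, h1, h2, ha⟩, b₀, h3, h4, hb⟩
      obtain ⟨a, hac, ha₀, -⟩ := hext a₀ 0 fun i => Nat.zero_le _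
      obtain ⟨b, hbc, hb₀, -⟩ := hext b₀ 0 fun i => Nat.zero_le _
      exact ⟨⟨a, (hmem' a a₀ hac ha₀).2 ha, (hne a a₀ ha₀ u).2 h1, (hne a a₀ ha₀ w).2 h2⟩,
        b, hbc, fun h => hb ((hmem' b b₀ hbc hb₀).1 h), (hne b b₀ hb₀ u).2 h3,
        (hne b b₀ hb₀ w).2 h4⟩
  have hsing : ∀ u, {ψ u} ∈ (muraiSphere M).faces ↔ CoreAdj c₀ m₀ u u := fun u => by
    rw [← hcore, Finset.pair_eq_singleton]
  -- a vertex outside the core is adjacent to all vertices of the core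
  have hfreecore : ∀ u, CoreAdj c₀ m₀ u u → ∀ w : Vertex c, (∀ j, ρ j ≠ w.1) →
      {ψ u, w} ∈ (muraiSphere M).faces := by
    rintro u ⟨⟨a₀, h1, -, ha⟩, b₀, h3, -, hb⟩ w hw
    have hcw := hfree w.1 hw
    have hf : (fun i => if i = w.1 then 1 - (w.2 : ℕ) else 0) ≤ c := by
      intro i
      dsimp only
      split
      · rename_i h
        subst h
        omega
      · exact Nat.zero_le _
    obtain ⟨a, hac, ha₀, ha'⟩ := hext a₀ _ hf
    obtain ⟨b, hbc, hb₀, hb'⟩ := hext b₀ _ hf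
    have hw2 := w.2.2
    rw [pair_mem_muraiSphere_iff]
    refine ⟨⟨a, (hmem' a a₀ hac ha₀).2 ha, ?_, ?_⟩, b, hbc, fun h => hb ((hmem' b b₀ hbc hb₀).1 h),
      ?_, ?_⟩
    · change (u.2 : ℕ) ≠ a (ρ u.1)
      rw [ha₀]
      exact fun h => h1 (Fin.ext h.symm)
    · rw [ha' _ hw, if_pos rfl]
      omega
    · change (u.2 : ℕ) ≠ b (ρ u.1)
      rw [hb₀]
      exact fun h => h3 (Fin.ext h.symm)
    · rw [hb' _ hw, if_pos rfl]
      omega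
  have hfreefree : ∀ u w : Vertex c, (∀ j, ρ j ≠ u.1) → (∀ j, ρ j ≠ w.1) →
      ({u, w} ∉ (muraiSphere M).faces ↔ u.1 = w.1 ∧ u ≠ w) := by
    intro u w hu hw
    have hcu := hfree u.1 hu
    have hcw := hfree w.1 hw
    have hu2 := u.2.2
    have hw2 := w.2.2
    constructor
    · intro hn
      by_contra hcon
      apply hn
      have hf : (fun i => if i = u.1 then 1 - (u.2 : ℕ) else if i = w.1 then 1 - (w.2 : ℕ) else 0)
          ≤ c := by
        intro i
        dsimp only
        split
        · rename_i h
          subst h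
          omega
        · split
          · rename_i h
            subst h
            omega
          · exact Nat.zero_le _
      obtain ⟨a₀, ha₀'⟩ := hres 0 fun i => Nat.zero_le _
      obtain ⟨b₀, hb₀'⟩ := hres c le_rfl
      obtain ⟨a, hac, ha₀, ha'⟩ := hext a₀ _ hf
      obtain ⟨b, hbc, hb₀, hb'⟩ := hext b₀ _ hf
      have hw' : ∀ x : Fin m → ℕ, (∀ i, (∀ j, ρ j ≠ i) → x i = if i = u.1 then 1 - (u.2 : ℕ) else
          if i = w.1 then 1 - (w.2 : ℕ) else 0) → (u.2 : ℕ) ≠ x u.1 ∧ (w.2 : ℕ) ≠ x w.1 := by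
        intro x hx
        rw [hx _ hu, hx _ hw, if_pos rfl]
        refine ⟨by omega, ?_⟩
        by_cases h : w.1 = u.1
        · have : u = w := by
            by_contra hne
            exact hcon ⟨h.symm, hne⟩
          rw [if_pos h, this]
          omega
        · rw [if_neg h, if_pos rfl]
          omega
      rw [pair_mem_muraiSphere_iff]
      refine ⟨⟨a, ?_, hw' a ha'⟩, b, hbc, fun h => hM.notMem ?_, hw' b hb'⟩
      · rw [hmem' a a₀ hac ha₀, ← hmem' 0 a₀ (fun i => Nat.zero_le _) fun i => (ha₀' i).symm]
        exact M.zero_mem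
      · rwa [hmem' b b₀ hbc hb₀, ← hmem' c b₀ le_rfl fun i => (hb₀' i).symm] at h
    · rintro ⟨h1, h2⟩ hmemf
      obtain ⟨⟨a, ha, h3, h4⟩, -⟩ := pair_mem_muraiSphere_iff.1 hmemf
      have hac : a u.1 ≤ c u.1 := M.le_of_mem a ha u.1
      obtain ⟨i, j⟩ := u
      obtain ⟨i', j'⟩ := w
      obtain rfl : i = i' := h1
      dsimp only at *
      refine h2 ?_
      rw [Fin.ext (by omega : (j : ℕ) = j')]
  have hφvert : ∀ p, CoreAdj c₀ m₀ (φ p) (φ p) := fun p => by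
    obtain ⟨k, hk⟩ := hs₀.cover p
    exact (hadj p p).2 ⟨k, hk, hk⟩
  refine exists_complexIso_join hs₀ hf₀ hK (fun p => ψ (φ p)) (fun p q h => hφ p q (hψ h))
    (fun p q => by rw [hcore, hadj]) fun u hu huφ => ?_
  by_cases hur : ∃ j, ρ j = u.1
  · obtain ⟨j, hj⟩ := hur
    obtain ⟨u₀, rfl⟩ : ∃ u₀, ψ u₀ = u := by
      obtain ⟨i, x⟩ := u
      dsimp only at hj
      subst hj
      exact ⟨⟨j, ⟨x, by rw [← hc₀]; exact x.2⟩⟩, rfl⟩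
    have hu₀ := (hsing u₀).1 hu
    obtain ⟨h1, w, hw, hne, hw'⟩ := hout u₀ hu₀ fun p hp => huφ ⟨p, by rw [← hp]⟩
    refine ⟨fun p => (hcore _ _).2 (h1 p), ψ w, (hsing w).2 hw, fun h => hne (hψ h),
      fun w' hw'' => ?_⟩
    by_cases hwr : ∃ j, ρ j = w'.1
    · obtain ⟨j', hj'⟩ := hwr
      obtain ⟨w₀, rfl⟩ : ∃ w₀, ψ w₀ = w' := by
        obtain ⟨i, x⟩ := w'
        dsimp only at hj'
        subst hj'
        exact ⟨⟨j', ⟨x, by rw [← hc₀]; exact x.2⟩⟩, rfl⟩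
      rw [hcore, hw' w₀ ((hsing w₀).1 hw''), hψ.eq_iff]
    · push Not at hwr
      refine iff_of_false (not_not.2 (hfreecore u₀ hu₀ w' hwr)) ?_
      rintro rfl
      exact hwr w.1 rfl
  · push Not at hur
    refine ⟨fun p => hfreecore _ (hφvert p) u hur, ⟨u.1, ⟨1 - u.2, ?_⟩⟩, ?_, ?_, ?_⟩
    · have := hfree u.1 hur
      omega
    · by_contra hn
      rw [← Finset.pair_eq_singleton] at hn
      exact ((hfreefree _ _ (by exact hur) (by exact hur)).1 hn).2 rfl
    · obtain ⟨i, x⟩ := u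
      have hx := x.2
      intro h
      have h2 : 1 - (x : ℕ) = x := by
        have := eq_of_heq (Sigma.mk.inj h).2
        exact congrArg Fin.val this
      omega
    · intro w' hw'
      by_cases hwr : ∃ j, ρ j = w'.1
      · obtain ⟨j', hj'⟩ := hwr
        obtain ⟨w₀, rfl⟩ : ∃ w₀, ψ w₀ = w' := by
          obtain ⟨i, x⟩ := w'
          dsimp only at hj'
          subst hj'
          exact ⟨⟨j', ⟨x, by rw [← hc₀]; exact x.2⟩⟩, rfl⟩
        refine iff_of_false (not_not.2 ?_) ?_
        · rw [Finset.pair_comm]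
          exact hfreecore w₀ ((hsing w₀).1 hw') u hur
        · intro h
          exact hur w₀.1 (congrArg Sigma.fst h)
      · push Not at hwr
        rw [hfreefree u w' hur hwr]
        obtain ⟨i, x⟩ := u
        obtain ⟨i', x'⟩ := w'
        have hcu := hfree _ hur
        have hx := x.2
        have hx' := x'.2
        dsimp only at *
        constructor
        · rintro ⟨rfl, hne⟩
          have : (x : ℕ) ≠ x' := fun e => hne (by rw [Fin.ext e])
          congr 1
          exact Fin.ext (by dsimp only; omega)
        · intro h
          obtain rfl : i' = i := congrArg Sigma.fst h
          refine ⟨rfl, fun e => ?_⟩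
          rw [← e] at h
          have := congrArg Fin.val (eq_of_heq (Sigma.mk.inj h).2)
          dsimp only at this
          omega

end Core

/-! ### The flag Murai spheres in few variables -/

section Cores

variable {r : ℕ}

/-- Avoidance of the generators `x_i` for `i ∈ S`, `x_i²` for `i ∈ L`, and `x_i x_j` for
`(i, j) ∈ G`. -/
def AvoidsQuadrics (S L : List (Fin r)) (G : List (Fin r × Fin r)) (a : Fin r → ℕ) : Prop :=
  (∀ i ∈ S, a i = 0) ∧ (∀ i ∈ L, a i ≤ 1) ∧ ∀ e ∈ G, a e.1 = 0 ∨ a e.2 = 0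

instance (S L : List (Fin r)) (G : List (Fin r × Fin r)) : DecidablePred (AvoidsQuadrics S L G) :=
  fun _ => by unfold AvoidsQuadrics; infer_instance

instance {c₀ : Fin r → ℕ} {m₀ : (Fin r → ℕ) → Prop} [DecidablePred m₀] (u w : Vertex c₀) :
    Decidable (CoreAdj c₀ m₀ u w) := by
  unfold CoreAdj
  infer_instance

instance {c₀ : Fin r → ℕ} {m₀ : (Fin r → ℕ) → Prop} [DecidablePred m₀] {κ₀ ι₀ : Type}
    [Fintype κ₀] [Fintype ι₀] [DecidableEq ι₀] {s₀ : κ₀ → Finset ι₀} {φ : ι₀ → Vertex c₀} :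
    Decidable (CoreCert c₀ m₀ s₀ φ) := by
  have : Decidable (∀ p q, CoreAdj c₀ m₀ (φ p) (φ q) ↔ ∃ k, p ∈ s₀ k ∧ q ∈ s₀ k) :=
    Fintype.decidableForallFintype
  have h1 : DecidablePred fun u => CoreAdj c₀ m₀ u u → (∀ p, φ p ≠ u) →
      (∀ p, CoreAdj c₀ m₀ (φ p) u) ∧ ∃ w, CoreAdj c₀ m₀ w w ∧ w ≠ u ∧
        ∀ w', CoreAdj c₀ m₀ w' w' → (¬ CoreAdj c₀ m₀ u w' ↔ w' = w) := fun u => by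
    have : Decidable (∀ p, φ p ≠ u) := Fintype.decidableForallFintype
    have : Decidable (∀ p, CoreAdj c₀ m₀ (φ p) u) := Fintype.decidableForallFintype
    infer_instance
  have : Decidable (∀ p q, φ p = φ q → p = q) := Fintype.decidableForallFintype
  unfold CoreCert
  infer_instance

theorem coreCert_point_iff {c₀ : Fin r → ℕ} {m₀ : (Fin r → ℕ) → Prop} :
    CoreCert c₀ m₀ pointFamily Empty.elim ↔ ∀ u, CoreAdj c₀ m₀ u u →
      ∃ w, CoreAdj c₀ m₀ w w ∧ w ≠ u ∧
        ∀ w', CoreAdj c₀ m₀ w' w' → (¬ CoreAdj c₀ m₀ u w' ↔ w' = w) := by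
  constructor
  · rintro ⟨-, -, h⟩ u hu
    exact (h u hu fun p => p.elim).2
  · exact fun h => ⟨fun p => p.elim, fun p => p.elim, fun u hu _ => ⟨fun p => p.elim, h u hu⟩⟩

/-- The Murai sphere of `c₀` and the generators `(S, L, G)` is, up to joins with pairs of points,
one of the complexes of the classification. -/
def IsFlagCore (c₀ : Fin r → ℕ) (S L : List (Fin r)) (G : List (Fin r × Fin r)) : Prop :=
  CoreCert c₀ (AvoidsQuadrics S L G) pointFamily Empty.elim ∨
  (∃ φ, CoreCert c₀ (AvoidsQuadrics S L G) (polygonFamily 5) φ) ∨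
  (∃ φ, CoreCert c₀ (AvoidsQuadrics S L G) (polygonFamily 6) φ) ∨
  ∃ φ, CoreCert c₀ (AvoidsQuadrics S L G) cutCubeFamily φ

theorem isFlagCore_var_one : IsFlagCore ![1] [0] [] [] :=
  .inl (coreCert_point_iff.2 (by decide +kernel))

theorem isFlagCore_var_two : IsFlagCore ![2] [0] [] [] :=
  .inl (coreCert_point_iff.2 (by decide +kernel))

theorem isFlagCore_sq_two : IsFlagCore ![2] [] [0] [] :=
  .inl (coreCert_point_iff.2 (by decide +kernel))

theorem isFlagCore_sq_three : IsFlagCore ![3] [] [0] [] :=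
  .inl (coreCert_point_iff.2 (by decide +kernel))

theorem isFlagCore_vars : IsFlagCore ![1, 1] [0, 1] [] [] :=
  .inl (coreCert_point_iff.2 (by decide +kernel))

theorem isFlagCore_edge_one_one : IsFlagCore ![1, 1] [] [] [(0, 1)] :=
  .inl (coreCert_point_iff.2 (by decide +kernel))

theorem isFlagCore_sq_var : IsFlagCore ![2, 1] [1] [0] [] :=
  .inl (coreCert_point_iff.2 (by decide +kernel))

theorem isFlagCore_edge_two_one : IsFlagCore ![2, 1] [] [] [(0, 1)] :=
  .inl (coreCert_point_iff.2 (by decide +kernel))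

theorem isFlagCore_sqs : IsFlagCore ![2, 2] [] [0, 1] [] :=
  .inl (coreCert_point_iff.2 (by decide +kernel))

theorem isFlagCore_edge_two_two : IsFlagCore ![2, 2] [] [] [(0, 1)] :=
  .inl (coreCert_point_iff.2 (by decide +kernel))

theorem isFlagCore_loop_edge : IsFlagCore ![2, 1] [] [0] [(0, 1)] :=
  .inr (.inl ⟨![⟨0, 0⟩, ⟨0, 2⟩, ⟨1, 0⟩, ⟨0, 1⟩, ⟨1, 1⟩],
    by decide +kernel⟩)

theorem isFlagCore_var_edge : IsFlagCore ![1, 1, 1] [0] [] [(1, 2)] :=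
  .inr (.inl ⟨![⟨0, 1⟩, ⟨1, 0⟩, ⟨2, 1⟩, ⟨1, 1⟩, ⟨2, 0⟩],
    by decide +kernel⟩)

theorem isFlagCore_path_one : IsFlagCore ![1, 1, 1] [] [] [(0, 1), (0, 2)] :=
  .inr (.inl ⟨![⟨0, 0⟩, ⟨1, 1⟩, ⟨2, 0⟩, ⟨1, 0⟩, ⟨2, 1⟩],
    by decide +kernel⟩)

theorem isFlagCore_sq_edge : IsFlagCore ![2, 1, 1] [] [0] [(1, 2)] :=
  .inr (.inl ⟨![⟨0, 2⟩, ⟨1, 0⟩, ⟨2, 1⟩, ⟨1, 1⟩, ⟨2, 0⟩],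
    by decide +kernel⟩)

theorem isFlagCore_path_two : IsFlagCore ![2, 1, 1] [] [] [(0, 1), (0, 2)] :=
  .inr (.inl ⟨![⟨0, 0⟩, ⟨1, 1⟩, ⟨2, 0⟩, ⟨1, 0⟩, ⟨2, 1⟩],
    by decide +kernel⟩)

theorem isFlagCore_triangle : IsFlagCore ![1, 1, 1] [] [] [(0, 1), (0, 2), (1, 2)] :=
  .inr (.inr (.inl ⟨![⟨0, 0⟩, ⟨1, 1⟩, ⟨2, 0⟩, ⟨0, 1⟩, ⟨1, 0⟩, ⟨2, 1⟩],
    by decide +kernel⟩))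

theorem isFlagCore_two_edges : IsFlagCore ![1, 1, 1, 1] [] [] [(0, 1), (2, 3)] :=
  .inr (.inr (.inr ⟨![⟨0, 1⟩, ⟨2, 1⟩, ⟨1, 1⟩, ⟨3, 1⟩, ⟨0, 0⟩, ⟨1, 0⟩, ⟨2, 0⟩, ⟨3, 0⟩],
    by decide +kernel⟩))

theorem isFlagCore_cycle : IsFlagCore ![1, 1, 1, 1] [] [] [(0, 1), (1, 2), (2, 3), (3, 0)] :=
  .inr (.inr (.inr ⟨![⟨0, 0⟩, ⟨1, 0⟩, ⟨2, 0⟩, ⟨3, 0⟩, ⟨0, 1⟩, ⟨2, 1⟩, ⟨1, 1⟩, ⟨3, 1⟩],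
    by decide +kernel⟩))

theorem isFlagCore_path_four : IsFlagCore ![1, 1, 1, 1] [] [] [(0, 1), (1, 2), (2, 3)] :=
  .inr (.inr (.inr ⟨![⟨1, 0⟩, ⟨1, 1⟩, ⟨2, 1⟩, ⟨2, 0⟩, ⟨0, 0⟩, ⟨0, 1⟩, ⟨3, 1⟩, ⟨3, 0⟩],
    by decide +kernel⟩))

end Cores

/-! ### Classification of the generators -/

theorem eq_of_sum_le_two {m : ℕ} {u : Fin m → ℕ} (hu : ∑ i, u i ≤ 2) :
    (∀ i, u i = 0) ∨ (∃ p, (u p = 1 ∨ u p = 2) ∧ ∀ i, i ≠ p → u i = 0) ∨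
      ∃ p q, p ≠ q ∧ u p = 1 ∧ u q = 1 ∧ ∀ i, i ≠ p → i ≠ q → u i = 0 := by
  by_cases h0 : ∀ i, u i = 0
  · exact .inl h0
  push Not at h0
  obtain ⟨p, hp⟩ := h0
  have h1 := Finset.add_sum_erase Finset.univ u (Finset.mem_univ p)
  by_cases h2 : ∀ i, i ≠ p → u i = 0
  · exact .inr (.inl ⟨p, by omega, h2⟩)
  push Not at h2
  obtain ⟨q, hqp, hq⟩ := h2
  have h3 := Finset.add_sum_erase (Finset.univ.erase p) u (Finset.mem_erase.2 ⟨hqp, Finset.mem_univ q⟩)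
  have h4 : ∑ i ∈ (Finset.univ.erase p).erase q, u i = 0 := by omega
  refine .inr (.inr ⟨p, q, hqp.symm, by omega, by omega, fun i hip hiq => ?_⟩)
  exact Finset.sum_eq_zero_iff.1 h4 i (by simp [hip, hiq])

section Generators

variable {m : ℕ} {c : Fin m → ℕ} {s l : Fin m → Prop} {g : Fin m → Fin m → Prop}

/-- `c - u` is a maximal monomial, of codegree at most two, outside the ideal generated by the
`x_i` with `s i`, the `x_i²` with `l i` and the `x_i x_j` with `g i j`. -/
structure IsCover (c : Fin m → ℕ) (s l : Fin m → Prop) (g : Fin m → Fin m → Prop)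
    (u : Fin m → ℕ) : Prop where
  sum_le : ∑ i, u i ≤ 2
  le : ∀ i, u i ≤ c i
  var : ∀ i, s i → u i = c i
  sq : ∀ i, l i → c i ≤ u i + 1
  edge : ∀ i j, g i j → u i = c i ∨ u j = c j
  maximal : ∀ i, 1 ≤ u i → (s i ∧ u i = c i) ∨ (l i ∧ c i = u i + 1) ∨
    (u i = c i ∧ ∃ j, g i j ∧ u j < c j)

/-- The minimal generators `x_i` (`s i`), `x_i²` (`l i`) and `x_i x_j` (`g i j`) of the complement
of a multicomplex, together with the conditions imposed by flagness of the Murai sphere. -/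
structure IsFlagGenerators (c : Fin m → ℕ) (s l : Fin m → Prop) (g : Fin m → Fin m → Prop) :
    Prop where
  pos : ∀ i, 1 ≤ c i
  symm : ∀ i j, g i j → g j i
  irrefl : ∀ i, ¬ g i i
  not_sq : ∀ i, s i → ¬ l i
  not_edge : ∀ i j, s i → ¬ g i j
  two_le : ∀ i, l i → 2 ≤ c i
  free : ∀ i, 2 ≤ c i → s i ∨ l i ∨ ∃ j, g i j
  nonempty : (∃ i, s i) ∨ (∃ i, l i) ∨ ∃ i j, g i j
  cover : ∃ u, IsCover c s l g u
  cover_lt : ∀ p, ¬ s p → ∃ u, IsCover c s l g u ∧ u p < c p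

/-- Up to renaming the variables, `c` and the generators are those of `(c₀, S, L, G)`, apart from
variables with `c_i = 1` that occur in no generator. -/
def HasCore (c : Fin m → ℕ) (s l : Fin m → Prop) (g : Fin m → Fin m → Prop) {r : ℕ}
    (c₀ : Fin r → ℕ) (S L : List (Fin r)) (G : List (Fin r × Fin r)) : Prop :=
  ∃ ρ : Fin r → Fin m, Function.Injective ρ ∧ (∀ x, c (ρ x) = c₀ x) ∧
    (∀ i, s i ↔ ∃ x ∈ S, ρ x = i) ∧ (∀ i, l i ↔ ∃ x ∈ L, ρ x = i) ∧
    ∀ i j, g i j ↔ ∃ e ∈ G, (ρ e.1 = i ∧ ρ e.2 = j) ∨ (ρ e.1 = j ∧ ρ e.2 = i)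

/-- The generators are those of a flag core. -/
def HasFlagCore (c : Fin m → ℕ) (s l : Fin m → Prop) (g : Fin m → Fin m → Prop) : Prop :=
  ∃ (r : ℕ) (c₀ : Fin r → ℕ) (S L : List (Fin r)) (G : List (Fin r × Fin r)),
    IsFlagCore c₀ S L G ∧ HasCore c s l g c₀ S L G

theorem hasFlagCore_of_one {x : ℕ} {S L : List (Fin 1)} {G : List (Fin 1 × Fin 1)}
    (h : IsFlagCore ![x] S L G) (p : Fin m) (hp : c p = x)
    (hs : ∀ i, s i ↔ ∃ x ∈ S, (![p] : Fin 1 → Fin m) x = i)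
    (hl : ∀ i, l i ↔ ∃ x ∈ L, (![p] : Fin 1 → Fin m) x = i)
    (hg : ∀ i j, g i j ↔ ∃ e ∈ G, ((![p] : Fin 1 → Fin m) e.1 = i ∧ (![p] : Fin 1 → Fin m) e.2 = j)
      ∨ ((![p] : Fin 1 → Fin m) e.1 = j ∧ (![p] : Fin 1 → Fin m) e.2 = i)) :
    HasFlagCore c s l g :=
  ⟨_, _, _, _, _, h, ![p], Function.injective_of_subsingleton _, by simpa using hp, hs, hl, hg⟩

theorem hasFlagCore_of_two {x y : ℕ} {S L : List (Fin 2)} {G : List (Fin 2 × Fin 2)}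
    (h : IsFlagCore ![x, y] S L G) (p q : Fin m) (hpq : p ≠ q) (hp : c p = x) (hq : c q = y)
    (hs : ∀ i, s i ↔ ∃ x ∈ S, ![p, q] x = i) (hl : ∀ i, l i ↔ ∃ x ∈ L, ![p, q] x = i)
    (hg : ∀ i j, g i j ↔ ∃ e ∈ G, (![p, q] e.1 = i ∧ ![p, q] e.2 = j) ∨
      (![p, q] e.1 = j ∧ ![p, q] e.2 = i)) :
    HasFlagCore c s l g :=
  ⟨_, _, _, _, _, h, ![p, q], by
    intro x y
    fin_cases x <;> fin_cases y <;> simp [hpq, hpq.symm], by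
    simp [Fin.forall_fin_succ, hp, hq], hs, hl, hg⟩

theorem hasFlagCore_of_three {x y z : ℕ} {S L : List (Fin 3)} {G : List (Fin 3 × Fin 3)}
    (h : IsFlagCore ![x, y, z] S L G) (p q k : Fin m) (hpq : p ≠ q) (hpk : p ≠ k) (hqk : q ≠ k)
    (hp : c p = x) (hq : c q = y) (hk : c k = z)
    (hs : ∀ i, s i ↔ ∃ x ∈ S, ![p, q, k] x = i) (hl : ∀ i, l i ↔ ∃ x ∈ L, ![p, q, k] x = i)
    (hg : ∀ i j, g i j ↔ ∃ e ∈ G, (![p, q, k] e.1 = i ∧ ![p, q, k] e.2 = j) ∨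
      (![p, q, k] e.1 = j ∧ ![p, q, k] e.2 = i)) :
    HasFlagCore c s l g :=
  ⟨_, _, _, _, _, h, ![p, q, k], by
    intro x y
    fin_cases x <;> fin_cases y <;> simp [hpq, hpq.symm, hpk, hpk.symm, hqk, hqk.symm], by
    simp [Fin.forall_fin_succ, hp, hq, hk], hs, hl, hg⟩

theorem hasFlagCore_of_four {S L : List (Fin 4)} {G : List (Fin 4 × Fin 4)}
    (h : IsFlagCore ![1, 1, 1, 1] S L G) (p q k n : Fin m) (hpq : p ≠ q) (hpk : p ≠ k)
    (hpn : p ≠ n) (hqk : q ≠ k) (hqn : q ≠ n) (hkn : k ≠ n)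
    (hp : c p = 1) (hq : c q = 1) (hk : c k = 1) (hn : c n = 1)
    (hs : ∀ i, s i ↔ ∃ x ∈ S, ![p, q, k, n] x = i) (hl : ∀ i, l i ↔ ∃ x ∈ L, ![p, q, k, n] x = i)
    (hg : ∀ i j, g i j ↔ ∃ e ∈ G, (![p, q, k, n] e.1 = i ∧ ![p, q, k, n] e.2 = j) ∨
      (![p, q, k, n] e.1 = j ∧ ![p, q, k, n] e.2 = i)) :
    HasFlagCore c s l g :=
  ⟨_, _, _, _, _, h, ![p, q, k, n], by
    intro x y
    fin_cases x <;> fin_cases y <;> simp [hpq, hpq.symm, hpk, hpk.symm, hqk, hqk.symm,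
      hpn, hpn.symm, hqn, hqn.symm, hkn, hkn.symm], by
    simp [Fin.forall_fin_succ, hp, hq, hk, hn], hs, hl, hg⟩

namespace IsFlagGenerators

/-- The neighbours of a variable have total weight at most two; if it is equal to two, they
involve all generators. -/
theorem neighbors (h : IsFlagGenerators c s l g) {p k₀ : Fin m} (hk₀ : g p k₀) :
    (∃ k, c k = 1 ∧ ∀ j, g p j ↔ j = k) ∨
      (((∃ k, c k = 2 ∧ ∀ j, g p j ↔ j = k) ∨
        ∃ k k', k ≠ k' ∧ c k = 1 ∧ c k' = 1 ∧ ∀ j, g p j ↔ j = k ∨ j = k') ∧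
      (∀ i, ¬ s i) ∧ (∀ i, l i → g p i) ∧ ∀ i j, g i j → g p i ∨ g p j) := by
  obtain ⟨u, hu, hup⟩ := h.cover_lt p fun hs => h.not_edge p k₀ hs hk₀
  have hnb : ∀ j, g p j → u j = c j := fun j hj => (hu.edge p j hj).resolve_left hup.ne
  have hpos := h.pos
  have hk := hnb k₀ hk₀
  have hk1 := hpos k₀
  have huv := hu.var
  have hus := hu.sq
  have hue := hu.edge
  have hnl := h.two_le
  have hne := h.not_edge
  have hsym := h.symm
  rcases eq_of_sum_le_two hu.sum_le with h0 | ⟨a, ha, h0⟩ | ⟨a, b, hab, ha, hb, h0⟩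
  · have := h0 k₀
    omega
  · have hka : k₀ = a := by
      by_contra hne
      have := h0 k₀ hne
      omega
    subst hka
    have hiff : ∀ j, g p j ↔ j = k₀ := by grind
    rcases ha with ha | ha
    · exact .inl ⟨k₀, by omega, hiff⟩
    · refine .inr ⟨.inl ⟨k₀, by omega, hiff⟩, ?_, ?_, ?_⟩ <;> grind
  · by_cases hga : g p a
    · by_cases hgb : g p b
      · refine .inr ⟨.inr ⟨a, b, hab, ?_, ?_, ?_⟩, ?_, ?_, ?_⟩ <;> grind
      · refine .inl ⟨a, ?_, ?_⟩ <;> grind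
    · refine .inl ⟨b, ?_, ?_⟩ <;> grind

end IsFlagGenerators
end Generators

section Generators

variable {m : ℕ} {c : Fin m → ℕ} {s l : Fin m → Prop} {g : Fin m → Fin m → Prop}

namespace IsFlagGenerators

/-- The case of a maximal monomial `x^c / x_p²`. -/
theorem hasFlagCore_of_sq (h : IsFlagGenerators c s l g) {u : Fin m → ℕ} (hu : IsCover c s l g u)
    {p : Fin m} (hp : u p = 2) (h0 : ∀ i, i ≠ p → u i = 0) : HasFlagCore c s l g := by
  obtain ⟨hpos, hsym, hirr, hns, hne, htwo, -, -, -, -⟩ := id h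
  obtain ⟨-, hle, hvar, hsq, hedge, hmax⟩ := hu
  have hmaxp := hmax p (by omega)
  have hlep := hle p
  have hs : ∀ i, s i → i = p := by grind
  have hl : ∀ i, l i → i = p := by grind
  have hg : ∀ i j, g i j → i = p ∨ j = p := by grind
  by_cases hc3 : c p = 3
  · exact hasFlagCore_of_one isFlagCore_sq_three p hc3 (by simp; grind) (by simp; grind)
      (by simp; grind)
  have hcp : c p = 2 := by grind
  by_cases hsp : s p
  · exact hasFlagCore_of_one isFlagCore_var_two p hcp (by simp; grind) (by simp; grind)
      (by simp; grind)
  obtain ⟨k₀, hk₀⟩ : ∃ k, g p k := by grind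
  rcases h.neighbors hk₀ with ⟨k, hk, hN⟩ | ⟨⟨k, hk, hN⟩ | ⟨k, k', hkk', hk, hk', hN⟩, hx⟩
  · by_cases hlp : l p
    · exact hasFlagCore_of_two isFlagCore_loop_edge p k (by grind) hcp hk (by simp; grind)
        (by simp; grind) (by simp; grind)
    · exact hasFlagCore_of_two isFlagCore_edge_two_one p k (by grind) hcp hk (by simp; grind)
        (by simp; grind) (by simp; grind)
  · exact hasFlagCore_of_two isFlagCore_edge_two_two p k (by grind) hcp hk (by simp; grind)
      (by simp; grind) (by simp; grind)
  · exact hasFlagCore_of_three isFlagCore_path_two p k k' (by grind) (by grind) hkk' hcp hk hk'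
      (by simp; grind) (by simp; grind) (by simp; grind)

/-- The case of a maximal monomial `x^c / x_p`. -/
theorem hasFlagCore_of_single (h : IsFlagGenerators c s l g) {u : Fin m → ℕ}
    (hu : IsCover c s l g u) {p : Fin m} (hp : u p = 1) (h0 : ∀ i, i ≠ p → u i = 0) :
    HasFlagCore c s l g := by
  obtain ⟨hpos, hsym, hirr, hns, hne, htwo, -, -, -, -⟩ := id h
  obtain ⟨-, hle, hvar, hsq, hedge, hmax⟩ := hu
  have hmaxp := hmax p (by omega)
  have hlep := hle p
  have hs : ∀ i, s i → i = p := by grind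
  have hl : ∀ i, l i → i = p := by grind
  have hg : ∀ i j, g i j → i = p ∨ j = p := by grind
  by_cases hc2 : c p = 2
  · exact hasFlagCore_of_one isFlagCore_sq_two p hc2 (by simp; grind) (by simp; grind)
      (by simp; grind)
  have hcp : c p = 1 := by grind
  by_cases hsp : s p
  · exact hasFlagCore_of_one isFlagCore_var_one p hcp (by simp; grind) (by simp; grind)
      (by simp; grind)
  obtain ⟨k₀, hk₀⟩ : ∃ k, g p k := by grind
  rcases h.neighbors hk₀ with ⟨k, hk, hN⟩ | ⟨⟨k, hk, hN⟩ | ⟨k, k', hkk', hk, hk', hN⟩, hx⟩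
  · exact hasFlagCore_of_two isFlagCore_edge_one_one p k (by grind) hcp hk (by simp; grind)
      (by simp; grind) (by simp; grind)
  · exact hasFlagCore_of_two isFlagCore_edge_two_one k p (by grind) hk hcp (by simp; grind)
      (by simp; grind) (by simp; grind)
  · exact hasFlagCore_of_three isFlagCore_path_one p k k' (by grind) (by grind) hkk' hcp hk hk'
      (by simp; grind) (by simp; grind) (by simp; grind)

/-- The case of a maximal monomial `x^c / (x_p x_q)` with `c_p = 2` and `c_q = 1`; maximality in
the direction of `x_p` makes `x_p²` a generator. -/
theorem hasFlagCore_of_two_one (h : IsFlagGenerators c s l g) {u : Fin m → ℕ}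
    (hu : IsCover c s l g u) {p q : Fin m} (hpq : p ≠ q) (hp : u p = 1) (hq : u q = 1)
    (h0 : ∀ i, i ≠ p → i ≠ q → u i = 0) (hcp : c p = 2) (hcq : c q = 1) :
    HasFlagCore c s l g := by
  obtain ⟨hpos, hsym, hirr, hns, hne, htwo, -, -, -, -⟩ := id h
  obtain ⟨-, hle, hvar, hsq, hedge, hmax⟩ := hu
  have hmaxp := hmax p (by omega)
  have hmaxq := hmax q (by omega)
  have hs : ∀ i, s i → i = q := by grind
  have hl : ∀ i, l i ↔ i = p := by grind
  have hg : ∀ i j, g i j → i = q ∨ j = q := by grind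
  by_cases hsq : s q
  · exact hasFlagCore_of_two isFlagCore_sq_var p q hpq hcp hcq (by simp; grind)
      (by simp; grind) (by simp; grind)
  obtain ⟨k₀, hk₀⟩ : ∃ k, g q k := by grind
  rcases h.neighbors hk₀ with ⟨k, hk, hN⟩ | ⟨⟨k, hk, hN⟩ | ⟨k, k', hkk', hk, hk', hN⟩, hx⟩
  · exact hasFlagCore_of_three isFlagCore_sq_edge p q k hpq (by grind) (by grind) hcp hcq hk
      (by simp; grind) (by simp; grind) (by simp; grind)
  · exact hasFlagCore_of_two isFlagCore_loop_edge p q hpq hcp hcq (by simp; grind)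
      (by simp; grind) (by simp; grind)
  · grind

/-- The case of a maximal monomial `x^c / (x_p x_q)` with `c_p = c_q = 1`, where `x_p` is a
generator. -/
theorem hasFlagCore_of_var (h : IsFlagGenerators c s l g) {u : Fin m → ℕ}
    (hu : IsCover c s l g u) {p q : Fin m} (hpq : p ≠ q) (hq : u q = 1)
    (h0 : ∀ i, i ≠ p → i ≠ q → u i = 0) (hcp : c p = 1) (hcq : c q = 1) (hsp : s p) :
    HasFlagCore c s l g := by
  obtain ⟨hpos, hsym, hirr, hns, hne, htwo, -, -, -, -⟩ := id h
  obtain ⟨-, hle, hvar, hsq, hedge, hmax⟩ := hu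
  have hmaxq := hmax q (by omega)
  have hs : ∀ i, s i → i = p ∨ i = q := by grind
  have hl : ∀ i, ¬ l i := by grind
  have hg : ∀ i j, g i j → i = q ∨ j = q := by grind
  by_cases hsq : s q
  · exact hasFlagCore_of_two isFlagCore_vars p q hpq hcp hcq (by simp; grind)
      (by simp; grind) (by simp; grind)
  obtain ⟨k₀, hk₀⟩ : ∃ k, g q k := by grind
  rcases h.neighbors hk₀ with ⟨k, hk, hN⟩ | ⟨-, hx, -⟩
  · exact hasFlagCore_of_three isFlagCore_var_edge p q k hpq (by grind) (by grind) hcp hcq hk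
      (by simp; grind) (by simp; grind) (by simp; grind)
  · exact absurd hsp (hx p)

/-- The case of a maximal monomial `x^c / (x_p x_q)` with `c_p = c_q = 1`, where all generators are
of the form `x_i x_j`: they are the edges of a graph covered by `p` and `q`. -/
theorem hasFlagCore_of_edges (h : IsFlagGenerators c s l g) {u : Fin m → ℕ}
    (hu : IsCover c s l g u) {p q : Fin m} (hpq : p ≠ q) (hp : u p = 1) (hq : u q = 1)
    (h0 : ∀ i, i ≠ p → i ≠ q → u i = 0) (hcp : c p = 1) (hcq : c q = 1) (hsp : ¬ s p)
    (hsq : ¬ s q) : HasFlagCore c s l g := by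
  obtain ⟨hpos, hsym, hirr, hns, hne, htwo, -, -, -, -⟩ := id h
  obtain ⟨-, hle, hvar, hsq', hedge, hmax⟩ := hu
  have hmaxp := hmax p (by omega)
  have hmaxq := hmax q (by omega)
  have hs : ∀ i, ¬ s i := by grind
  have hl : ∀ i, ¬ l i := by grind
  have hg : ∀ i j, g i j → (i = p ∨ i = q) ∨ j = p ∨ j = q := by grind
  obtain ⟨k₀, hk₀, hk₀q⟩ : ∃ k, g p k ∧ k ≠ q := by grind
  obtain ⟨l₀, hl₀, hl₀p⟩ : ∃ k, g q k ∧ k ≠ p := by grind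
  clear hmax hmaxp hmaxq hvar hsq' hedge hle
  rcases h.neighbors hk₀ with ⟨k, hk, hN⟩ | ⟨⟨k, hk, hN⟩ | ⟨k, k', hkk', hk, hk', hN⟩, -, -, hx⟩
  · rcases h.neighbors hl₀ with ⟨n, hn, hN'⟩ | ⟨⟨n, hn, hN'⟩ | ⟨n, n', hnn', hn, hn', hN'⟩, -, -, hx'⟩
    · by_cases hkn : k = n
      · subst hkn
        exact hasFlagCore_of_three isFlagCore_path_one k p q (by grind) (by grind) hpq hk hcp hcq
          (by simp; grind) (by simp; grind) (by simp; grind)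
      · exact hasFlagCore_of_four isFlagCore_two_edges p k q n (by grind) (by grind) (by grind)
          (by grind) hkn (by grind) hcp hk hcq hn (by simp; grind) (by simp; grind) (by simp; grind)
    · grind
    · -- `p` and `q` have a common neighbour: the path `p, k, q, _`
      obtain ⟨x, hx1, hxk, hNx⟩ : ∃ x, c x = 1 ∧ x ≠ k ∧ ∀ j, g q j ↔ j = k ∨ j = x := by
        rcases hx' p k ((hN k).2 rfl) with h1 | h1
        · grind
        · rcases (hN' k).1 h1 with rfl | rfl
          · exact ⟨n', hn', by grind, hN'⟩
          · exact ⟨n, hn, by grind, by grind⟩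
      exact hasFlagCore_of_four isFlagCore_path_four p k q x (by grind) (by grind) (by grind)
          (by grind) (by grind) (by grind) hcp hk hcq hx1 (by simp; grind) (by simp; grind)
          (by simp; grind)
  · -- the neighbours of `q` are among those of `p`
    have hN' : ∀ j, g q j ↔ j = k := by grind
    exact hasFlagCore_of_three isFlagCore_path_two k p q (by grind) (by grind) hpq hk hcp hcq
      (by simp; grind) (by simp; grind) (by simp; grind)
  · by_cases hpq' : g p q
    · obtain ⟨x, hx1, hxq, hNx⟩ : ∃ x, c x = 1 ∧ x ≠ q ∧ ∀ j, g p j ↔ j = q ∨ j = x := by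
        rcases (hN q).1 hpq' with rfl | rfl
        · exact ⟨k', hk', by grind, hN⟩
        · exact ⟨k, hk, by grind, by grind⟩
      obtain ⟨y, hy1, hyp, hNy⟩ : ∃ y, c y = 1 ∧ y ≠ p ∧ ∀ j, g q j ↔ j = p ∨ j = y := by
        have hqp := hsym p q hpq'
        rcases h.neighbors hl₀ with ⟨n, hn, hN'⟩ | ⟨⟨n, hn, hN'⟩ | ⟨n, n', hnn', hn, hn', hN'⟩, -⟩
        · grind
        · grind
        · rcases (hN' p).1 hqp with rfl | rfl
          · exact ⟨n', hn', by grind, hN'⟩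
          · exact ⟨n, hn, by grind, by grind⟩
      by_cases hxy : x = y
      · subst hxy
        exact hasFlagCore_of_three isFlagCore_triangle p q x hpq (by grind) (by grind) hcp hcq hx1
          (by simp; grind) (by simp; grind) (by simp; grind)
      · exact hasFlagCore_of_four isFlagCore_path_four x p q y (by grind) (by grind) (by grind)
          (by grind) (by grind) (by grind) hx1 hcp hcq hy1 (by simp; grind) (by simp; grind)
          (by simp; grind)
    · by_cases hqk : g q k
      · by_cases hqk' : g q k'
        · exact hasFlagCore_of_four isFlagCore_cycle p k q k' (by grind) (by grind) (by grind)
            (by grind) hkk' (by grind) hcp hk hcq hk' (by simp; grind) (by simp; grind)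
            (by simp; grind)
        · exact hasFlagCore_of_four isFlagCore_path_four q k p k' (by grind) (by grind) (by grind)
            (by grind) hkk' (by grind) hcq hk hcp hk' (by simp; grind) (by simp; grind)
            (by simp; grind)
      · exact hasFlagCore_of_four isFlagCore_path_four q k' p k (by grind) (by grind) (by grind)
            (by grind) hkk'.symm (by grind) hcq hk' hcp hk (by simp; grind) (by simp; grind)
            (by simp; grind)

/-- Up to renaming, only nineteen sets of generators are possible. -/
theorem hasFlagCore (h : IsFlagGenerators c s l g) : HasFlagCore c s l g := by
  obtain ⟨u, hu⟩ := h.cover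
  rcases eq_of_sum_le_two hu.sum_le with h0 | ⟨p, hp | hp, h0⟩ | ⟨p, q, hpq, hp, hq, h0⟩
  · obtain ⟨hpos, -, -, -, -, htwo, -, hne, -, -⟩ := h
    obtain ⟨-, -, hvar, hsq, hedge, -⟩ := hu
    grind
  · exact h.hasFlagCore_of_single hu hp h0
  · exact h.hasFlagCore_of_sq hu hp h0
  · obtain ⟨hpos, hsym, hirr, hns, hne, htwo, -, -, -, -⟩ := id h
    obtain ⟨-, hle, hvar, hsq, hedge, hmax⟩ := id hu
    have hmaxp := hmax p (by omega)
    have hmaxq := hmax q (by omega)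
    have hcp : c p = 1 ∨ c p = 2 := by grind
    have hcq : c q = 1 ∨ c q = 2 := by grind
    rcases hcp with hcp | hcp <;> rcases hcq with hcq | hcq
    · by_cases hsp : s p
      · exact h.hasFlagCore_of_var hu hpq hq h0 hcp hcq hsp
      by_cases hsq : s q
      · exact h.hasFlagCore_of_var hu hpq.symm hp (fun i h1 h2 => h0 i h2 h1) hcq hcp hsq
      exact h.hasFlagCore_of_edges hu hpq hp hq h0 hcp hcq hsp hsq
    · exact h.hasFlagCore_of_two_one hu hpq.symm hq hp (fun i h1 h2 => h0 i h2 h1) hcq hcp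
    · exact h.hasFlagCore_of_two_one hu hpq hp hq h0 hcp hcq
    · have hl : ∀ i, l i ↔ i = p ∨ i = q := by grind
      have hs : ∀ i, ¬ s i := by grind
      have hg : ∀ i j, ¬ g i j := by grind
      exact hasFlagCore_of_two isFlagCore_sqs p q hpq hcp hcq (by simp; grind)
        (by simp; grind) (by simp; grind)

end IsFlagGenerators
end Generators

/-! ### Flag Murai spheres -/

section Flag

variable {m : ℕ} {c : Fin m → ℕ}

/-- `x_i` is a generator of the complement of `M`. -/
def IsVarGenerator (M : Multicomplex c) (i : Fin m) : Prop := Pi.single i 1 ∉ M.carrier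

/-- `x_i²` is a minimal generator of the complement of `M` in the set of `c`-monomials. -/
def IsSqGenerator (M : Multicomplex c) (i : Fin m) : Prop :=
  2 ≤ c i ∧ Pi.single i 1 ∈ M.carrier ∧ Pi.single i 2 ∉ M.carrier

/-- `x_i x_j`, with `i ≠ j`, is a minimal generator of the complement of `M`. -/
def IsEdgeGenerator (M : Multicomplex c) (i j : Fin m) : Prop :=
  i ≠ j ∧ Pi.single i 1 ∈ M.carrier ∧ Pi.single j 1 ∈ M.carrier ∧
    Pi.single i 1 + Pi.single j 1 ∉ M.carrier

variable {M : Multicomplex c}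

theorem single_le_iff {i : Fin m} {k : ℕ} {a : Fin m → ℕ} :
    (Pi.single i k : Fin m → ℕ) ≤ a ↔ k ≤ a i := by
  constructor
  · intro h
    simpa using h i
  · intro h j
    by_cases hj : j = i
    · subst hj; simpa using h
    · simp [hj]

theorem single_add_single_le {i j : Fin m} (hij : i ≠ j) {a : Fin m → ℕ} (hi : 1 ≤ a i)
    (hj : 1 ≤ a j) : (Pi.single i 1 + Pi.single j 1 : Fin m → ℕ) ≤ a := by
  intro k
  by_cases hk : k = i
  · subst hk; simpa [hij] using hi
  · by_cases hk' : k = j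
    · subst hk'; simpa [hk] using hj
    · simp [hk, hk']

/-- In a flag Murai sphere, the complement of the multicomplex is generated by monomials of degree
at most two. -/
theorem notMem_iff (hK : IsFlag (muraiSphere M)) {a : Fin m → ℕ} (ha : a ≤ c) :
    a ∉ M.carrier ↔ (∃ i, IsVarGenerator M i ∧ 1 ≤ a i) ∨ (∃ i, IsSqGenerator M i ∧ 2 ≤ a i) ∨
      ∃ i j, IsEdgeGenerator M i j ∧ 1 ≤ a i ∧ 1 ≤ a j := by
  constructor
  · intro haM
    obtain ⟨b, hba, hb, hsum⟩ := exists_notMem_degree_le hK ha haM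
    by_contra! hcon
    obtain ⟨h1, h2, h3⟩ := hcon
    have hvar : ∀ i, 1 ≤ a i → (Pi.single i 1 : Fin m → ℕ) ∈ M.carrier := fun i hi => by
      by_contra hn
      exact absurd (h1 i hn) (by omega)
    rcases eq_of_sum_le_two hsum with h0 | ⟨p, hp, h0⟩ | ⟨p, q, hpq, hp, hq, h0⟩
    · exact hb (by rw [show b = 0 from funext h0]; exact M.zero_mem)
    · have hbp : b = Pi.single p (b p) := by
        ext i
        by_cases hi : i = p
        · subst hi; simp
        · simp [hi, h0 i hi]
      have hle : b p ≤ a p := hba p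
      have hac : a p ≤ c p := ha p
      rcases hp with hp | hp
      · rw [hbp, hp] at hb
        exact hb (hvar p (by omega))
      · rw [hbp, hp] at hb
        exact absurd (h2 p ⟨by omega, hvar p (by omega), hb⟩) (by omega)
    · have hbp : b = Pi.single p 1 + Pi.single q 1 := by
        ext i
        by_cases hi : i = p
        · subst hi; simp [hp, hpq]
        · by_cases hi' : i = q
          · subst hi'; simp [hq, hi]
          · simp [hi, hi', h0 i hi hi']
      have hle : b p ≤ a p := hba p
      have hle' : b q ≤ a q := hba q
      rw [hbp] at hb
      exact absurd (h3 p q ⟨hpq, hvar p (by omega), hvar q (by omega), hb⟩ (by omega)) (by omega)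
  · rintro (⟨i, hi, h1⟩ | ⟨i, ⟨-, -, hi⟩, h1⟩ | ⟨i, j, ⟨hij, -, -, hg⟩, h1, h2⟩) haM
    · exact hi (M.mem_of_le a haM _ (single_le_iff.2 h1))
    · exact hi (M.mem_of_le a haM _ (single_le_iff.2 h1))
    · exact hg (M.mem_of_le a haM _ (single_add_single_le hij h1 h2))

/-- A maximal member of the multicomplex is a maximal monomial divisible by no generator. -/
theorem isCover_of_maximal (hK : IsFlag (muraiSphere M)) {a : Fin m → ℕ}
    (ha : Maximal (· ∈ M.carrier) a) (hsum : ∑ i, (c i - a i) ≤ 2) :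
    IsCover c (IsVarGenerator M) (IsSqGenerator M) (IsEdgeGenerator M) fun i => c i - a i := by
  have hac : ∀ i, a i ≤ c i := M.le_of_mem a ha.1
  have haM := not_not.2 ha.1
  rw [notMem_iff hK hac] at haM
  push Not at haM
  obtain ⟨h1, h2, h3⟩ := haM
  refine ⟨hsum, fun i => by omega, fun i hi => ?_, fun i hi => ?_, fun i j hij => ?_, fun i hi => ?_⟩
  · have := h1 i hi
    omega
  · have := h2 i hi
    omega
  · have := h3 i j hij
    omega
  · have hi' := hac i
    -- by maximality, some generator divides `x^a x_i` but not `x^a`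
    have hup : Function.update a i (a i + 1) ∉ M.carrier := fun h => by
      have := ha.2 h (le_update_self_iff.2 (by omega)) i
      simp at this
    rw [notMem_iff hK (update_le_iff.2 ⟨by omega, fun j _ => hac j⟩)] at hup
    rcases hup with ⟨j, hj, hj1⟩ | ⟨j, hj, hj1⟩ | ⟨j, k, hjk, hj1, hk1⟩
    · have := h1 j hj
      by_cases hji : j = i
      · subst hji
        exact .inl ⟨hj, by omega⟩
      · simp only [ne_eq, hji, not_false_eq_true, Function.update_of_ne] at hj1
        omega
    · have := h2 j hj
      by_cases hji : j = i
      · subst hji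
        simp only [Function.update_self] at hj1
        exact .inr (.inl ⟨hj, by omega⟩)
      · simp only [ne_eq, hji, not_false_eq_true, Function.update_of_ne] at hj1
        omega
    · have h4 := h3 j k hjk
      have hkj : IsEdgeGenerator M k j := by
        obtain ⟨h5, h6, h7, h8⟩ := hjk
        exact ⟨h5.symm, h7, h6, by rwa [add_comm]⟩
      have hj2 := hac j
      have hk2 := hac k
      by_cases hji : j = i
      · subst hji
        have hne : k ≠ j := hjk.1.symm
        simp only [ne_eq, hne, not_false_eq_true, Function.update_of_ne] at hk1
        exact .inr (.inr ⟨by omega, k, hjk, by omega⟩)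
      · simp only [ne_eq, hji, not_false_eq_true, Function.update_of_ne] at hj1
        by_cases hki : k = i
        · subst hki
          exact .inr (.inr ⟨by omega, j, hkj, by omega⟩)
        · simp only [ne_eq, hki, not_false_eq_true, Function.update_of_ne] at hk1
          omega

/-- The minimal non-faces of a flag Murai sphere restrict the generators: cardinality at most two
bounds the codegree of the maximal members, and rules out `c_i ≥ 2` for a variable in no generator. -/
theorem isFlagGenerators (hK : IsFlag (muraiSphere M)) (hM : M.IsProper) (hc : ∀ i, 1 ≤ c i) :
    IsFlagGenerators c (IsVarGenerator M) (IsSqGenerator M) (IsEdgeGenerator M) where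
  pos := hc
  symm := fun i j ⟨h1, h2, h3, h4⟩ => ⟨h1.symm, h3, h2, by rwa [add_comm]⟩
  irrefl i h := h.1 rfl
  not_sq i h1 h2 := h1 h2.2.1
  not_edge i j h1 h2 := h1 h2.2.1
  two_le i h := h.1
  free i hi := by
    by_contra! hcon
    obtain ⟨h1, h2, h3⟩ := hcon
    rcases row_condition hK hi with h | h
    · have hle : Function.update (0 : Fin m → ℕ) i (c i) ≤ c :=
        update_le_iff.2 ⟨le_rfl, fun _ _ => Nat.zero_le _⟩
      rw [notMem_iff hK hle] at h
      have key : ∀ j, 1 ≤ Function.update (0 : Fin m → ℕ) i (c i) j → j = i := fun j hj => by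
        by_contra hji
        simp [hji] at hj
      rcases h with ⟨j, hj, hj1⟩ | ⟨j, hj, hj1⟩ | ⟨j, k, hjk, hj1, hk1⟩
      · exact h1 (key j hj1 ▸ hj)
      · exact h2 (key j (by omega) ▸ hj)
      · exact h3 k (key j hj1 ▸ hjk)
    · have hcM := hM.notMem
      rw [notMem_iff hK le_rfl] at hcM
      refine absurd h ?_
      rw [notMem_iff hK (update_le_self_iff.2 (Nat.zero_le _))]
      have key : ∀ j, j ≠ i → Function.update c i 0 j = c j := fun j hj => by simp [hj]
      rcases hcM with ⟨j, hj, hj1⟩ | ⟨j, hj, hj1⟩ | ⟨j, k, hjk, hj1, hk1⟩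
      · exact .inl ⟨j, hj, by rwa [key j fun e => h1 (e ▸ hj)]⟩
      · exact .inr (.inl ⟨j, hj, by rwa [key j fun e => h2 (e ▸ hj)]⟩)
      · refine .inr (.inr ⟨j, k, hjk, by rwa [key j fun e => h3 k (e ▸ hjk)], ?_⟩)
        rw [key k fun e => h3 j ?_]
        · exact hk1
        · obtain ⟨h5, h6, h7, h8⟩ := hjk
          subst e
          exact ⟨h5.symm, h7, h6, by rwa [add_comm]⟩
  nonempty := by
    rcases (notMem_iff hK le_rfl).1 hM.notMem with ⟨j, hj, -⟩ | ⟨j, hj, -⟩ | ⟨j, k, hjk, -⟩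
    · exact .inl ⟨j, hj⟩
    · exact .inr (.inl ⟨j, hj⟩)
    · exact .inr (.inr ⟨j, k, hjk⟩)
  cover := by
    obtain ⟨a, -, ha, hsum⟩ := exists_maximal_codegree_le hK hM M.zero_mem
    exact ⟨_, isCover_of_maximal hK ha hsum⟩
  cover_lt p hp := by
    obtain ⟨a, hle, ha, hsum⟩ := exists_maximal_codegree_le hK hM (not_not.1 hp)
    refine ⟨_, isCover_of_maximal hK ha hsum, ?_⟩
    have h1 := single_le_iff.1 hle
    have h2 : a p ≤ c p := M.le_of_mem a ha.1 p
    omega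

/-- A flag Murai sphere is the join of a cross-polytope with one of four complexes. -/
theorem exists_complexIso_of_isFlag (hK : IsFlag (muraiSphere M)) (hM : M.IsProper)
    (hc : ∀ i, 1 ≤ c i) :
    (∃ n, ComplexIso (muraiSphere M)
      (generatedBy (Set.range (joinFamily (cubeFamily (Fin n)) pointFamily)))) ∨
    (∃ n, ComplexIso (muraiSphere M)
      (generatedBy (Set.range (joinFamily (cubeFamily (Fin n)) (polygonFamily 5))))) ∨
    (∃ n, ComplexIso (muraiSphere M)
      (generatedBy (Set.range (joinFamily (cubeFamily (Fin n)) (polygonFamily 6))))) ∨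
    ∃ n, ComplexIso (muraiSphere M)
      (generatedBy (Set.range (joinFamily (cubeFamily (Fin n)) cutCubeFamily))) := by
  have hgen := isFlagGenerators hK hM hc
  obtain ⟨r, c₀, S, L, G, hcore, ρ, hρ, hc₀, hs, hl, hg⟩ := hgen.hasFlagCore
  have hfree : ∀ i, (∀ j, ρ j ≠ i) → c i = 1 := by
    intro i hi
    by_contra hne
    have hci := hc i
    rcases hgen.free i (by omega) with h | h | ⟨j, h⟩
    · obtain ⟨x, -, hx⟩ := (hs i).1 h
      exact hi x hx
    · obtain ⟨x, -, hx⟩ := (hl i).1 h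
      exact hi x hx
    · obtain ⟨e, -, ⟨hx, -⟩ | ⟨-, hx⟩⟩ := (hg i j).1 h
      · exact hi _ hx
      · exact hi _ hx
  have hmem : ∀ a, a ≤ c → (a ∈ M.carrier ↔ AvoidsQuadrics S L G fun i => a (ρ i)) := by
    intro a ha
    rw [← not_iff_not, notMem_iff hK ha]
    simp only [hs, hl, hg, AvoidsQuadrics]
    constructor
    · rintro (⟨i, ⟨x, hx, rfl⟩, h⟩ | ⟨i, ⟨x, hx, rfl⟩, h⟩ |
        ⟨i, j, ⟨e, he, ⟨rfl, rfl⟩ | ⟨rfl, rfl⟩⟩, h⟩) ⟨h1, h2, h3⟩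
      · have := h1 x hx; omega
      · have := h2 x hx; omega
      · have := h3 e he; omega
      · have := h3 e he; omega
    · intro h
      by_contra! hcon
      obtain ⟨h1, h2, h3⟩ := hcon
      refine h ⟨fun x hx => ?_, fun x hx => ?_, fun e he => ?_⟩
      · have := h1 _ ⟨x, hx, rfl⟩; omega
      · have := h2 _ ⟨x, hx, rfl⟩; omega
      · have := h3 (ρ e.1) (ρ e.2) ⟨e, he, .inl ⟨rfl, rfl⟩⟩; omega
  rcases hcore with h | ⟨φ, h⟩ | ⟨φ, h⟩ | ⟨φ, h⟩
  · exact .inl (exists_complexIso_of_core hK hM isClosedFamily_point isFlagFamily_point h ρ hρ hc₀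
      hfree hmem)
  · exact .inr (.inl (exists_complexIso_of_core hK hM isClosedFamily_five isFlagFamily_five h ρ hρ
      hc₀ hfree hmem))
  · exact .inr (.inr (.inl (exists_complexIso_of_core hK hM isClosedFamily_six isFlagFamily_six h ρ
      hρ hc₀ hfree hmem)))
  · exact .inr (.inr (.inr (exists_complexIso_of_core hK hM isClosedFamily_cutCube
      isFlagFamily_cutCube h ρ hρ hc₀ hfree hmem)))

theorem nonempty_faces (hM : M.IsProper) (hc : ∀ i, 1 ≤ c i) (hc2 : 2 ≤ ∑ i, c i) :
    (muraiSphere M).faces.Nonempty := by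
  suffices h : ∃ v, {v, v} ∈ (muraiSphere M).faces by
    obtain ⟨v, hv⟩ := h
    exact ⟨_, hv⟩
  simp only [pair_mem_muraiSphere_iff]
  by_cases h2 : ∃ i, 2 ≤ c i
  · obtain ⟨i, hi⟩ := h2
    exact ⟨⟨i, ⟨1, by omega⟩⟩, ⟨0, M.zero_mem, by simp⟩, c, le_rfl, hM.notMem, by dsimp only; omega,
      by dsimp only; omega⟩
  push Not at h2
  have hm : ∑ i, c i ≤ ∑ _i : Fin m, 1 := Finset.sum_le_sum fun i _ => by have := h2 i; omega
  rw [Finset.sum_const, Finset.card_univ, Fintype.card_fin, smul_eq_mul, mul_one] at hm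
  let i : Fin m := ⟨0, by omega⟩
  let j : Fin m := ⟨1, by omega⟩
  have hij : j ≠ i := by simp [i, j, Fin.ext_iff]
  have hci : c i = 1 := le_antisymm (by have := h2 i; omega) (hc i)
  have hcj : c j = 1 := le_antisymm (by have := h2 j; omega) (hc j)
  by_cases hb : Function.update c i 0 ∈ M.carrier
  · have hj : Pi.single j 1 ∈ M.carrier :=
      M.mem_of_le _ hb _ (single_le_iff.2 (by simp [hij, hcj]))
    exact ⟨⟨j, ⟨0, by omega⟩⟩, ⟨_, hj, by simp⟩, c, le_rfl, hM.notMem, by dsimp only; omega,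
      by dsimp only; omega⟩
  · exact ⟨⟨i, ⟨1, by omega⟩⟩, ⟨0, M.zero_mem, by simp⟩, _, update_le_self_iff.2 (Nat.zero_le _), hb,
      by simp⟩

end Flag
end MuraiSphere

theorem mainTheorem1 {m : ℕ} (c : Fin m → ℕ) (hc : ∀ i, 1 ≤ c i) (hc2 : 2 ≤ ∑ i, c i)
    (M : MuraiSphere.Multicomplex c) (hM : M.IsProper) :
    (MuraiSphere.IsFlag (MuraiSphere.muraiSphere M) ↔
      MuraiSphere.IsPolytopalSphere (MuraiSphere.muraiSphere M) ∧
        ∃ (d : ℕ) (P : Set (Fin d → ℝ)),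
          MuraiSphere.IsNerveComplexOf (MuraiSphere.muraiSphere M) P ∧
            MuraiSphere.IsListed P) ∧
    (∀ (d : ℕ) (P : Set (Fin d → ℝ)),
      MuraiSphere.IsNerveComplexOf (MuraiSphere.muraiSphere M) P →
        MuraiSphere.IsListed P → MuraiSphere.IsFlagNestohedron P) := by
  open MuraiSphere in
  refine ⟨⟨fun hK => ?_, ?_⟩, fun d P hP hL => ?_⟩
  · rcases exists_complexIso_of_isFlag hK hM hc with ⟨n, h⟩ | ⟨n, h⟩ | ⟨n, h⟩ | ⟨n, h⟩
    · -- the complex of a point has no nonempty faces, unlike the Murai sphere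
      have hn : 1 ≤ n := by
        by_contra hn
        obtain rfl : n = 0 := by omega
        obtain ⟨e⟩ := h
        obtain ⟨σ, hσ⟩ := nonempty_faces hM hc hc2
        obtain ⟨τ, ⟨x | x, -⟩, -⟩ := e ⟨σ, hσ⟩
        · exact x.1.elim0
        · exact x.elim
      obtain ⟨h1, d, P, h2, h3⟩ := (IsFlagModel.cube n).exists_isNerveComplexOf hn h
      exact ⟨h1, d, P, h2, .inl ⟨n, hn, h3⟩⟩
    · obtain ⟨h1, d, P, h2, h3⟩ :=
        (IsFlagModel.pentagon.cube_prod n).exists_isNerveComplexOf (by omega) h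
      exact ⟨h1, d, P, h2, .inr (.inl ⟨n, h3⟩)⟩
    · obtain ⟨h1, d, P, h2, h3⟩ :=
        (IsFlagModel.hexagon.cube_prod n).exists_isNerveComplexOf (by omega) h
      exact ⟨h1, d, P, h2, .inr (.inr (.inl ⟨n, h3⟩))⟩
    · obtain ⟨h1, d, P, h2, h3⟩ :=
        (IsFlagModel.cutCube.cube_prod n).exists_isNerveComplexOf (by omega) h
      exact ⟨h1, d, P, h2, .inr (.inr (.inr ⟨n, h3⟩))⟩
  · rintro ⟨-, d, P, hP, ⟨n, -, h⟩ | ⟨n, h⟩ | ⟨n, h⟩ | ⟨n, h⟩⟩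
    · exact (IsFlagModel.cube n).isFlag hP h
    · exact (IsFlagModel.pentagon.cube_prod n).isFlag hP h
    · exact (IsFlagModel.hexagon.cube_prod n).isFlag hP h
    · exact (IsFlagModel.cutCube.cube_prod n).isFlag hP h
  · rcases hL with ⟨n, -, h⟩ | ⟨n, h⟩ | ⟨n, h⟩ | ⟨n, h⟩
    · exact (IsFlagModel.cube n).isFlagNestohedron hP h
    · exact (IsFlagModel.pentagon.cube_prod n).isFlagNestohedron hP h
    · exact (IsFlagModel.hexagon.cube_prod n).isFlagNestohedron hP h
    · exact (IsFlagModel.cutCube.cube_prod n).isFlagNestohedron hP h
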